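/- Let $n\ge 1$, and let $\mathbb{Z}^n_0$ be the lattice of integer vectors of length $n$ whose coordinates sum to zero. For a finite directed multigraph $G$ on the vertex set $\{1,\dots,n\}$ (loops and multiple edges allowed), with $d_{vw}$ edges from $v$ to $w$ and outdegrees $d_v=\sum_w d_{vw}$, the Laplacian of $G$ is the $n\times n$ matrix $\Delta$ with $\Delta_{vw}=-d_{wv}$ for $v\ne w$ and $\Delta_{vv}=d_v-d_{vv}$. For every $(n-1)$-dimensional lattice $L\subset\mathbb{Z}^n_0$ there is a strongly connected finite directed multigraph on $\{1,\dots,n\}$ whose Laplacian $\Delta$ satisfies $L=\Delta\mathbb{Z}^n$. Moreover, $\Delta$ can be chosen (depending on $L$ only) such that all its entries are bounded in absolute value by $n\cdot\det L$, where $\det L=[\mathbb{Z}^n_0:L]$ (equivalently, the absolute value of the determinant of the matrix obtained by deleting the last row from a matrix whose columns are a $\mathbb{Z}$-basis of $L$), and such that $\Delta$ is computable from any $\mathbb{Z}$-basis of $L$ in time polynomial in the length of the binary description of the basis (by one algorithm for all $n$ and $L$; time is measured as logarithmic cost on a random access machine, which agrees with Turing machine time up to a polynomial). -/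

import Mathlib

/-- A finite directed multigraph on the vertex set `V`: every edge has a tail and a head;
loops and multiple edges are allowed. -/
structure DiMultigraph (V : Type) where
  /-- The type of edges. -/
  E : Type
  /-- There are finitely many edges. -/
  finiteE : Finite E
  /-- The vertex an edge leaves. -/
  tail : E → V
  /-- The vertex an edge enters. -/
  head : E → V

namespace DiMultigraph

variable {V : Type}

/-- The number of edges from `v` to `w`. -/
noncomputable def mult (G : DiMultigraph V) (v w : V) : ℕ :=
  Nat.card {e : G.E // G.tail e = v ∧ G.head e = w}

/-- The outdegree of `v` (loops included). -/
noncomputable def outdeg (G : DiMultigraph V) (v : V) : ℕ :=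
  Nat.card {e : G.E // G.tail e = v}

/-- For all vertices `v` and `w` there is a directed path from `v` to `w`. -/
def StronglyConnected (G : DiMultigraph V) : Prop :=
  ∀ v w : V, Relation.ReflTransGen (fun a b => ∃ e : G.E, G.tail e = a ∧ G.head e = b) v w

/-- The graph Laplacian: off the diagonal, the entry in row `v` and column `w` is minus the number
of edges from `w` to `v`; the diagonal entry at `v` is the outdegree of `v` minus the number of
loops at `v`. -/
noncomputable def laplacian [DecidableEq V] (G : DiMultigraph V) : Matrix V V ℤ :=
  Matrix.of fun v w => if v = w then (G.outdeg v : ℤ) - (G.mult v v : ℤ) else -(G.mult w v : ℤ)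

end DiMultigraph

/-- The lattice of all integer vectors of length `n` with coordinate sum zero. -/
def sumZero (n : ℕ) : Submodule ℤ (Fin n → ℤ) where
  carrier := {x | ∑ i, x i = 0}
  zero_mem' := by simp
  add_mem' := by
    intro a b ha hb
    simp only [Set.mem_ofPred_eq] at ha hb ⊢
    simp [Finset.sum_add_distrib, ha, hb]
  smul_mem' := by
    intro c a ha
    simp only [Set.mem_ofPred_eq] at ha ⊢
    simp [← Finset.mul_sum, ha]

/-- The determinant of a lattice `L` of rank `n - 1` contained in `sumZero n`: its index in
`sumZero n`. Deleting the last coordinate identifies `sumZero n` with `ℤ ^ (n - 1)`, so this is the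
absolute value of the determinant of any matrix that arises by deleting the last row from a matrix
whose columns are a basis of `L`. -/
noncomputable def latticeDet {n : ℕ} (L : Submodule ℤ (Fin n → ℤ)) : ℕ :=
  L.toAddSubgroup.relIndex (sumZero n).toAddSubgroup

/-! The model of computation is the random access machine over the integers, with an input tape,
an output tape, indirect addressing, and the logarithmic cost criterion: an instruction costs the
total bit length of the addresses and numbers that it handles. -/

namespace RAM

/-- Instructions of a random access machine with registers `r 0, r 1, r 2, …`. -/
inductive Instr where
  /-- `r i := z`. -/
  | const (i : ℕ) (z : ℤ)
  /-- `r i := r j + r k`. -/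
  | add (i j k : ℕ)
  /-- `r i := r j - r k`. -/
  | sub (i j k : ℕ)
  /-- `r i := r j * r k`. -/
  | mul (i j k : ℕ)
  /-- `r i := r j / r k`, the integer quotient (`0` if `r k = 0`). -/
  | div (i j k : ℕ)
  /-- `r i := r (r j)`, where a negative address counts as `0`. -/
  | load (i j : ℕ)
  /-- `r (r i) := r j`, where a negative address counts as `0`. -/
  | store (i j : ℕ)
  /-- Go to instruction number `l`. -/
  | jump (l : ℕ)
  /-- Go to instruction number `l` if `r i = 0`. -/
  | jzero (i l : ℕ)
  /-- Go to instruction number `l` if `r i < 0`. -/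
  | jneg (i l : ℕ)
  /-- Read the next integer of the input tape into `r i` (`0` if there is none left). -/
  | read (i : ℕ)
  /-- Write `r i` onto the output tape. -/
  | write (i : ℕ)

/-- A program is a finite list of instructions, numbered from `0`. -/
abbrev Program := List Instr

/-- A configuration of the machine. -/
structure Config where
  /-- The number of the next instruction. -/
  pc : ℕ
  /-- The contents of the registers. -/
  reg : ℕ → ℤ
  /-- The part of the input that has not been read yet. -/
  input : List ℤ
  /-- What has been written so far. -/
  output : List ℤ

/-- The initial configuration: all registers are `0`, nothing has been written. -/
def init (inp : List ℤ) : Config := ⟨0, fun _ => 0, inp, []⟩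

/-- The length of an integer: the number of binary digits of its absolute value, plus one (for the
sign). -/
def len (z : ℤ) : ℕ := z.natAbs.size + 1

/-- The effect of the assignment `r i := z`, followed by passing to the next instruction. -/
def Config.assign (c : Config) (i : ℕ) (z : ℤ) : Config :=
  { c with pc := c.pc + 1, reg := Function.update c.reg i z }

/-- The effect of one instruction. -/
def exec : Instr → Config → Config
  | .const i z, c => c.assign i z
  | .add i j k, c => c.assign i (c.reg j + c.reg k)
  | .sub i j k, c => c.assign i (c.reg j - c.reg k)
  | .mul i j k, c => c.assign i (c.reg j * c.reg k)
  | .div i j k, c => c.assign i (c.reg j / c.reg k)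
  | .load i j, c => c.assign i (c.reg (c.reg j).toNat)
  | .store i j, c => c.assign (c.reg i).toNat (c.reg j)
  | .jump l, c => { c with pc := l }
  | .jzero i l, c => { c with pc := if c.reg i = 0 then l else c.pc + 1 }
  | .jneg i l, c => { c with pc := if c.reg i < 0 then l else c.pc + 1 }
  | .read i, c => { c.assign i (c.input.headD 0) with input := c.input.tail }
  | .write i, c => { c with pc := c.pc + 1, output := c.output ++ [c.reg i] }

/-- The logarithmic cost of one instruction: the total length of the register addresses and of the
operands that it uses. -/
def cost : Instr → Config → ℕ
  | .const i z, _ => len i + len z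
  | .add i j k, c => len i + len j + len k + len (c.reg j) + len (c.reg k)
  | .sub i j k, c => len i + len j + len k + len (c.reg j) + len (c.reg k)
  | .mul i j k, c => len i + len j + len k + len (c.reg j) + len (c.reg k)
  | .div i j k, c => len i + len j + len k + len (c.reg j) + len (c.reg k)
  | .load i j, c => len i + len j + len (c.reg j) + len (c.reg (c.reg j).toNat)
  | .store i j, c => len i + len j + len (c.reg i) + len (c.reg j)
  | .jump _, _ => 1
  | .jzero i _, c => len i + len (c.reg i)
  | .jneg i _, c => len i + len (c.reg i)
  | .read i, c => len i + len (c.input.headD 0)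
  | .write i, c => len i + len (c.reg i)

/-- `Run p c t c'`: the program `p`, started in the configuration `c`, halts in the configuration
`c'`, and the total cost of the instructions executed is `t`. The machine halts when there is no
instruction with the current number. -/
inductive Run (p : Program) : Config → ℕ → Config → Prop
  | halt (c : Config) (h : p[c.pc]? = none) : Run p c 0 c
  | step (c c' : Config) (ins : Instr) (t : ℕ) (h : p[c.pc]? = some ins)
      (hr : Run p (exec ins c) t c') : Run p c (cost ins c + t) c'

/-- On the input `inp` the program `p` halts with output `out` in time at most `T`. -/
def OutputsInTime (p : Program) (inp out : List ℤ) (T : ℕ) : Prop :=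
  ∃ (t : ℕ) (c : Config), Run p (init inp) t c ∧ c.output = out ∧ t ≤ T

/-- The length of a list of integers on the tape. -/
def size (inp : List ℤ) : ℕ := (inp.map len).sum

end RAM

/-- The description of a finite family of vectors of length `n`: the number `n`, followed by the
coordinates of the vectors, one vector after the other. -/
def encodeVectors {m n : ℕ} (b : Fin m → Fin n → ℤ) : List ℤ :=
  (n : ℤ) :: (List.ofFn fun j => List.ofFn fun i => b j i).flatten

/-- The description of a matrix: its entries, row after row. -/
def encodeMatrix {m n : ℕ} (A : Matrix (Fin m) (Fin n) ℤ) : List ℤ :=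
  (List.ofFn fun i => List.ofFn fun j => A i j).flatten

/-!
Every lattice of full rank in the vectors of sum zero is the lattice of a Laplacian, and a Laplacian
can be computed from a basis in polynomial time.

*The Laplacian.* Let `m = n - 1`, and let `D` be the determinant of `L`. Deletion of the last
coordinate (`proj`) turns `L` into a lattice `Λ` of index `D` in `ℤ ^ m`, so `Λ` contains `D` times
every unit vector. Its Hermite normal form `H` (`IsHNF`) is upper triangular, with nonnegative entries
that are at most `D`. It is extended by a last column with entries in `[0, D)` that makes all row sums
divisible by `D`, and by a last row `(0, …, 0, D)` (`extMat`). The row `a < m` contains the numbers of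
edges that leave the vertex `a + 1`, and the last row those of the vertex `0`; the entry of the vertex
itself is disregarded. Modulo `D`, the column `a + 1` of the Laplacian is the negative of the row `a`
of `H`, and it vanishes above the pivot. So the columns of the Laplacian are in `L`, and up to sign
the columns `1, …, m` are a triangular basis of `Λ` with the smallest possible pivots
(`triBasis_negCols`), which generates (`TriBasis.span_eq`). The pivots give edges from `a + 1` to `a`,
and the last row gives an edge from `0` to `m`, so the graph contains a Hamiltonian cycle
(`exists_digraph`). Since the Hermite normal form is unique (`IsHNF.unique`), this Laplacian depends on
`L` only.

*The algorithm.* The Euclidean algorithm on the rows of a matrix is run with all entries reduced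
modulo a number `T`, so that the numbers stay small (`wp_eliminate`). In a first pass `T` exceeds twice
the absolute value of the determinant of the basis. The division steps preserve this determinant modulo
`T` up to sign (`wp_pass_det`), so that its absolute value `D` can be read off from the triangular
matrix (`abs_of_residue`). The second pass is applied to the rows of the basis and the multiples by `D`
of the unit vectors, with `T = D`. Here the reduction modulo `D` is an operation on the rows as well, so
that the generated lattice is preserved (`wp_pass_lattice`), and the result is a triangular basis of
`Λ`. Reduction of the entries above the pivots gives the Hermite normal form.

*Verification.* The program is written in a structured language with expressions, a two-dimensional
memory and loops. Its weakest preconditions `wp X N` contain the bounds `X` for the assigned values and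
`N` for the numbers of rounds of the loops; everything else about the running time is independent of
the program. The compiler into the random access machine is correct (`Stmt.comp_spec`), and the
running time of the compiled program is at most a polynomial in `N` times the bit length of `X`, up to
constants (`exists_outputsInTime`).
-/

namespace Prog

open RAM

/-! ### A structured programming language -/

/-- A state of the structured language: integer variables, a two-dimensional integer memory, the
unread input and the output written so far. -/
structure St where
  /-- The values of the variables. -/
  var : ℕ → ℤ
  /-- The contents of the two-dimensional memory. -/
  mem : ℕ → ℕ → ℤ
  /-- The part of the input that has not been read yet. -/
  inp : List ℤ
  /-- What has been written so far. -/
  out : List ℤ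

/-- Assignment of a value to a variable. -/
def St.set (σ : St) (x : ℕ) (v : ℤ) : St := { σ with var := Function.update σ.var x v }

/-- Assignment of a value to a memory cell. -/
def St.put (σ : St) (r c : ℕ) (v : ℤ) : St :=
  { σ with mem := fun r' c' => if r' = r ∧ c' = c then v else σ.mem r' c' }

/-- Integer expressions. In `ld r c` (and in memory writes) the absolute values of the indices are
used. -/
inductive Expr where
  | const (z : ℤ)
  | var (x : ℕ)
  | ld (r c : Expr)
  | add (a b : Expr)
  | sub (a b : Expr)
  | mul (a b : Expr)
  | div (a b : Expr)

/-- The value of an expression in a state. -/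
def Expr.eval (σ : St) : Expr → ℤ
  | .const z => z
  | .var x => σ.var x
  | .ld r c => σ.mem (r.eval σ).natAbs (c.eval σ).natAbs
  | .add a b => a.eval σ + b.eval σ
  | .sub a b => a.eval σ - b.eval σ
  | .mul a b => a.eval σ * b.eval σ
  | .div a b => a.eval σ / b.eval σ

/-- An exponent `k` such that all numbers arising in the evaluation of the expression are at most
`X ^ k` in absolute value if `2 ≤ X` bounds the variables and the memory. -/
def Expr.sz : Expr → ℕ
  | .const z => z.natAbs + 1
  | .var _ => 1
  | .ld r c => 6 * r.sz + 6 * c.sz + 3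
  | .add a b => a.sz + b.sz
  | .sub a b => a.sz + b.sz
  | .mul a b => a.sz + b.sz
  | .div a b => a.sz + b.sz

/-- Remainder of the integer division. -/
def Expr.mod (a b : Expr) : Expr := .sub a (.mul (.div a b) b)

/-- Structured programs. The statement `loop h e s` repeats `s` as often as the counter, with
initial value `e`, is positive, where the counter is halved (if `h` is true) or decremented (if `h`
is false) after every round. -/
inductive Stmt where
  | assign (x : ℕ) (e : Expr)
  | store (r c e : Expr)
  | read (x : ℕ)
  | write (e : Expr)
  | seq (s t : Stmt)
  | ifnz (e : Expr) (s : Stmt)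
  | loop (h : Bool) (e : Expr) (s : Stmt)

/-- An exponent as in `Expr.sz` for a whole program. -/
def Stmt.sz : Stmt → ℕ
  | .assign _ e => e.sz
  | .store r c e => 6 * r.sz + 6 * c.sz + 3 + e.sz
  | .read _ => 1
  | .write e => e.sz
  | .seq s t => s.sz + t.sz
  | .ifnz e s => e.sz + s.sz
  | .loop _ e s => e.sz + s.sz

/-- The number of rounds of a loop with initial counter `v`. -/
def cnt (h : Bool) (v : ℤ) : ℕ := if h then v.toNat.size else v.toNat

/-- Weakest preconditions: running the statement from the state `σ` leads to a state that satisfies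
`Q`, all values assigned on the way are at most `X` in absolute value, and no loop has more than `N`
rounds. -/
def wp (X N : ℕ) : Stmt → (St → Prop) → St → Prop
  | .assign x e, Q, σ => (e.eval σ).natAbs ≤ X ∧ Q (σ.set x (e.eval σ))
  | .store r c e, Q, σ => (e.eval σ).natAbs ≤ X ∧
      Q (σ.put (r.eval σ).natAbs (c.eval σ).natAbs (e.eval σ))
  | .read x, Q, σ => (σ.inp.headD 0).natAbs ≤ X ∧
      Q { σ.set x (σ.inp.headD 0) with inp := σ.inp.tail }
  | .write e, Q, σ => Q { σ with out := σ.out ++ [e.eval σ] }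
  | .seq s t, Q, σ => wp X N s (fun τ => wp X N t Q τ) σ
  | .ifnz e s, Q, σ => (e.eval σ ≠ 0 → wp X N s Q σ) ∧ (e.eval σ = 0 → Q σ)
  | .loop h e s, Q, σ => cnt h (e.eval σ) ≤ N ∧
      ((fun R τ => wp X N s R τ)^[cnt h (e.eval σ)] Q) σ

theorem wp_mono {X N : ℕ} (s : Stmt) {Q R : St → Prop} (h : ∀ τ, Q τ → R τ) {σ : St}
    (hs : wp X N s Q σ) : wp X N s R σ := by
  induction s generalizing Q R σ with
  | assign x e => exact ⟨hs.1, h _ hs.2⟩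
  | store r c e => exact ⟨hs.1, h _ hs.2⟩
  | read x => exact ⟨hs.1, h _ hs.2⟩
  | write e => exact h _ hs
  | seq s t ihs iht => exact ihs (fun τ hτ => iht h hτ) hs
  | ifnz e s ih => exact ⟨fun h0 => ih h (hs.1 h0), fun h0 => h _ (hs.2 h0)⟩
  | loop b e s ih =>
    refine ⟨hs.1, ?_⟩
    have key : ∀ k (Q R : St → Prop), (∀ τ, Q τ → R τ) → ∀ τ,
        ((fun R τ => wp X N s R τ)^[k] Q) τ → ((fun R τ => wp X N s R τ)^[k] R) τ := by
      intro k
      induction k with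
      | zero => intro Q R h τ; exact h τ
      | succ k ihk =>
        intro Q R h τ
        simp only [Function.iterate_succ, Function.comp]
        exact ihk _ _ (fun τ hτ => ih h hτ) τ
    exact key _ _ _ h _ hs.2

/-- The rule for loops with an invariant indexed by the number of rounds. -/
theorem wp_loop {X N : ℕ} {b : Bool} {e : Expr} {s : Stmt} {Q : St → Prop} {σ : St}
    (I : ℕ → St → Prop) (M : ℕ) (hM : cnt b (e.eval σ) = M) (hN : M ≤ N) (h0 : I 0 σ)
    (hs : ∀ i τ, i < M → I i τ → wp X N s (I (i + 1)) τ) (hQ : ∀ τ, I M τ → Q τ) :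
    wp X N (.loop b e s) Q σ := by
  refine ⟨hM ▸ hN, ?_⟩
  rw [hM]
  have key : ∀ k i, i + k = M → ∀ τ, I i τ → ((fun R τ => wp X N s R τ)^[k] Q) τ := by
    intro k
    induction k with
    | zero => intro i hi τ h; exact hQ τ (by simpa [← hi] using h)
    | succ k ih =>
      intro i hi τ h
      rw [Function.iterate_succ_apply']
      exact wp_mono s (fun τ' h' => ih (i + 1) (by omega) τ' h') (hs i τ (by omega) h)
  exact key M 0 (by omega) σ h0

/-! ### Compilation -/

/-- With the indices `r` and `c` in the temporary registers `d` and `d + 1`, this code computes the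
address of the memory cell `(r, c)` into the temporary register `d`. The address is polynomial in
the squares of the indices, and injective in them. -/
def addrCode (d : ℕ) : List Instr :=
  [.mul (3*d+1) (3*d+1) (3*d+1), .mul (3*(d+1)+1) (3*(d+1)+1) (3*(d+1)+1),
   .add (3*d+1) (3*d+1) (3*(d+1)+1), .mul (3*d+1) (3*d+1) (3*d+1),
   .add (3*d+1) (3*d+1) (3*(d+1)+1), .const (3*(d+1)+1) 3,
   .mul (3*d+1) (3*d+1) (3*(d+1)+1), .const (3*(d+1)+1) 2, .add (3*d+1) (3*d+1) (3*(d+1)+1)]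

/-- The code that computes an expression into the temporary register `d`, using the temporary
registers from `d` on. The temporary registers are those with address `1` modulo `3`, the variables
have the addresses `0` modulo `3`, and the memory the addresses `2` modulo `3`. -/
def Expr.comp : Expr → ℕ → List Instr
  | .const z, d => [.const (3*d+1) z]
  | .var x, d => [.const (3*d+1) 0, .add (3*d+1) (3*x) (3*d+1)]
  | .ld r c, d => r.comp d ++ (c.comp (d+1) ++ (addrCode d ++ [.load (3*d+1) (3*d+1)]))
  | .add a b, d => a.comp d ++ (b.comp (d+1) ++ [.add (3*d+1) (3*d+1) (3*(d+1)+1)])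
  | .sub a b, d => a.comp d ++ (b.comp (d+1) ++ [.sub (3*d+1) (3*d+1) (3*(d+1)+1)])
  | .mul a b, d => a.comp d ++ (b.comp (d+1) ++ [.mul (3*d+1) (3*d+1) (3*(d+1)+1)])
  | .div a b, d => a.comp d ++ (b.comp (d+1) ++ [.div (3*d+1) (3*d+1) (3*(d+1)+1)])

/-- The instruction that updates a loop counter. -/
def nextInstr (h : Bool) (d : ℕ) : Instr :=
  if h then .div (3*d+1) (3*d+1) (3*(d+1)+1) else .sub (3*d+1) (3*d+1) (3*(d+1)+1)

/-- The code of a statement, placed at the position `b` of the program, using the temporary registers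
from `d` on. -/
def Stmt.comp : Stmt → ℕ → ℕ → List Instr
  | .assign x e, _, d => e.comp d ++ [.const (3*(d+1)+1) 0, .add (3*x) (3*d+1) (3*(d+1)+1)]
  | .store r c e, _, d => r.comp d ++ (c.comp (d+1) ++ (addrCode d ++
      (e.comp (d+1) ++ [.store (3*d+1) (3*(d+1)+1)])))
  | .read x, _, _ => [.read (3*x)]
  | .write e, _, d => e.comp d ++ [.write (3*d+1)]
  | .seq s t, b, d => s.comp b d ++ t.comp (b + (s.comp b d).length) d
  | .ifnz e s, b, d =>
      e.comp d ++ (.jzero (3*d+1) (b + (e.comp d).length + 1 +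
        (s.comp (b + (e.comp d).length + 1) d).length) :: s.comp (b + (e.comp d).length + 1) d)
  | .loop h e s, b, d =>
      let body := s.comp (b + (e.comp d).length + 2) (d+1)
      let fin := b + (e.comp d).length + 2 + body.length + 3
      e.comp d ++ (.jneg (3*d+1) fin :: .jzero (3*d+1) fin :: (body ++
        [.const (3*(d+1)+1) (if h then 2 else 1), nextInstr h d, .jump (b + (e.comp d).length)]))

/-- The code `l` is found in the program `p` from position `b` on. -/
def CodeAt (p : Program) : ℕ → List Instr → Prop
  | _, [] => True
  | b, i :: l => p[b]? = some i ∧ CodeAt p (b + 1) l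

theorem codeAt_append {p : Program} {b : ℕ} {l l' : List Instr} :
    CodeAt p b (l ++ l') ↔ CodeAt p b l ∧ CodeAt p (b + l.length) l' := by
  induction l generalizing b with
  | nil => simp [CodeAt]
  | cons i l ih => simp [CodeAt, ih, and_assoc, Nat.add_assoc, Nat.add_comm 1]

theorem codeAt_self (l p : List Instr) : CodeAt (p ++ l) p.length l := by
  induction l generalizing p with
  | nil => trivial
  | cons i l ih => exact ⟨by simp, by simpa using ih (p ++ [i])⟩

/-- All registers and input numbers are at most `B` in absolute value. -/
def Bdd (B : ℕ) (c : Config) : Prop := (∀ r, (c.reg r).natAbs ≤ B) ∧ ∀ z ∈ c.input, z.natAbs ≤ B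

/-- `Steps p B k c c'`: the program `p` gets from `c` to `c'` in `k` steps, with all registers
bounded by `B` before each step. -/
inductive Steps (p : Program) (B : ℕ) : ℕ → Config → Config → Prop
  | nil (c : Config) : Steps p B 0 c c
  | cons (c c' : Config) (ins : Instr) (k : ℕ) (h : p[c.pc]? = some ins) (hb : Bdd B c)
      (hr : Steps p B k (exec ins c) c') : Steps p B (k + 1) c c'

theorem Steps.trans {p : Program} {B k k' : ℕ} {c c' c'' : Config} (h : Steps p B k c c')
    (h' : Steps p B k' c' c'') : Steps p B (k + k') c c'' := by
  induction h with
  | nil => simpa using h'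
  | cons c c' ins k hi hb _ ih => rw [Nat.add_right_comm]; exact .cons _ _ _ _ hi hb (ih h')

theorem Steps.one {p : Program} {B : ℕ} {c : Config} {ins : Instr} (h : p[c.pc]? = some ins)
    (hb : Bdd B c) : Steps p B 1 c (exec ins c) := .cons _ _ _ _ h hb (.nil _)

/-- A bound for the register addresses and the constants that occur in an instruction. -/
def mx : Instr → ℕ
  | .const i z => i + z.natAbs
  | .add i j k => i + j + k
  | .sub i j k => i + j + k
  | .mul i j k => i + j + k
  | .div i j k => i + j + k
  | .load i j => i + j
  | .store i j => i + j
  | .jump _ => 0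
  | .jzero i _ => i
  | .jneg i _ => i
  | .read i => i
  | .write i => i

theorem len_le {B : ℕ} {z : ℤ} (h : z.natAbs ≤ B) : len z ≤ B.size + 1 :=
  Nat.succ_le_succ (Nat.size_le_size h)

theorem cost_le {B : ℕ} {ins : Instr} {c : Config} (hb : Bdd B c) (hm : mx ins ≤ B) :
    cost ins c ≤ 5 * (B.size + 1) := by
  have hr := fun r => len_le (hb.1 r)
  have hn : ∀ i : ℕ, i ≤ B → len (i : ℤ) ≤ B.size + 1 := fun i hi => len_le (by simpa using hi)
  cases ins <;> simp only [mx] at hm <;> simp only [cost]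
  case const i z =>
    have := hn i (by omega)
    have := len_le (B := B) (z := z) (by omega)
    omega
  case add i j k =>
    linarith [hn i (by omega), hn j (by omega), hn k (by omega), hr j, hr k]
  case sub i j k =>
    linarith [hn i (by omega), hn j (by omega), hn k (by omega), hr j, hr k]
  case mul i j k =>
    linarith [hn i (by omega), hn j (by omega), hn k (by omega), hr j, hr k]
  case div i j k =>
    linarith [hn i (by omega), hn j (by omega), hn k (by omega), hr j, hr k]
  case load i j =>
    linarith [hn i (by omega), hn j (by omega), hr j, hr (c.reg j).toNat]
  case store i j =>
    linarith [hn i (by omega), hn j (by omega), hr j, hr i]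
  case jump => omega
  case jzero i l => linarith [hn i (by omega), hr i]
  case jneg i l => linarith [hn i (by omega), hr i]
  case read i =>
    have : (c.input.headD 0).natAbs ≤ B := by
      cases h : c.input with
      | nil => simp
      | cons z l => simpa using hb.2 z (by simp [h])
    linarith [hn i (by omega), len_le this]
  case write i => linarith [hn i (by omega), hr i]

theorem Steps.run {p : Program} {B k : ℕ} {c c' : Config} (hp : ∀ ins ∈ p, mx ins ≤ B)
    (h : Steps p B k c c') (hc : p[c'.pc]? = none) :
    ∃ t, Run p c t c' ∧ t ≤ k * (5 * (B.size + 1)) := by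
  induction h with
  | nil c => exact ⟨0, .halt _ hc, by omega⟩
  | cons c c' ins k hi hb _ ih =>
    obtain ⟨t, ht, htk⟩ := ih hc
    refine ⟨_, .step _ _ _ _ hi ht, ?_⟩
    have := cost_le hb (hp ins (List.mem_of_getElem? hi))
    rw [Nat.add_mul]; omega

/-- The address of the memory cell `(r, c)`. -/
def addr (r c : ℕ) : ℕ := (r * r + c * c) * (r * r + c * c) + c * c

theorem addr_inj {r c r' c' : ℕ} : addr r c = addr r' c' ↔ r = r' ∧ c = c' := by
  constructor
  · intro h
    unfold addr at h
    have key : r * r + c * c = r' * r' + c' * c' := by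
      rcases lt_trichotomy (r * r + c * c) (r' * r' + c' * c') with h1 | h1 | h1
      · nlinarith [Nat.zero_le (r * r), Nat.zero_le (c' * c')]
      · exact h1
      · nlinarith [Nat.zero_le (r' * r'), Nat.zero_le (c * c)]
    rw [key] at h
    have hc : c = c' := Nat.mul_self_inj.mp (by omega)
    subst hc
    exact ⟨Nat.mul_self_inj.mp (by omega), rfl⟩
  · rintro ⟨rfl, rfl⟩; rfl

/-- The configuration `c` represents the state `σ`, and all registers and input numbers are bounded
by `B`. -/
structure Rel (B : ℕ) (σ : St) (c : Config) : Prop where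
  var : ∀ x, c.reg (3 * x) = σ.var x
  mem : ∀ i j, c.reg (3 * addr i j + 2) = σ.mem i j
  inp : c.input = σ.inp
  out : c.output = σ.out
  bdd : Bdd B c

/-- All variables and memory cells are at most `X` in absolute value. -/
def Sb (X : ℕ) (σ : St) : Prop := (∀ x, (σ.var x).natAbs ≤ X) ∧ ∀ r c, (σ.mem r c).natAbs ≤ X

theorem Sb.set {X : ℕ} {σ : St} (h : Sb X σ) {x : ℕ} {v : ℤ} (hv : v.natAbs ≤ X) :
    Sb X (σ.set x v) := by
  refine ⟨fun y => ?_, h.2⟩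
  by_cases hy : y = x
  · subst hy; simpa [St.set] using hv
  · simpa [St.set, hy] using h.1 y

theorem Sb.put {X : ℕ} {σ : St} (h : Sb X σ) {r c : ℕ} {v : ℤ} (hv : v.natAbs ≤ X) :
    Sb X (σ.put r c v) := by
  refine ⟨h.1, fun i j => ?_⟩
  simp only [St.put]
  split_ifs
  · exact hv
  · exact h.2 i j

theorem Bdd.assign {B : ℕ} {c : Config} (h : Bdd B c) (i : ℕ) {v : ℤ} (hv : v.natAbs ≤ B) :
    Bdd B (c.assign i v) := by
  refine ⟨fun r => ?_, h.2⟩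
  by_cases hr : r = i
  · subst hr; simpa [Config.assign] using hv
  · simpa [Config.assign, hr] using h.1 r

theorem Rel.assign_temp {B : ℕ} {σ : St} {c : Config} (h : Rel B σ c) (d : ℕ) {v : ℤ}
    (hv : v.natAbs ≤ B) : Rel B σ (c.assign (3 * d + 1) v) where
  var x := by
    have : 3 * x ≠ 3 * d + 1 := by omega
    simpa [Config.assign, this] using h.var x
  mem i j := by
    have : 3 * addr i j + 2 ≠ 3 * d + 1 := by omega
    simpa [Config.assign, this] using h.mem i j
  inp := h.inp
  out := h.out
  bdd := h.bdd.assign _ hv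

/-- `Reach p B k σ d c n v`: running `p` from `c` for `k` steps, the program counter advances by `n`,
the temporary register `d` receives the value `v`, the represented state stays `σ`, and the temporary
registers below `d` are unchanged. -/
def Reach (p : Program) (B k : ℕ) (σ : St) (d : ℕ) (c : Config) (n : ℕ) (v : ℤ) (c' : Config) :
    Prop :=
  Steps p B k c c' ∧ c'.pc = c.pc + n ∧ c'.reg (3 * d + 1) = v ∧ Rel B σ c' ∧
    ∀ t < d, c'.reg (3 * t + 1) = c.reg (3 * t + 1)

theorem assign_pc (c : Config) (i : ℕ) (v : ℤ) : (c.assign i v).pc = c.pc + 1 := rfl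

theorem assign_reg (c : Config) (i j : ℕ) (v : ℤ) :
    (c.assign i v).reg j = if j = i then v else c.reg j := by
  simp [Config.assign, Function.update_apply]

/-! ### Size bounds for expressions -/

theorem Expr.sz_pos (e : Expr) : 1 ≤ e.sz := by
  induction e <;> simp only [Expr.sz] <;> omega

theorem add_le_pow {X a b u v : ℕ} (hX : 2 ≤ X) (ha : 1 ≤ a) (hb : 1 ≤ b) (hu : u ≤ X ^ a)
    (hv : v ≤ X ^ b) : u + v ≤ X ^ (a + b) := by
  have h1 : 2 ≤ X ^ a := hX.trans (Nat.le_self_pow (by omega) X)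
  have h2 : 2 ≤ X ^ b := hX.trans (Nat.le_self_pow (by omega) X)
  rw [pow_add]
  nlinarith

theorem Expr.eval_le {X : ℕ} (hX : 2 ≤ X) {σ : St} (hσ : Sb X σ) (e : Expr) :
    (e.eval σ).natAbs ≤ X ^ e.sz := by
  induction e with
  | const z =>
    simp only [eval, sz]
    calc z.natAbs ≤ 2 ^ (z.natAbs + 1) := by
          have := Nat.lt_two_pow_self (n := z.natAbs); rw [pow_succ]; omega
      _ ≤ _ := Nat.pow_le_pow_left hX _
  | var x => simpa [eval, sz] using hσ.1 x
  | ld r c _ _ =>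
    exact (hσ.2 _ _).trans (Nat.le_self_pow (by simp only [sz]; omega) X)
  | add a b iha ihb =>
    exact (Int.natAbs_add_le _ _).trans (add_le_pow hX a.sz_pos b.sz_pos iha ihb)
  | sub a b iha ihb =>
    exact (Int.natAbs_sub_le _ _).trans (add_le_pow hX a.sz_pos b.sz_pos iha ihb)
  | mul a b iha ihb =>
    simp only [eval, sz, Int.natAbs_mul, pow_add]; exact Nat.mul_le_mul iha ihb
  | div a b iha ihb =>
    exact (Int.natAbs_ediv_le_natAbs _ _).trans
      (iha.trans (Nat.pow_le_pow_right (by omega) (by simp only [sz]; omega)))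

/-! ### Correctness of the compiler -/

theorem temp_step {p : Program} {B : ℕ} {σ : St} {c : Config} {ins : Instr} {d : ℕ} {v : ℤ}
    (hR : Rel B σ c) (hi : p[c.pc]? = some ins) (he : exec ins c = c.assign (3 * d + 1) v)
    (hv : v.natAbs ≤ B) :
    Steps p B 1 c (c.assign (3 * d + 1) v) ∧ Rel B σ (c.assign (3 * d + 1) v) :=
  ⟨he ▸ Steps.one hi hR.bdd, hR.assign_temp d hv⟩

theorem addr_cast (u v : ℤ) :
    3 * ((u * u + v * v) * (u * u + v * v) + v * v) + 2 =
      ((3 * addr u.natAbs v.natAbs + 2 : ℕ) : ℤ) := by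
  simp only [addr]; push_cast; simp only [abs_mul_abs_self]

theorem addrCode_spec {p : Program} {X B a b d : ℕ} {σ : St} {c : Config} {u v : ℤ}
    (hX : 2 ≤ X) (ha : 1 ≤ a) (hb : 1 ≤ b)
    (hB : X ^ (6 * a + 6 * b + 3) ≤ B) (hR : Rel B σ c) (hc : CodeAt p c.pc (addrCode d))
    (hu : c.reg (3 * d + 1) = u) (hv : c.reg (3 * (d + 1) + 1) = v)
    (hua : u.natAbs ≤ X ^ a) (hvb : v.natAbs ≤ X ^ b) :
    ∃ c', Reach p B 9 σ d c 9 ((3 * addr u.natAbs v.natAbs + 2 : ℕ) : ℤ) c' := by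
  have hle : ∀ {w k : ℕ}, w ≤ X ^ k → k ≤ 6 * a + 6 * b + 3 → w ≤ B := fun h hk =>
    h.trans ((Nat.pow_le_pow_right (by omega) hk).trans hB)
  have b1 : (u * u).natAbs ≤ X ^ (a + a) := by
    rw [Int.natAbs_mul, pow_add]; exact Nat.mul_le_mul hua hua
  have b2 : (v * v).natAbs ≤ X ^ (b + b) := by
    rw [Int.natAbs_mul, pow_add]; exact Nat.mul_le_mul hvb hvb
  have b3 : (u * u + v * v).natAbs ≤ X ^ ((a + a) + (b + b)) :=
    (Int.natAbs_add_le _ _).trans (add_le_pow hX (by omega) (by omega) b1 b2)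
  have b4 : ((u * u + v * v) * (u * u + v * v)).natAbs ≤
      X ^ (((a + a) + (b + b)) + ((a + a) + (b + b))) := by
    rw [Int.natAbs_mul, pow_add]; exact Nat.mul_le_mul b3 b3
  have b5 : ((u * u + v * v) * (u * u + v * v) + v * v).natAbs ≤
      X ^ ((((a + a) + (b + b)) + ((a + a) + (b + b))) + (b + b)) :=
    (Int.natAbs_add_le _ _).trans (add_le_pow hX (by omega) (by omega) b4 b2)
  have b6 : (3 : ℤ).natAbs ≤ X ^ 2 := by
    show 3 ≤ X ^ 2
    nlinarith
  have b7 : (((u * u + v * v) * (u * u + v * v) + v * v) * 3).natAbs ≤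
      X ^ (((((a + a) + (b + b)) + ((a + a) + (b + b))) + (b + b)) + 2) := by
    rw [Int.natAbs_mul, pow_add]; exact Nat.mul_le_mul b5 b6
  have b8 : (2 : ℤ).natAbs ≤ X ^ 1 := by
    show 2 ≤ X ^ 1
    simpa using hX
  have b9 : (((u * u + v * v) * (u * u + v * v) + v * v) * 3 + 2).natAbs ≤
      X ^ ((((((a + a) + (b + b)) + ((a + a) + (b + b))) + (b + b)) + 2) + 1) :=
    (Int.natAbs_add_le _ _).trans (add_le_pow hX (by omega) (by omega) b7 b8)
  simp only [addrCode, CodeAt] at hc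
  obtain ⟨i1, i2, i3, i4, i5, i6, i7, i8, i9, -⟩ := hc
  obtain ⟨s1, r1⟩ := temp_step (d := d) (v := u * u) hR i1 (by simp [exec, hu])
    (hle b1 (by omega))
  set c1 := c.assign (3 * d + 1) (u * u) with hc1
  obtain ⟨s2, r2⟩ := temp_step (d := d + 1) (v := v * v) r1 i2
    (by simp [exec, assign_reg, hc1, hv]) (hle b2 (by omega))
  set c2 := c1.assign (3 * (d + 1) + 1) (v * v) with hc2
  obtain ⟨s3, r3⟩ := temp_step (d := d) (v := u * u + v * v) r2 i3
    (by simp [exec, assign_reg, hc1, hc2]) (hle b3 (by omega))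
  set c3 := c2.assign (3 * d + 1) (u * u + v * v) with hc3
  obtain ⟨s4, r4⟩ := temp_step (d := d) (v := (u * u + v * v) * (u * u + v * v)) r3 i4
    (by simp [exec, assign_reg, hc3]) (hle b4 (by omega))
  set c4 := c3.assign (3 * d + 1) ((u * u + v * v) * (u * u + v * v)) with hc4
  obtain ⟨s5, r5⟩ := temp_step (d := d) (v := (u * u + v * v) * (u * u + v * v) + v * v) r4 i5
    (by simp [exec, assign_reg, hc4, hc3, hc2]) (hle b5 (by omega))
  set c5 := c4.assign (3 * d + 1) ((u * u + v * v) * (u * u + v * v) + v * v) with hc5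
  obtain ⟨s6, r6⟩ := temp_step (d := d + 1) (v := 3) r5 i6 (by simp [exec]) (hle b6 (by omega))
  set c6 := c5.assign (3 * (d + 1) + 1) 3 with hc6
  obtain ⟨s7, r7⟩ := temp_step (d := d)
    (v := ((u * u + v * v) * (u * u + v * v) + v * v) * 3) r6 i7
    (by simp [exec, assign_reg, hc6, hc5]) (hle b7 (by omega))
  set c7 := c6.assign (3 * d + 1) (((u * u + v * v) * (u * u + v * v) + v * v) * 3) with hc7
  obtain ⟨s8, r8⟩ := temp_step (d := d + 1) (v := 2) r7 i8 (by simp [exec]) (hle b8 (by omega))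
  set c8 := c7.assign (3 * (d + 1) + 1) 2 with hc8
  obtain ⟨s9, r9⟩ := temp_step (d := d)
    (v := ((u * u + v * v) * (u * u + v * v) + v * v) * 3 + 2) r8 i9
    (by simp [exec, assign_reg, hc8, hc7]) (hle b9 (by omega))
  refine ⟨_, ((((((((s1.trans s2).trans s3).trans s4).trans s5).trans s6).trans s7).trans
    s8).trans s9), rfl, ?_, r9, fun t ht => ?_⟩
  · rw [assign_reg, if_pos rfl, ← addr_cast]; ring
  · have e1 : 3 * t + 1 ≠ 3 * d + 1 := by omega
    have e2 : 3 * t + 1 ≠ 3 * (d + 1) + 1 := by omega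
    simp only [hc8, hc7, hc6, hc5, hc4, hc3, hc2, hc1, assign_reg, if_neg e1, if_neg e2]

theorem Expr.comp_spec {p : Program} {X B : ℕ} (hX : 2 ≤ X) {σ : St} (hσ : Sb X σ) (e : Expr) :
    ∀ {d : ℕ} {c : Config}, X ^ e.sz ≤ B → Rel B σ c → CodeAt p c.pc (e.comp d) →
      ∃ c', Reach p B (e.comp d).length σ d c (e.comp d).length (e.eval σ) c' := by
  have bin : ∀ (a b : Expr) (ins : ℕ → Instr) (f : ℤ → ℤ → ℤ),
      (∀ d c, exec (ins d) c = c.assign (3 * d + 1)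
        (f (c.reg (3 * d + 1)) (c.reg (3 * (d + 1) + 1)))) →
      (∀ {d : ℕ} {c : Config}, X ^ a.sz ≤ B → Rel B σ c → CodeAt p c.pc (a.comp d) →
        ∃ c', Reach p B (a.comp d).length σ d c (a.comp d).length (a.eval σ) c') →
      (∀ {d : ℕ} {c : Config}, X ^ b.sz ≤ B → Rel B σ c → CodeAt p c.pc (b.comp d) →
        ∃ c', Reach p B (b.comp d).length σ d c (b.comp d).length (b.eval σ) c') →
      ∀ {d : ℕ} {c : Config}, X ^ (a.sz + b.sz) ≤ B → Rel B σ c →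
        (f (a.eval σ) (b.eval σ)).natAbs ≤ B →
        CodeAt p c.pc (a.comp d ++ (b.comp (d+1) ++ [ins d])) →
        ∃ c', Reach p B (a.comp d ++ (b.comp (d+1) ++ [ins d])).length σ d c
          (a.comp d ++ (b.comp (d+1) ++ [ins d])).length (f (a.eval σ) (b.eval σ)) c' := by
    intro a b ins f hf iha ihb d c hB hR hv hc
    rw [codeAt_append, codeAt_append] at hc
    have hBa : X ^ a.sz ≤ B := (Nat.pow_le_pow_right (by omega) (by omega)).trans hB
    have hBb : X ^ b.sz ≤ B := (Nat.pow_le_pow_right (by omega) (by omega)).trans hB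
    obtain ⟨c1, s1, p1, v1, r1, t1⟩ := iha hBa hR hc.1
    obtain ⟨c2, s2, p2, v2, r2, t2⟩ := ihb (d := d + 1) hBb r1 (by rw [p1]; exact hc.2.1)
    have hi : p[c2.pc]? = some (ins d) := by rw [p2, p1]; exact hc.2.2.1
    have hva : c2.reg (3 * d + 1) = a.eval σ := by rw [t2 d (by omega), v1]
    obtain ⟨s3, r3⟩ := temp_step r2 hi (hf d c2) (by rw [hva, v2]; exact hv)
    refine ⟨_, by simpa [Nat.add_assoc] using (s1.trans s2).trans s3, ?_, ?_, r3, ?_⟩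
    · simp [assign_pc, p2, p1, Nat.add_assoc]
    · simp [assign_reg, hva, v2]
    · intro t ht
      have : 3 * t + 1 ≠ 3 * d + 1 := by omega
      rw [assign_reg, if_neg this, t2 t (by omega), t1 t ht]
  induction e with
  | const z =>
    intro d c hB hR hc
    obtain ⟨s, r⟩ := temp_step (d := d) (v := z) hR hc.1 rfl
      ((Expr.eval_le hX hσ (.const z)).trans hB)
    refine ⟨_, s, rfl, by simp [assign_reg, eval], r, fun t ht => ?_⟩
    rw [assign_reg, if_neg (by omega)]
  | var x =>
    intro d c hB hR hc
    obtain ⟨s, r⟩ := temp_step (d := d) (v := 0) hR hc.1 rfl (by simp)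
    have hx : (c.assign (3 * d + 1) 0).reg (3 * x) = σ.var x := by
      rw [assign_reg, if_neg (by omega), hR.var]
    obtain ⟨s', r'⟩ := temp_step (d := d) (v := σ.var x) r hc.2.1
      (by simp only [exec, hx]; simp [assign_reg])
      ((Expr.eval_le hX hσ (.var x)).trans hB)
    refine ⟨_, s.trans s', rfl, by simp [assign_reg, eval], r', fun t ht => ?_⟩
    rw [assign_reg, if_neg (by omega), assign_reg, if_neg (by omega)]
  | ld a b iha ihb =>
    intro d c hB hR hc
    simp only [comp, codeAt_append] at hc
    simp only [sz] at hB
    have hBa : X ^ a.sz ≤ B := (Nat.pow_le_pow_right (by omega) (by omega)).trans hB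
    have hBb : X ^ b.sz ≤ B := (Nat.pow_le_pow_right (by omega) (by omega)).trans hB
    obtain ⟨c1, s1, p1, v1, r1, t1⟩ := iha hBa hR hc.1
    obtain ⟨c2, s2, p2, v2, r2, t2⟩ := ihb (d := d + 1) hBb r1 (by rw [p1]; exact hc.2.1)
    have hva : c2.reg (3 * d + 1) = a.eval σ := by rw [t2 d (by omega), v1]
    obtain ⟨c3, s3, p3, v3, r3, t3⟩ := addrCode_spec (d := d) hX a.sz_pos b.sz_pos hB r2
      (by rw [p2, p1]; exact hc.2.2.1) hva v2 (Expr.eval_le hX hσ a) (Expr.eval_le hX hσ b)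
    have hi : p[c3.pc]? = some (.load (3 * d + 1) (3 * d + 1)) := by
      rw [p3, p2, p1]; exact hc.2.2.2.1
    obtain ⟨s4, r4⟩ := temp_step (d := d) (v := (Expr.ld a b).eval σ) r3 hi
      (by simp only [exec, v3, eval]; rw [Int.toNat_natCast, r3.mem])
      ((hσ.2 _ _).trans ((Nat.le_self_pow (by omega) X).trans hB))
    refine ⟨_, ?_, ?_, ?_, r4, ?_⟩
    · have := ((s1.trans s2).trans s3).trans s4
      simpa [comp, addrCode, Nat.add_assoc] using this
    · simp [assign_pc, p3, p2, p1, comp, addrCode, Nat.add_assoc]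
    · simp [assign_reg]
    · intro t ht
      have : 3 * t + 1 ≠ 3 * d + 1 := by omega
      rw [assign_reg, if_neg this, t3 t ht, t2 t (by omega), t1 t ht]
  | add a b iha ihb =>
    intro d c hB hR hc
    exact bin a b (fun d => .add (3*d+1) (3*d+1) (3*(d+1)+1)) (· + ·) (fun _ _ => rfl) iha ihb hB hR
      ((Expr.eval_le hX hσ (.add a b)).trans hB) hc
  | sub a b iha ihb =>
    intro d c hB hR hc
    exact bin a b (fun d => .sub (3*d+1) (3*d+1) (3*(d+1)+1)) (· - ·) (fun _ _ => rfl) iha ihb hB hR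
      ((Expr.eval_le hX hσ (.sub a b)).trans hB) hc
  | mul a b iha ihb =>
    intro d c hB hR hc
    exact bin a b (fun d => .mul (3*d+1) (3*d+1) (3*(d+1)+1)) (· * ·) (fun _ _ => rfl) iha ihb hB hR
      ((Expr.eval_le hX hσ (.mul a b)).trans hB) hc
  | div a b iha ihb =>
    intro d c hB hR hc
    exact bin a b (fun d => .div (3*d+1) (3*d+1) (3*(d+1)+1)) (· / ·) (fun _ _ => rfl) iha ihb hB hR
      ((Expr.eval_le hX hσ (.div a b)).trans hB) hc

/-- A bound for the number of steps of the code of a statement, as a polynomial in the bound for the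
numbers of rounds of its loops. -/
noncomputable def Stmt.time : Stmt → Polynomial ℕ
  | .assign _ e => Polynomial.C ((e.comp 0).length + 2)
  | .store r c e => Polynomial.C ((r.comp 0).length + (c.comp 0).length + 10 + (e.comp 0).length)
  | .read _ => 1
  | .write e => Polynomial.C ((e.comp 0).length + 1)
  | .seq s t => s.time + t.time
  | .ifnz e s => Polynomial.C ((e.comp 0).length + 1) + s.time
  | .loop _ e s => Polynomial.C ((e.comp 0).length + 2) + Polynomial.X * (s.time + 5)

theorem Expr.length_comp (e : Expr) : ∀ d, (e.comp d).length = (e.comp 0).length := by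
  have : ∀ d d', (e.comp d).length = (e.comp d').length := by
    induction e with
    | const | var => intros; rfl
    | ld a b iha ihb | add a b iha ihb | sub a b iha ihb | mul a b iha ihb | div a b iha ihb =>
      intro d d'
      simp [comp, iha d d', ihb (d+1) (d'+1), addrCode]
  exact fun d => this d 0

/-- The effect of a round of a loop on its counter. -/
def next (h : Bool) (v : ℤ) : ℤ := if h then v / 2 else v - 1

theorem cnt_nonpos {h : Bool} {v : ℤ} (hv : v ≤ 0) : cnt h v = 0 := by
  simp [cnt, Int.toNat_of_nonpos hv]

theorem cnt_pos {h : Bool} {v : ℤ} (hv : 0 < v) : cnt h v = cnt h (next h v) + 1 := by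
  obtain ⟨n, rfl⟩ := Int.eq_ofNat_of_zero_le hv.le
  cases h
  · simp only [cnt, next]; simp; omega
  · have hn : n ≠ 0 := by rintro rfl; simp at hv
    have h2 : ((n : ℤ) / 2).toNat = n / 2 := by omega
    simp only [cnt, next, if_true, Int.toNat_natCast, h2]
    have h3 := Nat.bit_bodd_div2 n
    rw [← h3, Nat.size_bit (by rwa [h3]), h3, Nat.div2_val]

theorem next_le {h : Bool} {v : ℤ} {B : ℕ} (hv : v.natAbs ≤ B) (h0 : 0 < v) :
    (next h v).natAbs ≤ B := by
  unfold next; split_ifs <;> omega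

theorem Rel.set {B : ℕ} {σ : St} {c : Config} (h : Rel B σ c) {x : ℕ} {v : ℤ}
    (hv : v.natAbs ≤ B) : Rel B (σ.set x v) (c.assign (3 * x) v) where
  var y := by
    simp only [assign_reg, St.set, Function.update_apply, h.var y]
    by_cases hy : y = x
    · simp [hy]
    · have : 3 * y ≠ 3 * x := by omega
      simp [hy]
  mem i j := by
    rw [assign_reg, if_neg (by omega)]; exact h.mem i j
  inp := h.inp
  out := h.out
  bdd := h.bdd.assign _ hv

theorem Rel.put {B : ℕ} {σ : St} {c : Config} (h : Rel B σ c) {i j : ℕ} {v : ℤ}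
    (hv : v.natAbs ≤ B) : Rel B (σ.put i j v) (c.assign (3 * addr i j + 2) v) where
  var y := by
    rw [assign_reg, if_neg (by omega)]; exact h.var y
  mem i' j' := by
    simp only [assign_reg, St.put, h.mem, Nat.add_right_cancel_iff, Nat.mul_left_cancel_iff,
      show 0 < 3 by omega, addr_inj]
  inp := h.inp
  out := h.out
  bdd := h.bdd.assign _ hv

theorem Rel.jump {B : ℕ} {σ : St} {c : Config} (h : Rel B σ c) (l : ℕ) :
    Rel B σ { c with pc := l } := ⟨h.var, h.mem, h.inp, h.out, h.bdd⟩

/-- The code of a statement establishes the postcondition whenever its weakest precondition holds,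
within the number of steps given by `Stmt.time`. -/
theorem Stmt.comp_spec {p : Program} {X B N : ℕ} (hX : 2 ≤ X) (s : Stmt) :
    ∀ {Q : St → Prop} {σ : St} {d : ℕ} {c : Config}, Sb X σ → X ^ s.sz ≤ B → Rel B σ c →
      CodeAt p c.pc (s.comp c.pc d) → wp X N s Q σ →
      ∃ k σ' c', Q σ' ∧ Sb X σ' ∧ Steps p B k c c' ∧ k ≤ s.time.eval N ∧
        c'.pc = c.pc + (s.comp c.pc d).length ∧ Rel B σ' c' ∧
        ∀ t < d, c'.reg (3 * t + 1) = c.reg (3 * t + 1) := by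
  induction s with
  | assign x e =>
    intro Q σ d c hσ hB hR hc hw
    simp only [comp, codeAt_append] at hc
    simp only [sz] at hB
    have hXB : X ≤ B := (Nat.le_self_pow (by have := e.sz_pos; omega) X).trans hB
    obtain ⟨c1, s1, p1, v1, r1, t1⟩ := Expr.comp_spec hX hσ e hB hR hc.1
    obtain ⟨s2, r2⟩ := temp_step (d := d + 1) (v := 0) r1 (by rw [p1]; exact hc.2.1) rfl (by simp)
    have s3 : Steps p B 1 (c1.assign (3 * (d+1) + 1) 0) _ :=
      Steps.one (by rw [assign_pc, p1]; exact hc.2.2.1) r2.bdd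
    have he : exec (.add (3*x) (3*d+1) (3*(d+1)+1)) (c1.assign (3 * (d+1) + 1) 0) =
        (c1.assign (3 * (d+1) + 1) 0).assign (3 * x) (e.eval σ) := by
      simp only [exec]; congr 1; simp [assign_reg, v1]
    rw [he] at s3
    refine ⟨_, _, _, hw.2, hσ.set hw.1, (s1.trans s2).trans s3, ?_, ?_,
      r2.set (hw.1.trans hXB), ?_⟩
    · simp [time, e.length_comp d]
    · simp [comp, assign_pc, p1, Nat.add_assoc]
    · intro t ht
      rw [assign_reg, if_neg (by omega), assign_reg, if_neg (by omega), t1 t ht]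
  | store a b e =>
    intro Q σ d c hσ hB hR hc hw
    simp only [comp, codeAt_append] at hc
    simp only [sz] at hB
    have hpow : ∀ {k}, k ≤ 6 * a.sz + 6 * b.sz + 3 + e.sz → X ^ k ≤ B := fun hk =>
      (Nat.pow_le_pow_right (by omega) hk).trans hB
    have hXB : X ≤ B := by simpa using hpow (k := 1) (by omega)
    obtain ⟨c1, s1, p1, v1, r1, t1⟩ := Expr.comp_spec hX hσ a (hpow (by omega)) hR hc.1
    obtain ⟨c2, s2, p2, v2, r2, t2⟩ := Expr.comp_spec hX hσ b (d := d + 1) (hpow (by omega)) r1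
      (by rw [p1]; exact hc.2.1)
    have hva : c2.reg (3 * d + 1) = a.eval σ := by rw [t2 d (by omega), v1]
    obtain ⟨c3, s3, p3, v3, r3, t3⟩ := addrCode_spec (d := d) hX a.sz_pos b.sz_pos
      (hpow (by omega)) r2
      (by rw [p2, p1]; exact hc.2.2.1) hva v2 (Expr.eval_le hX hσ a) (Expr.eval_le hX hσ b)
    obtain ⟨c4, s4, p4, v4, r4, t4⟩ := Expr.comp_spec hX hσ e (d := d + 1) (hpow (by omega)) r3
      (by rw [p3, p2, p1]; exact hc.2.2.2.1)
    have hv3 := t4 d (by omega)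
    rw [v3] at hv3
    have s5 : Steps p B 1 c4 _ := Steps.one (by rw [p4, p3, p2, p1]; exact hc.2.2.2.2.1) r4.bdd
    have he : exec (.store (3*d+1) (3*(d+1)+1)) c4 =
        c4.assign (3 * addr (a.eval σ).natAbs (b.eval σ).natAbs + 2) (e.eval σ) := by
      simp only [exec, hv3, v4, Int.toNat_natCast]
    rw [he] at s5
    refine ⟨_, _, _, hw.2, hσ.put hw.1, (((s1.trans s2).trans s3).trans s4).trans s5, ?_, ?_,
      r4.put (hw.1.trans hXB), ?_⟩
    · simp [time, e.length_comp (d+1), a.length_comp d, b.length_comp (d+1)]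
    · simp [comp, assign_pc, p1, p2, p3, p4, Nat.add_assoc, addrCode]; omega
    · intro t ht
      rw [assign_reg, if_neg (by omega), t4 t (by omega), t3 t ht, t2 t (by omega), t1 t ht]
  | read x =>
    intro Q σ d c hσ hB hR hc hw
    have hXB : X ≤ B := by simpa [sz] using hB
    refine ⟨1, _, _, hw.2, hσ.set hw.1, Steps.one hc.1 hR.bdd, by simp [time], rfl, ?_, ?_⟩
    · have := hR.set (x := x) (hw.1.trans hXB)
      refine ⟨?_, ?_, ?_, this.out, ?_, ?_⟩
      · simpa [exec, hR.inp, Config.assign] using this.var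
      · simpa [exec, hR.inp, Config.assign] using this.mem
      · simp [exec, hR.inp]
      · simpa [exec, hR.inp, Config.assign] using this.bdd.1
      · intro z hz
        exact hR.bdd.2 z (List.mem_of_mem_tail hz)
    · intro t ht
      have : 3 * t + 1 ≠ 3 * x := by omega
      simp [exec, Config.assign, this]
  | write e =>
    intro Q σ d c hσ hB hR hc hw
    simp only [comp, codeAt_append] at hc
    obtain ⟨c1, s1, p1, v1, r1, t1⟩ := Expr.comp_spec hX hσ e hB hR hc.1
    have s2 : Steps p B 1 c1 _ := Steps.one (by rw [p1]; exact hc.2.1) r1.bdd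
    refine ⟨_, _, _, hw, hσ, s1.trans s2, ?_, ?_, ⟨r1.var, r1.mem, r1.inp, ?_, r1.bdd⟩, t1⟩
    · simp [time, e.length_comp d]
    · simp [comp, exec, p1, Nat.add_assoc]
    · simp [exec, v1, r1.out]
  | seq s t ihs iht =>
    intro Q σ d c hσ hB hR hc hw
    simp only [comp, codeAt_append] at hc
    simp only [sz] at hB
    have hpow : ∀ {k}, k ≤ s.sz + t.sz → X ^ k ≤ B := fun hk =>
      (Nat.pow_le_pow_right (by omega) hk).trans hB
    obtain ⟨k1, σ1, c1, q1, b1, s1, l1, p1, r1, t1⟩ := ihs hσ (hpow (by omega)) hR hc.1 hw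
    obtain ⟨k2, σ2, c2, q2, b2, s2, l2, p2, r2, t2⟩ := iht (d := d) b1 (hpow (by omega)) r1
      (by rw [p1]; exact hc.2) q1
    refine ⟨_, σ2, c2, q2, b2, s1.trans s2, ?_, ?_, r2, fun i hi => (t2 i hi).trans (t1 i hi)⟩
    · simp only [time, Polynomial.eval_add]; omega
    · rw [p2, p1]; simp [comp, Nat.add_assoc]
  | ifnz e s ih =>
    intro Q σ d c hσ hB hR hc hw
    simp only [comp, codeAt_append] at hc
    simp only [sz] at hB
    have hpow : ∀ {k}, k ≤ e.sz + s.sz → X ^ k ≤ B := fun hk =>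
      (Nat.pow_le_pow_right (by omega) hk).trans hB
    obtain ⟨c1, s1, p1, v1, r1, t1⟩ := Expr.comp_spec hX hσ e (hpow (by omega)) hR hc.1
    have s2 : Steps p B 1 c1 _ := Steps.one (by rw [p1]; exact hc.2.1) r1.bdd
    simp only [exec, v1] at s2
    by_cases h0 : e.eval σ = 0
    · rw [if_pos h0] at s2
      refine ⟨_, σ, _, hw.2 h0, hσ, s1.trans s2, ?_, ?_, r1.jump _, t1⟩
      · simp [time, e.length_comp d]
      · simp [comp, Nat.add_assoc, Nat.add_comm 1]
    · rw [if_neg h0] at s2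
      obtain ⟨k3, σ3, c3, q3, b3, s3, l3, p3, r3, t3⟩ := ih (d := d) hσ (hpow (by omega))
        (r1.jump (c1.pc + 1)) (by simp only [p1]; exact hc.2.2) (hw.1 h0)
      refine ⟨_, σ3, c3, q3, b3, (s1.trans s2).trans s3, ?_, ?_, r3,
        fun i hi => (t3 i hi).trans (t1 i hi)⟩
      · simp [time, e.length_comp d]; omega
      · rw [p3]; simp [comp, p1, Nat.add_assoc, Nat.add_comm 1]
  | loop h e s ih =>
    intro Q σ d c hσ hB hR hc hw
    simp only [comp, codeAt_append] at hc
    simp only [sz] at hB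
    have hpow : ∀ {k}, k ≤ e.sz + s.sz → X ^ k ≤ B := fun hk =>
      (Nat.pow_le_pow_right (by omega) hk).trans hB
    have h2B : 2 ≤ B := hX.trans
      (by simpa using hpow (k := 1) (by have := e.sz_pos; omega))
    obtain ⟨c1, s1, p1, v1, r1, t1⟩ := Expr.comp_spec hX hσ e (hpow (by omega)) hR hc.1
    obtain ⟨hce, hj1, hj2, hc⟩ := hc
    rw [codeAt_append] at hc
    obtain ⟨hcs, hi1, hi2, hi3, -⟩ := hc
    set L := (e.comp d).length
    set body := s.comp (c.pc + L + 2) (d + 1) with hbody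
    set fin := c.pc + L + 2 + body.length + 3 with hfin
    have key : ∀ k τ (c1 : Config), Sb X τ → Rel B τ c1 → c1.pc = c.pc + L →
        (∀ t < d, c1.reg (3 * t + 1) = c.reg (3 * t + 1)) →
        cnt h (c1.reg (3 * d + 1)) = k → ((fun R τ => wp X N s R τ)^[k] Q) τ →
        ∃ k' σ' c', Q σ' ∧ Sb X σ' ∧ Steps p B k' c1 c' ∧ k' ≤ 2 + k * (s.time.eval N + 5) ∧
          c'.pc = fin ∧ Rel B σ' c' ∧ ∀ t < d, c'.reg (3 * t + 1) = c.reg (3 * t + 1) := by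
      intro k
      induction k with
      | zero =>
        intro τ c1 hτ hR p1 t1 hk hw
        have hv : c1.reg (3 * d + 1) ≤ 0 := by
          by_contra hcon
          rw [cnt_pos (not_le.mp hcon)] at hk
          omega
        have s2 : Steps p B 1 c1 _ := Steps.one (by rw [p1]; exact hj1) hR.bdd
        simp only [exec] at s2
        by_cases hneg : c1.reg (3 * d + 1) < 0
        · rw [if_pos hneg] at s2
          exact ⟨1, τ, _, hw, hτ, s2, by omega, rfl, hR.jump _, t1⟩
        · rw [if_neg hneg] at s2
          have s3 : Steps p B 1 { c1 with pc := c1.pc + 1 } _ :=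
            Steps.one (by rw [p1]; exact hj2) (hR.jump _).bdd
          have h0 : c1.reg (3 * d + 1) = 0 := by omega
          simp only [exec, h0, if_true] at s3
          exact ⟨2, τ, _, hw, hτ, s2.trans s3, by omega, rfl, hR.jump _, t1⟩
      | succ k ihk =>
        intro τ c1 hτ hR p1 t1 hk hw
        have hv : 0 < c1.reg (3 * d + 1) := by
          by_contra hcon
          rw [cnt_nonpos (not_lt.mp hcon)] at hk
          omega
        rw [Function.iterate_succ_apply'] at hw
        have s2 : Steps p B 1 c1 _ := Steps.one (by rw [p1]; exact hj1) hR.bdd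
        simp only [exec, if_neg hv.not_gt] at s2
        have s3 : Steps p B 1 { c1 with pc := c1.pc + 1 } _ :=
          Steps.one (by rw [p1]; exact hj2) (hR.jump _).bdd
        simp only [exec, if_neg hv.ne'] at s3
        obtain ⟨k4, σ4, c4, q4, b4, s4, l4, p4, r4, t4⟩ := ih (d := d + 1) hτ (hpow (by omega))
          (hR.jump (c1.pc + 1 + 1)) (by simp only [p1]; exact hcs) hw
        have p4' : c4.pc = c.pc + L + 2 + body.length := by simp only [p4, p1, hbody]
        have hv4 : c4.reg (3 * d + 1) = c1.reg (3 * d + 1) := t4 d (by omega)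
        obtain ⟨s5, r5⟩ := temp_step (d := d + 1) (v := if h then 2 else 1) r4
          (by rw [p4']; exact hi1) rfl (by split_ifs <;> simp <;> omega)
        set c5 := c4.assign (3 * (d + 1) + 1) (if h then 2 else 1) with hc5
        obtain ⟨s6, r6⟩ := temp_step (d := d) (v := next h (c1.reg (3 * d + 1))) r5
          (by rw [hc5, assign_pc, p4']; exact hi2)
          (by cases h <;> simp [nextInstr, exec, next, assign_reg, hc5, hv4])
          (next_le (hR.bdd.1 _) hv)
        set c6 := c5.assign (3 * d + 1) (next h (c1.reg (3 * d + 1))) with hc6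
        have s7 : Steps p B 1 c6 _ :=
          Steps.one (by rw [hc6, hc5, assign_pc, assign_pc, p4']; exact hi3) r6.bdd
        simp only [exec] at s7
        obtain ⟨k8, σ8, c8, q8, b8, s8, l8, p8, r8, t8⟩ := ihk σ4 { c6 with pc := c.pc + L } b4
          (r6.jump _) rfl (by
            intro t ht
            simp only [hc6, hc5]
            rw [assign_reg, if_neg (by omega), assign_reg, if_neg (by omega), t4 t (by omega)]
            exact t1 t ht)
          (by
            rw [cnt_pos hv] at hk
            simp only [hc6, assign_reg, if_true]
            omega) q4
        refine ⟨_, σ8, c8, q8, b8, (((((s2.trans s3).trans s4).trans s5).trans s6).trans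
          s7).trans s8, ?_, p8, r8, t8⟩
        rw [Nat.add_mul]
        omega
    obtain ⟨k', σ', c', q', b', s', l', p', r', t'⟩ := key _ σ c1 hσ r1 p1 t1 (by rw [v1]) hw.2
    refine ⟨_, σ', c', q', b', s1.trans s', ?_, ?_, r', t'⟩
    · have h1 := Nat.mul_le_mul_right (s.time.eval N + 5) hw.1
      have h5 : Polynomial.eval N (5 : Polynomial ℕ) = 5 := by
        rw [← Polynomial.C_ofNat, Polynomial.eval_C]
      simp only [time, Polynomial.eval_add, Polynomial.eval_C, Polynomial.eval_mul,
        Polynomial.eval_X, h5, e.length_comp d, L] at *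
      omega
    · rw [p', hfin]
      simp [comp, ← hbody, L]
      omega

theorem exists_mx_le (p : Program) : ∃ M, ∀ ins ∈ p, mx ins ≤ M := by
  induction p with
  | nil => exact ⟨0, by simp⟩
  | cons i p ih =>
    obtain ⟨M, hM⟩ := ih
    refine ⟨mx i + M, fun ins hins => ?_⟩
    rcases List.mem_cons.mp hins with rfl | h
    · omega
    · have := hM ins h; omega

theorem size_two_pow_mul_le (x k : ℕ) : ((2 ^ x) ^ k).size ≤ x * k + 1 := by
  rw [← pow_mul, Nat.size_pow]

/-- A program of the structured language, compiled to the random access machine, takes a time that is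
polynomial in the bound for the number of rounds of the loops and in the bit length of the assigned
values. -/
theorem exists_outputsInTime (s : Stmt) : ∃ K : ℕ, ∀ (N x : ℕ) (inp : List ℤ) (Q : St → Prop),
    1 ≤ x → (∀ z ∈ inp, z.natAbs ≤ 2 ^ x) →
    wp (2 ^ x) N s Q ⟨fun _ => 0, fun _ _ => 0, inp, []⟩ →
    ∃ σ, Q σ ∧ OutputsInTime (s.comp 0 0) inp σ.out (s.time.eval N * (5 * (x * K + 2))) := by
  obtain ⟨M, hM⟩ := exists_mx_le (s.comp 0 0)
  refine ⟨s.sz + M + 1, fun N x inp Q hx hinp hw => ?_⟩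
  set B := (2 ^ x) ^ (s.sz + M + 1) with hB
  have h2 : 2 ≤ 2 ^ x := Nat.le_self_pow (by omega) 2
  have hMB : ∀ ins ∈ s.comp 0 0, mx ins ≤ B := fun ins hins =>
    calc mx ins ≤ M := hM ins hins
      _ ≤ 2 ^ M := Nat.lt_two_pow_self.le
      _ ≤ (2 ^ x) ^ M := Nat.pow_le_pow_left h2 _
      _ ≤ B := Nat.pow_le_pow_right (by omega) (by omega)
  have hXB : 2 ^ x ≤ B := Nat.le_self_pow (by omega) _
  obtain ⟨k, σ, c, q, -, st, hk, hpc, hr, -⟩ := Stmt.comp_spec (p := s.comp 0 0) (B := B) (N := N)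
    h2 s (Q := Q) (σ := ⟨fun _ => 0, fun _ _ => 0, inp, []⟩) (d := 0) (c := init inp)
    ⟨by simp, by simp⟩ (Nat.pow_le_pow_right (by omega) (by omega))
    ⟨by simp [init], by simp [init], rfl, rfl, by simp [init], fun z hz => (hinp z hz).trans hXB⟩
    (by simpa [init] using codeAt_self (s.comp 0 0) []) hw
  obtain ⟨t, ht, htk⟩ := st.run hMB (by rw [hpc]; simp [init])
  refine ⟨σ, q, t, c, ht, hr.out, htk.trans (Nat.mul_le_mul hk ?_)⟩
  have := size_two_pow_mul_le x (s.sz + M + 1)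
  rw [← hB] at this
  omega

/-! ### Triangular bases and the Hermite normal form -/

/-- The first `m` entries of the row `r` of an infinite matrix. -/
def row (m : ℕ) (A : ℕ → ℕ → ℤ) (r : ℕ) : Fin m → ℤ := fun c => A r c

/-- The rows `0, …, m - 1` of `R` are an upper triangular basis of the lattice `Λ`; equivalently, they
are in `Λ`, are upper triangular, and their pivots are positive and as small as possible. -/
structure TriBasis {m : ℕ} (Λ : Submodule ℤ (Fin m → ℤ)) (R : ℕ → ℕ → ℤ) : Prop where
  mem : ∀ a < m, row m R a ∈ Λ
  zero : ∀ a < m, ∀ c < a, R a c = 0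
  pos : ∀ a < m, 0 < R a a
  dvd : ∀ a : Fin m, ∀ x ∈ Λ, (∀ c < a, x c = 0) → R a a ∣ x a

/-- The rows of `H` are the Hermite normal form of the lattice `Λ`. -/
structure IsHNF {m : ℕ} (Λ : Submodule ℤ (Fin m → ℤ)) (H : ℕ → ℕ → ℤ) : Prop
    extends TriBasis Λ H where
  nonneg : ∀ a c, a < c → c < m → 0 ≤ H a c
  lt : ∀ a c, a < c → c < m → H a c < H c c

theorem TriBasis.span_eq {m : ℕ} {Λ : Submodule ℤ (Fin m → ℤ)} {R : ℕ → ℕ → ℤ}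
    (h : TriBasis Λ R) : Submodule.span ℤ (Set.range fun a : Fin m => row m R a) = Λ := by
  apply le_antisymm
  · rw [Submodule.span_le]
    rintro _ ⟨a, rfl⟩
    exact h.mem a a.2
  · have key : ∀ k ≤ m, ∀ x ∈ Λ, (∀ c : Fin m, (c : ℕ) < m - k → x c = 0) →
        x ∈ Submodule.span ℤ (Set.range fun a : Fin m => row m R a) := by
      intro k
      induction k with
      | zero =>
        intro _ x _ hx0
        have : x = 0 := funext fun c => hx0 c (by omega)
        simp [this]
      | succ k ih =>
        intro hk x hx hx0
        let a : Fin m := ⟨m - (k + 1), by omega⟩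
        have ha : (a : ℕ) = m - (k + 1) := rfl
        obtain ⟨q, hq⟩ := h.dvd a x hx (fun c hc => hx0 c (by rw [← ha]; exact hc))
        have h1 : x - q • row m R a ∈ Submodule.span ℤ (Set.range fun a : Fin m => row m R a) := by
          apply ih (by omega) _ (Λ.sub_mem hx (Λ.smul_mem q (h.mem a a.2)))
          intro c hc
          rcases (show (c : ℕ) < a ∨ (c : ℕ) = a by omega) with h1 | h1
          · simp [row, hx0 c (by omega), h.zero a a.2 c h1]
          · have : c = a := Fin.ext h1
            subst this
            simp only [row, Pi.sub_apply, Pi.smul_apply, smul_eq_mul, hq]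
            ring
        have := Submodule.add_mem _ h1
          (Submodule.smul_mem _ q (Submodule.subset_span ⟨a, rfl⟩))
        simpa using this
    intro x hx
    exact key m le_rfl x hx (fun c hc => by omega)

theorem exists_combination {m : ℕ} {Λ : Submodule ℤ (Fin m → ℤ)} {R : ℕ → ℕ → ℤ}
    (hs : Submodule.span ℤ (Set.range fun a : Fin m => row m R a) = Λ) {x : Fin m → ℤ}
    (hx : x ∈ Λ) : ∃ z : Fin m → ℤ, ∀ c : Fin m, x c = ∑ r : Fin m, z r * R r c := by
  rw [← hs] at hx
  obtain ⟨z, rfl⟩ := (Submodule.mem_span_range_iff_exists_fun ℤ).mp hx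
  exact ⟨z, fun c => by simp [row]⟩

/-- In a combination of upper triangular rows whose first coordinates vanish, the first coefficients
vanish. -/
theorem coeff_eq_zero {m : ℕ} {R : ℕ → ℕ → ℤ} (hz : ∀ a < m, ∀ c < a, R a c = 0)
    {x z : Fin m → ℤ} (hxz : ∀ c : Fin m, x c = ∑ r : Fin m, z r * R r c) (a : Fin m)
    (hp : ∀ c : Fin m, c < a → R c c ≠ 0) (hx : ∀ c < a, x c = 0) :
    (∀ c < a, z c = 0) ∧ x a = z a * R a a := by
  have single : ∀ c : Fin m, (∀ r < c, z r = 0) → x c = z c * R c c := by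
    intro c hc
    rw [hxz c]
    apply Finset.sum_eq_single c
    · intro r _ hr
      rcases lt_or_gt_of_ne hr with h1 | h1
      · simp [hc r h1]
      · simp [hz r r.2 c h1]
    · simp
  have hzero : ∀ k : ℕ, ∀ c : Fin m, (c : ℕ) = k → c < a → z c = 0 := by
    intro k
    induction k using Nat.strong_induction_on with
    | _ k ih =>
      intro c hck hca
      have h1 := single c (fun r hr => ih r (by rw [← hck]; exact hr) r rfl (hr.trans hca))
      rw [hx c hca] at h1
      exact (mul_eq_zero.mp h1.symm).resolve_right (hp c hca)
  exact ⟨fun c hc => hzero c c rfl hc, single a fun c hc => hzero c c rfl hc⟩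

/-- An upper triangular generating system of a lattice of full rank has positive pivots, and these are
as small as possible. -/
theorem triBasis_of_span {m : ℕ} {Λ : Submodule ℤ (Fin m → ℤ)} {R : ℕ → ℕ → ℤ} {D : ℤ}
    (hs : Submodule.span ℤ (Set.range fun a : Fin m => row m R a) = Λ)
    (hz : ∀ a < m, ∀ c < a, R a c = 0) (hn : ∀ a < m, 0 ≤ R a a) (hD : 0 < D)
    (hDΛ : ∀ j : Fin m, Pi.single j D ∈ Λ) : TriBasis Λ R := by
  have hne : ∀ k : ℕ, ∀ a : Fin m, (a : ℕ) = k → R a a ≠ 0 := by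
    intro k
    induction k using Nat.strong_induction_on with
    | _ k ih =>
      intro a hak h0
      obtain ⟨z, hxz⟩ := exists_combination hs (hDΛ a)
      have := (coeff_eq_zero hz hxz a (fun c hc => ih c (by rw [← hak]; exact hc) c rfl)
        (fun c hc => by simp [hc.ne])).2
      simp [h0] at this
      omega
  refine ⟨fun a ha => ?_, hz, fun a ha => ?_, fun a x hx hx0 => ?_⟩
  · rw [← hs]; exact Submodule.subset_span ⟨⟨a, ha⟩, rfl⟩
  · exact lt_of_le_of_ne (hn a ha) (hne a ⟨a, ha⟩ rfl).symm
  · obtain ⟨z, hxz⟩ := exists_combination hs hx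
    exact ⟨z a, by
      rw [(coeff_eq_zero hz hxz a (fun c _ => hne c c rfl) hx0).2, mul_comm]⟩

theorem TriBasis.le_of_single_mem {m : ℕ} {Λ : Submodule ℤ (Fin m → ℤ)} {R : ℕ → ℕ → ℤ} {D : ℤ}
    (h : TriBasis Λ R) (hD : 0 < D) (hDΛ : ∀ j : Fin m, Pi.single j D ∈ Λ) {a : ℕ} (ha : a < m) :
    R a a ≤ D := by
  have := h.dvd ⟨a, ha⟩ _ (hDΛ ⟨a, ha⟩) (fun c hc => by simp [hc.ne])
  simp only [Pi.single_eq_same] at this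
  exact Int.le_of_dvd hD this

/-- The Hermite normal form is unique: the first nonzero entry of the difference of two rows is less
than a pivot, and divisible by it. -/
theorem IsHNF.unique {m : ℕ} {Λ : Submodule ℤ (Fin m → ℤ)} {H H' : ℕ → ℕ → ℤ} (h : IsHNF Λ H)
    (h' : IsHNF Λ H') {a c : ℕ} (ha : a < m) (hc : c < m) : H a c = H' a c := by
  have diag : ∀ a < m, H a a = H' a a := fun a ha => by
    refine Int.dvd_antisymm (h.pos a ha).le (h'.pos a ha).le ?_ ?_
    · exact h.dvd ⟨a, ha⟩ _ (h'.mem a ha) (fun c hc => h'.zero a ha c hc)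
    · exact h'.dvd ⟨a, ha⟩ _ (h.mem a ha) (fun c hc => h.zero a ha c hc)
  induction c using Nat.strong_induction_on with
  | _ c ih =>
    rcases lt_trichotomy c a with h1 | rfl | h1
    · rw [h.zero a ha c h1, h'.zero a ha c h1]
    · exact diag c hc
    · have hx : row m H a - row m H' a ∈ Λ := Λ.sub_mem (h.mem a ha) (h'.mem a ha)
      have hd := h.dvd ⟨c, hc⟩ _ hx (fun i hi => by
        simp only [Pi.sub_apply, row]
        rw [ih i hi (by omega), sub_self])
      simp only [Pi.sub_apply, row] at hd
      have h2 := h.nonneg a c h1 hc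
      have h3 := h.lt a c h1 hc
      have h4 := h'.nonneg a c h1 hc
      have h5 := h'.lt a c h1 hc
      rw [← diag c hc] at h5
      have := Int.eq_zero_of_abs_lt_dvd hd (by rw [abs_lt]; constructor <;> omega)
      omega

/-! ### The determinant of the lattice -/

/-- Deleting the last coordinate. -/
def proj (m : ℕ) : (Fin (m + 1) → ℤ) →ₗ[ℤ] (Fin m → ℤ) := LinearMap.funLeft ℤ ℤ Fin.castSucc

theorem proj_apply {m : ℕ} (x : Fin (m + 1) → ℤ) (i : Fin m) : proj m x i = x i.castSucc := rfl

theorem mem_sumZero {n : ℕ} {x : Fin n → ℤ} : x ∈ sumZero n ↔ ∑ i, x i = 0 := Iff.rfl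

theorem proj_injOn {m : ℕ} {x y : Fin (m + 1) → ℤ} (hx : x ∈ sumZero (m + 1))
    (hy : y ∈ sumZero (m + 1)) (h : proj m x = proj m y) : x = y := by
  have hc : ∀ i : Fin m, x i.castSucc = y i.castSucc := fun i => congrFun h i
  rw [mem_sumZero, Fin.sum_univ_castSucc] at hx hy
  have hs : ∑ i : Fin m, x i.castSucc = ∑ i : Fin m, y i.castSucc :=
    Finset.sum_congr rfl fun i _ => hc i
  funext i
  induction i using Fin.lastCases with
  | last => omega
  | cast i => exact hc i

theorem eq_of_map_proj_eq {m : ℕ} {S T : Submodule ℤ (Fin (m + 1) → ℤ)}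
    (hS : S ≤ sumZero (m + 1)) (hT : T ≤ sumZero (m + 1)) (h : S.map (proj m) = T.map (proj m)) :
    S = T := by
  have : ∀ S T : Submodule ℤ (Fin (m + 1) → ℤ), S ≤ sumZero (m + 1) → T ≤ sumZero (m + 1) →
      S.map (proj m) = T.map (proj m) → S ≤ T := by
    intro S T hS hT h x hx
    obtain ⟨y, hy, hyx⟩ := (h ▸ Submodule.mem_map_of_mem hx : proj m x ∈ T.map (proj m))
    rwa [proj_injOn (hS hx) (hT hy) hyx.symm]
  exact le_antisymm (this S T hS hT h) (this T S hT hS h.symm)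

/-- Deleting the last coordinate identifies the vectors of length `m + 1` with coordinate sum zero
with the vectors of length `m`. -/
def sumZeroEquiv (m : ℕ) : sumZero (m + 1) ≃ₗ[ℤ] (Fin m → ℤ) where
  toFun x := proj m x
  map_add' _ _ := rfl
  map_smul' _ _ := rfl
  invFun y := ⟨Fin.snoc (α := fun _ => ℤ) y (-∑ i, y i), by
    rw [mem_sumZero, Fin.sum_univ_castSucc]; simp⟩
  left_inv x := Subtype.ext <| proj_injOn
    (by rw [mem_sumZero, Fin.sum_univ_castSucc]; simp) x.2 (by funext i; simp [proj_apply])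
  right_inv y := by funext i; simp [proj_apply]

/-- The square matrix of a basis whose vectors are the rows, with the last coordinate deleted. -/
noncomputable def basisMatrix {m : ℕ} {L : Submodule ℤ (Fin (m + 1) → ℤ)} (b : Module.Basis (Fin m) ℤ L) :
    Matrix (Fin m) (Fin m) ℤ := Matrix.of fun j => proj m (b j)

theorem latticeDet_eq {m : ℕ} {L : Submodule ℤ (Fin (m + 1) → ℤ)} (hL : L ≤ sumZero (m + 1))
    (b : Module.Basis (Fin m) ℤ L) : latticeDet L = (basisMatrix b).det.natAbs := by
  rw [latticeDet, AddSubgroup.relIndex_eq_natAbs_det L.toAddSubgroup (sumZero (m + 1)).toAddSubgroup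
    hL b (Module.Basis.ofEquivFun (sumZeroEquiv m)), Module.Basis.det_apply, ← Matrix.det_transpose]
  rfl

/-- Cramer's rule: the adjugate matrix gives the multiple of a unit vector by the determinant. -/
theorem single_mem_of_basis {m : ℕ} {L : Submodule ℤ (Fin (m + 1) → ℤ)}
    (b : Module.Basis (Fin m) ℤ L) (j : Fin m) :
    Pi.single j (basisMatrix b).det ∈ L.map (proj m) := by
  have h := congrFun (Matrix.adjugate_mul (basisMatrix b)) j
  have h2 : Pi.single j (basisMatrix b).det =
      ∑ k, (basisMatrix b).adjugate j k • proj m (b k) := by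
    funext i
    have h3 := congrFun h i
    rw [Matrix.mul_apply] at h3
    rw [Finset.sum_apply]
    simp only [Pi.smul_apply, smul_eq_mul]
    refine Eq.trans ?_ h3.symm
    simp [Matrix.one_apply, Pi.single_apply, eq_comm]
  rw [h2]
  exact Submodule.sum_mem _ fun k _ => Submodule.smul_mem _ _ (Submodule.mem_map_of_mem (b k).2)

theorem map_proj_eq_span {m : ℕ} {L : Submodule ℤ (Fin (m + 1) → ℤ)}
    (b : Module.Basis (Fin m) ℤ L) :
    L.map (proj m) = Submodule.span ℤ (Set.range (basisMatrix b)) := by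
  have h := congrArg (Submodule.map ((proj m).comp L.subtype)) b.span_eq
  rw [Submodule.map_top, Submodule.map_span, LinearMap.range_comp, Submodule.range_subtype] at h
  rw [← h, ← Set.range_comp]
  rfl

theorem det_basisMatrix_ne_zero {m : ℕ} {L : Submodule ℤ (Fin (m + 1) → ℤ)}
    (hL : L ≤ sumZero (m + 1)) (b : Module.Basis (Fin m) ℤ L) : (basisMatrix b).det ≠ 0 := by
  have hli : LinearIndependent ℤ (basisMatrix b).row := by
    have h1 : LinearIndependent ℤ (((sumZeroEquiv m).toLinearMap.comp
        (Submodule.inclusion hL)) ∘ b) := by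
      refine b.linearIndependent.map' _ (LinearMap.ker_eq_bot.mpr ?_)
      exact (sumZeroEquiv m).injective.comp (Submodule.inclusion_injective hL)
    exact h1
  intro h0
  obtain ⟨v, hv, hv0⟩ := Matrix.exists_vecMul_eq_zero_iff.mpr h0
  rw [Matrix.vecMul_eq_sum] at hv0
  exact hv (funext (Fintype.linearIndependent_iff.mp hli v hv0))

/-! ### The graph of a lattice in Hermite normal form -/

/-- The digraph with `d v w` edges from `v` to `w`. -/
def digraphOf {n : ℕ} (d : Fin n → Fin n → ℕ) : DiMultigraph (Fin n) where
  E := Σ p : Fin n × Fin n, Fin (d p.1 p.2)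
  finiteE := inferInstance
  tail e := e.1.1
  head e := e.1.2

theorem mult_digraphOf {n : ℕ} (d : Fin n → Fin n → ℕ) (v w : Fin n) :
    (digraphOf d).mult v w = d v w := by
  unfold DiMultigraph.mult
  let f : Fin (d v w) → {e : (digraphOf d).E // (digraphOf d).tail e = v ∧ (digraphOf d).head e = w} :=
    fun i => ⟨⟨(v, w), i⟩, rfl, rfl⟩
  have hf : Function.Bijective f := by
    constructor
    · intro i j hij
      have := congrArg Subtype.val hij
      exact eq_of_heq (Sigma.mk.inj this).2
    · rintro ⟨⟨⟨v', w'⟩, i⟩, h1, h2⟩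
      change v' = v at h1
      change w' = w at h2
      subst h1 h2
      exact ⟨i, rfl⟩
  rw [← Nat.card_congr (Equiv.ofBijective f hf), Nat.card_fin]

theorem outdeg_digraphOf {n : ℕ} (d : Fin n → Fin n → ℕ) (v : Fin n) :
    (digraphOf d).outdeg v = ∑ w, d v w := by
  unfold DiMultigraph.outdeg
  let f : (Σ w : Fin n, Fin (d v w)) → {e : (digraphOf d).E // (digraphOf d).tail e = v} :=
    fun i => ⟨⟨(v, i.1), i.2⟩, rfl⟩
  have hf : Function.Bijective f := by
    constructor
    · rintro ⟨w, i⟩ ⟨w', j⟩ hij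
      have := congrArg Subtype.val hij
      cases this
      rfl
    · rintro ⟨⟨⟨v', w'⟩, i⟩, h1⟩
      change v' = v at h1
      subst h1
      exact ⟨⟨w', i⟩, rfl⟩
  rw [← Nat.card_congr (Equiv.ofBijective f hf), Nat.card_sigma]
  simp

/-- The row of `extMat` that contains the edge multiplicities of the vertex `w`. -/
def rowOf (m w : ℕ) : ℕ := (w + m) % (m + 1)

/-- The Laplacian of the digraph that has `E (rowOf m w) v` edges from `w` to `v ≠ w`. -/
def lapMat (m : ℕ) (E : ℕ → ℕ → ℤ) : Matrix (Fin (m + 1)) (Fin (m + 1)) ℤ :=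
  Matrix.of fun v w => if v = w then
    (∑ u ∈ Finset.range (m + 1), E (rowOf m w) u) - E (rowOf m w) w else -E (rowOf m w) v

/-- The triangular matrix `H`, with a last column that makes the row sums divisible by `D`, and with a
last row `(0, …, 0, D)`. -/
def extMat (m : ℕ) (D : ℤ) (H : ℕ → ℕ → ℤ) : ℕ → ℕ → ℤ := fun a c =>
  if a < m then if c < m then H a c else (-∑ i ∈ Finset.range m, H a i) % D
  else if c = m then D else 0

theorem rowOf_succ {m a : ℕ} (h : a < m) : rowOf m (a + 1) = a := by
  rw [rowOf, show a + 1 + m = a + (m + 1) by omega, Nat.add_mod_right, Nat.mod_eq_of_lt (by omega)]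

theorem rowOf_zero (m : ℕ) : rowOf m 0 = m := by simp [rowOf]

theorem rowOf_lt (m w : ℕ) : rowOf m w < m + 1 := Nat.mod_lt _ (by omega)

section

variable {m : ℕ} {Λ : Submodule ℤ (Fin m → ℤ)} {H : ℕ → ℕ → ℤ} {D : ℤ}

theorem extMat_nonneg (h : IsHNF Λ H) (hD : 0 < D) {a : ℕ} (c : ℕ) :
    0 ≤ extMat m D H a c := by
  unfold extMat
  split_ifs with h1 h2 h3
  · rcases lt_trichotomy c a with h4 | rfl | h4
    · exact (h.zero a h1 c h4).ge
    · exact (h.pos c h1).le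
    · exact h.nonneg a c h4 h2
  · exact Int.emod_nonneg _ hD.ne'
  · exact hD.le
  · exact le_rfl

theorem extMat_le (h : IsHNF Λ H) (hD : 0 < D) (hDΛ : ∀ j : Fin m, Pi.single j D ∈ Λ) {a : ℕ}
    (c : ℕ) : extMat m D H a c ≤ D := by
  unfold extMat
  split_ifs with h1 h2 h3
  · rcases lt_trichotomy c a with h4 | rfl | h4
    · exact (h.zero a h1 c h4).le.trans hD.le
    · exact h.le_of_single_mem hD hDΛ h1
    · exact (h.lt a c h4 h2).le.trans (h.le_of_single_mem hD hDΛ h2)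
  · exact (Int.emod_lt_of_pos _ hD).le
  · exact le_rfl
  · exact hD.le

theorem lapMat_sum (m : ℕ) (E : ℕ → ℕ → ℤ) (w : Fin (m + 1)) : ∑ v, lapMat m E v w = 0 := by
  have h1 : ∀ v, lapMat m E v w =
      (if v = w then ∑ u ∈ Finset.range (m + 1), E (rowOf m w) u else 0) - E (rowOf m w) v := by
    intro v
    simp only [lapMat, Matrix.of_apply]
    split_ifs with h
    · rw [h]
    · ring
  simp only [h1, Finset.sum_sub_distrib, Finset.sum_ite_eq', Finset.mem_univ, if_true]
  rw [Finset.sum_range, sub_self]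

theorem lapMat_abs_le (h : IsHNF Λ H) (hD : 0 < D) (hDΛ : ∀ j : Fin m, Pi.single j D ∈ Λ)
    (v w : Fin (m + 1)) : |lapMat m (extMat m D H) v w| ≤ (m + 1 : ℕ) * D := by
  set E := extMat m D H
  have h0 : ∀ a c, 0 ≤ E a c := fun a c => extMat_nonneg h hD c
  have h1 : ∀ a c, E a c ≤ D := fun a c => extMat_le h hD hDΛ c
  simp only [lapMat, Matrix.of_apply]
  have hs : ∑ u ∈ Finset.range (m + 1), E (rowOf m w) u ≤ (m + 1 : ℕ) * D := by
    have := Finset.sum_le_card_nsmul (Finset.range (m + 1)) (fun u => E (rowOf m w) u) D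
      (fun u _ => h1 _ u)
    simpa using this
  have hDn : D ≤ (m + 1 : ℕ) * D := by push_cast; nlinarith
  split_ifs with hvw
  · have := Finset.single_le_sum (f := fun u => E (rowOf m w) u) (fun u _ => h0 _ u)
      (Finset.mem_range.mpr w.2)
    have := h0 (rowOf m w) w
    rw [abs_of_nonneg (by linarith)]
    linarith
  · rw [abs_neg, abs_of_nonneg (h0 _ _)]
    exact (h1 _ _).trans hDn

/-- The matrix whose rows are the negatives of the columns `1, …, m` of the Laplacian; it is again
upper triangular, with the same pivots as `H`. -/
def negCols (m : ℕ) (E : ℕ → ℕ → ℤ) : ℕ → ℕ → ℤ := fun a c =>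
  if c = a + 1 then E a (a + 1) - ∑ u ∈ Finset.range (m + 1), E a u else E a c

theorem triBasis_negCols (h : IsHNF Λ H) (hDΛ : ∀ j : Fin m, Pi.single j D ∈ Λ) :
    TriBasis Λ (negCols m (extMat m D H)) := by
  have hE : ∀ a < m, ∀ c < m, extMat m D H a c = H a c := fun a ha c hc => by
    simp [extMat, ha, hc]
  have hdiag : ∀ a < m, negCols m (extMat m D H) a a = H a a := fun a ha => by
    simp [negCols, hE a ha a ha]
  refine ⟨fun a ha => ?_, fun a ha c hc => ?_, fun a ha => ?_, fun a x hx hx0 => ?_⟩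
  -- The row differs from the row of `H` by a multiple of `D` in the column `a + 1`.
  · obtain ⟨t, ht⟩ : D ∣ ∑ u ∈ Finset.range (m + 1), extMat m D H a u := by
      rw [Finset.sum_range_succ, Finset.sum_congr rfl
        (fun u hu => hE a ha u (Finset.mem_range.mp hu))]
      simp only [extMat, ha, if_true, lt_irrefl, if_false]
      set s := ∑ i ∈ Finset.range m, H a i
      have := Int.emod_add_mul_ediv (-s) D
      exact ⟨-(-s / D), by linarith⟩
    by_cases ha1 : a + 1 < m
    · have : row m (negCols m (extMat m D H)) a =
          row m H a - t • Pi.single (⟨a + 1, ha1⟩ : Fin m) D := by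
        funext c
        simp only [row, negCols, Pi.sub_apply, Pi.smul_apply, smul_eq_mul]
        by_cases hc : c = ⟨a + 1, ha1⟩
        · subst hc
          simp [hE a ha (a + 1) ha1, ht, mul_comm]
        · have hc' : (c : ℕ) ≠ a + 1 := fun h => hc (Fin.ext h)
          simp [hc, hc', hE a ha c c.2]
      rw [this]
      exact Λ.sub_mem (h.mem a ha) (Λ.smul_mem _ (hDΛ _))
    · have : row m (negCols m (extMat m D H)) a = row m H a := by
        funext c
        have hc' : (c : ℕ) ≠ a + 1 := by omega
        simp [row, negCols, hc', hE a ha c c.2]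
      rw [this]
      exact h.mem a ha
  · have : c ≠ a + 1 := by omega
    simp [negCols, this, hE a ha c (by omega), h.zero a ha c hc]
  · rw [hdiag a ha]; exact h.pos a ha
  · rw [hdiag a a.2]; exact h.dvd a x hx hx0

theorem proj_col_succ (E : ℕ → ℕ → ℤ) (a : Fin m) :
    proj m ((lapMat m E).col a.succ) = -row m (negCols m E) a := by
  funext c
  simp only [proj_apply, Matrix.col_apply, lapMat, Matrix.of_apply, Pi.neg_apply, row, negCols]
  have h1 : (c.castSucc = a.succ) ↔ (c : ℕ) = a + 1 := by
    rw [Fin.ext_iff]; simp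
  have h2 : rowOf m (a.succ : Fin (m + 1)) = a := by
    rw [Fin.val_succ, rowOf_succ a.2]
  by_cases hc : (c : ℕ) = a + 1
  · rw [if_pos (h1.mpr hc), if_pos hc, h2]; simp
  · rw [if_neg (fun h => hc (h1.mp h)), if_neg hc, h2]; simp

theorem proj_col_zero_mem (hDΛ : ∀ j : Fin m, Pi.single j D ∈ Λ) :
    proj m ((lapMat m (extMat m D H)).col 0) ∈ Λ := by
  rcases Nat.eq_zero_or_pos m with rfl | hm
  · have : proj 0 ((lapMat 0 (extMat 0 D H)).col 0) = 0 := funext fun i => i.elim0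
    rw [this]; exact Λ.zero_mem
  · have h1 : ∀ c < m, extMat m D H m c = 0 := fun c hc => by simp [extMat, hc.ne]
    have h2 : extMat m D H m m = D := by simp [extMat]
    have : proj m ((lapMat m (extMat m D H)).col 0) = Pi.single (⟨0, hm⟩ : Fin m) D := by
      funext c
      simp only [proj_apply, Matrix.col_apply, lapMat, Matrix.of_apply, Fin.val_zero, rowOf_zero,
        Fin.val_castSucc, Finset.sum_range_succ, h2]
      rw [Finset.sum_eq_zero (fun u hu => h1 u (Finset.mem_range.mp hu))]
      by_cases hc : c = ⟨0, hm⟩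
      · subst hc
        simp [h1 0 hm]
      · have : c.castSucc ≠ 0 := fun h => hc (Fin.ext (by simpa using congrArg Fin.val h))
        simp [this, hc, h1 c c.2]
    rw [this]; exact hDΛ _

theorem range_lapMat {L : Submodule ℤ (Fin (m + 1) → ℤ)} (hL : L ≤ sumZero (m + 1))
    (h : IsHNF (L.map (proj m)) H) (hDΛ : ∀ j : Fin m, Pi.single j D ∈ L.map (proj m)) :
    L = LinearMap.range (lapMat m (extMat m D H)).mulVecLin := by
  rw [Matrix.range_mulVecLin]
  apply eq_of_map_proj_eq hL
  · rw [Submodule.span_le]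
    rintro _ ⟨w, rfl⟩
    exact lapMat_sum m _ w
  · have ht := triBasis_negCols h hDΛ
    rw [Submodule.map_span]
    apply le_antisymm
    · rw [← ht.span_eq, Submodule.span_le]
      rintro _ ⟨a, rfl⟩
      have : proj m ((lapMat m (extMat m D H)).col a.succ) ∈ Submodule.span ℤ
          (proj m '' Set.range (lapMat m (extMat m D H)).col) :=
        Submodule.subset_span ⟨_, ⟨_, rfl⟩, rfl⟩
      rw [proj_col_succ] at this
      simpa using Submodule.neg_mem _ this
    · rw [Submodule.span_le]
      rintro _ ⟨_, ⟨w, rfl⟩, rfl⟩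
      induction w using Fin.cases with
      | zero => exact proj_col_zero_mem hDΛ
      | succ a =>
        rw [proj_col_succ]
        exact Submodule.neg_mem _ (ht.mem a a.2)

/-- A lattice in Hermite normal form is the lattice of the Laplacian of a strongly connected
digraph: the pivots give an edge from every vertex to its predecessor, and the last row of
`extMat` gives an edge from the first vertex to the last one. -/
theorem exists_digraph {L : Submodule ℤ (Fin (m + 1) → ℤ)} (hL : L ≤ sumZero (m + 1))
    (h : IsHNF (L.map (proj m)) H) (hD : 0 < D)
    (hDΛ : ∀ j : Fin m, Pi.single j D ∈ L.map (proj m)) :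
    ∃ G : DiMultigraph (Fin (m + 1)), G.StronglyConnected ∧
      G.laplacian = lapMat m (extMat m D H) ∧ L = LinearMap.range G.laplacian.mulVecLin ∧
      ∀ v w, |G.laplacian v w| ≤ (m + 1 : ℕ) * D := by
  set E := extMat m D H with hEdef
  have h0 : ∀ a c, 0 ≤ E a c := fun a c => extMat_nonneg h hD c
  let d : Fin (m + 1) → Fin (m + 1) → ℕ := fun w v =>
    if v = w then 0 else (E (rowOf m w) v).toNat
  have hlap : (digraphOf d).laplacian = lapMat m E := by
    ext v w
    simp only [DiMultigraph.laplacian, lapMat, Matrix.of_apply, mult_digraphOf, outdeg_digraphOf]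
    split_ifs with hvw
    · subst hvw
      have h1 : ∀ u, ((d v u : ℕ) : ℤ) =
          E (rowOf m v) u - if u = v then E (rowOf m v) u else 0 := by
        intro u
        simp only [d]
        split_ifs <;> simp [h0]
      have h2 : d v v = 0 := by simp [d]
      rw [h2]
      push_cast
      simp only [h1, Finset.sum_sub_distrib, Finset.sum_ite_eq', Finset.mem_univ, if_true,
        Finset.sum_range]
      ring
    · simp [d, hvw, h0]
  refine ⟨digraphOf d, ?_, hlap, hlap ▸ range_lapMat hL h hDΛ,
    fun v w => by rw [hlap]; exact lapMat_abs_le h hD hDΛ v w⟩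
  have edge : ∀ v w : Fin (m + 1), v ≠ w → 0 < E (rowOf m v) w →
      ∃ e : (digraphOf d).E, (digraphOf d).tail e = v ∧ (digraphOf d).head e = w := by
    intro v w hvw hpos
    have : 0 < d v w := by simp [d, hvw.symm, hpos]
    exact ⟨⟨(v, w), ⟨0, this⟩⟩, rfl, rfl⟩
  have down : ∀ k (v w : Fin (m + 1)), (v : ℕ) = w + k → Relation.ReflTransGen
      (fun a b => ∃ e : (digraphOf d).E, (digraphOf d).tail e = a ∧ (digraphOf d).head e = b)
      v w := by
    intro k
    induction k with
    | zero => intro v w hvw; rw [Fin.ext hvw]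
    | succ k ih =>
      intro v w hvw
      have hw : (w : ℕ) + k < m := by omega
      refine Relation.ReflTransGen.head (edge v ⟨w + k, by omega⟩ ?_ ?_) (ih _ w rfl)
      · intro hcon
        have := congrArg Fin.val hcon
        simp only at this
        omega
      · rw [show (v : ℕ) = (w + k) + 1 by omega, rowOf_succ hw]
        simp only [hEdef, extMat, hw, if_true]
        exact h.pos _ hw
  intro v w
  refine (down v v 0 (by simp)).trans (Relation.ReflTransGen.trans ?_
    (down (m - w) (Fin.last m) w (by simp; omega)))
  rcases Nat.eq_zero_or_pos m with rfl | hm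
  · exact .refl
  · refine .single (edge 0 (Fin.last m) (by simp [Fin.ext_iff, hm.ne]) ?_)
    simpa [rowOf_zero, hEdef, extMat] using hD

end

/-! ### Loops over an index range -/

theorem wp_seq {X N : ℕ} {s t : Stmt} {Q R : St → Prop} {σ : St} (hs : wp X N s R σ)
    (ht : ∀ τ, R τ → wp X N t Q τ) : wp X N (.seq s t) Q σ := wp_mono s ht hs

/-- The loop in which the variable `x` runs through `c` values from `l` on. -/
def forLoop (x : ℕ) (l c : Expr) (s : Stmt) : Stmt :=
  .seq (.assign x l) (.loop false c (.seq s (.assign x (.add (.var x) (.const 1)))))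

theorem wp_for {X N x : ℕ} {lo c : Expr} {s : Stmt} {Q : St → Prop} {σ : St}
    (I : ℕ → St → Prop) (l M : ℕ) (hl : lo.eval σ = l) (hc : c.eval (σ.set x l) = M) (hN : M ≤ N)
    (hX : l + M ≤ X) (hI : ∀ i τ v, I i τ → I i (τ.set x v)) (h0 : I 0 σ)
    (hs : ∀ i τ, i < M → τ.var x = ((l + i : ℕ) : ℤ) → I i τ →
      wp X N s (fun τ' => τ'.var x = ((l + i : ℕ) : ℤ) ∧ I (i + 1) τ') τ)
    (hQ : ∀ τ, I M τ → Q τ) : wp X N (forLoop x lo c s) Q σ := by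
  unfold forLoop
  refine ⟨by rw [hl]; simp; omega, ?_⟩
  rw [hl]
  refine wp_loop (fun i τ => τ.var x = ((l + i : ℕ) : ℤ) ∧ I i τ) M (by rw [hc]; simp [cnt]) hN
    ⟨by simp [St.set], hI _ _ _ h0⟩ ?_ (fun τ h => hQ τ h.2)
  rintro i τ hi ⟨hx, h⟩
  refine wp_mono s ?_ (hs i τ hi hx h)
  rintro τ' ⟨hx', h'⟩
  simp only [wp, Expr.eval, hx']
  refine ⟨by omega, by simp [St.set]; omega, hI _ _ _ h'⟩

/-- The state `τ` agrees with `σ` in the variables below `l`, the unread input and the output, and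
has the memory `f`. -/
structure Post (l : ℕ) (σ : St) (f : ℕ → ℕ → ℤ) (τ : St) : Prop where
  var : ∀ y < l, τ.var y = σ.var y
  mem : τ.mem = f
  inp : τ.inp = σ.inp
  out : τ.out = σ.out

theorem Post.refl (l : ℕ) (σ : St) : Post l σ σ.mem σ := ⟨fun _ _ => rfl, rfl, rfl, rfl⟩

theorem Post.set {l : ℕ} {σ τ : St} {f : ℕ → ℕ → ℤ} (h : Post l σ f τ) {x : ℕ} (hx : l ≤ x)
    (v : ℤ) : Post l σ f (τ.set x v) := by
  refine ⟨fun y hy => ?_, h.mem, h.inp, h.out⟩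
  have : y ≠ x := by omega
  simp [St.set, this, h.var y hy]

theorem Post.trans {l l' : ℕ} {σ τ υ : St} {f g : ℕ → ℕ → ℤ} (h : Post l σ f τ)
    (h' : Post l' τ g υ) (hl : l ≤ l') : Post l σ g υ :=
  ⟨fun y hy => (h'.var y (by omega)).trans (h.var y hy), h'.mem, h'.inp.trans h.inp,
    h'.out.trans h.out⟩

theorem eval_mod (σ : St) (a b : Expr) : (Expr.mod a b).eval σ = a.eval σ % b.eval σ := by
  simp only [Expr.mod, Expr.eval, Int.emod_def, mul_comm]

/-! ### Elimination modulo `T` -/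

/-- The matrix after a division step in the Euclidean algorithm: the row `k` replaces the row `a`, and
the row `a` minus `q` times the row `k`, reduced modulo `T`, replaces the row `k`. -/
def swapStep (m : ℕ) (T : ℤ) (a k : ℕ) (q : ℤ) (A : ℕ → ℕ → ℤ) : ℕ → ℕ → ℤ := fun r c =>
  if c < m then if r = a then A k c else if r = k then (A a c - q * A k c) % T else A r c
  else A r c

/-- A division step for the rows whose numbers are in the variables `3` and `4`, applied to make the
entry of the second row in the column of the pivot of the first row smaller. -/
def stepRows : Stmt :=
  .ifnz (.ld (.var 4) (.var 3)) (.seq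
    (.assign 5 (.div (.ld (.var 3) (.var 3)) (.ld (.var 4) (.var 3))))
    (forLoop 6 (.const 0) (.var 1) (.seq
      (.assign 7 (.mod (.sub (.ld (.var 3) (.var 6)) (.mul (.var 5) (.ld (.var 4) (.var 6))))
        (.var 2)))
      (.seq (.store (.var 3) (.var 6) (.ld (.var 4) (.var 6)))
        (.store (.var 4) (.var 6) (.var 7))))))

theorem emod_natAbs_le {x T : ℤ} {X : ℕ} (hT : 0 < T) (hX : T ≤ X) : (x % T).natAbs ≤ X := by
  have := Int.emod_nonneg x hT.ne'
  have := Int.emod_lt_of_pos x hT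
  omega

theorem wp_stepRows {X N m a k : ℕ} {T : ℤ} {σ : St} (h1 : σ.var 1 = m) (h2 : σ.var 2 = T)
    (h3 : σ.var 3 = a) (h4 : σ.var 4 = k) (hak : a ≠ k) (hT : 0 < T) (hTX : T ≤ X) (hmX : m ≤ X)
    (hmN : m ≤ N) (ha : (σ.mem a a).natAbs ≤ X) (hk : ∀ c < m, (σ.mem k c).natAbs ≤ X) :
    wp X N stepRows (Post 5 σ (if σ.mem k a = 0 then σ.mem else
      swapStep m T a k (σ.mem a a / σ.mem k a) σ.mem)) σ := by
  simp only [stepRows, wp, Expr.eval, h3, h4, Int.natAbs_natCast]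
  refine ⟨fun h0 => ⟨(Int.natAbs_ediv_le_natAbs _ _).trans ha, ?_⟩, fun h0 => ?_⟩
  · rw [if_neg h0]
    set q := σ.mem a a / σ.mem k a
    set σ' := σ.set 5 q with hσ'
    refine wp_for (fun i => Post 6 σ' (fun r c => if c < i then swapStep m T a k q σ.mem r c else
      σ.mem r c)) 0 m rfl ?_ hmN (by omega) (fun i τ v h => h.set le_rfl v) ?_ ?_ ?_
    · simp [Expr.eval, St.set, hσ', h1]
    · exact ⟨fun _ _ => rfl, by funext r c; simp [hσ', St.set], rfl, rfl⟩
    · intro i τ hi hx h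
      have v2 : τ.var 2 = T := by rw [h.var 2 (by omega)]; simp [hσ', St.set, h2]
      have v3 : τ.var 3 = a := by rw [h.var 3 (by omega)]; simp [hσ', St.set, h3]
      have v4 : τ.var 4 = k := by rw [h.var 4 (by omega)]; simp [hσ', St.set, h4]
      have v5 : τ.var 5 = q := by rw [h.var 5 (by omega)]; simp [hσ', St.set]
      have v6 : τ.var 6 = i := by simpa using hx
      have m1 : ∀ r, τ.mem r i = σ.mem r i := fun r => by rw [h.mem]; simp
      simp [wp, eval_mod, Expr.eval, St.set, St.put, v2, v3, v4, v5, v6, m1,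
        emod_natAbs_le hT hTX, hk i hi]
      refine ⟨fun y hy => ?_, ?_, h.inp, h.out⟩
      · have : y ≠ 7 := by omega
        simp [this, h.var y hy]
      · funext r c
        simp only [h.mem, swapStep]
        by_cases hc : c = i
        · subst hc
          by_cases hra : r = a
          · subst hra; simp [hi, hak]
          · by_cases hrk : r = k
            · subst hrk; simp [hi, hra]
            · simp [hra, hrk]
        · have e1 : c ≤ i ↔ c < i := by omega
          simp [hc, e1]
    · intro τ h
      refine ⟨fun y hy => ?_, ?_, h.inp, h.out⟩
      · have : y ≠ 5 := by omega
        rw [h.var y (by omega)]; simp [hσ', St.set, this]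
      · rw [h.mem]; funext r c
        by_cases hc : c < m <;> simp [hc, swapStep]
  · rw [if_pos h0]; exact Post.refl 5 σ

/-- The entries of the first `2 * m` rows are between `0` and `T`, and those below the diagonal are
zero in the first `a` columns. -/
structure Stage (m : ℕ) (T : ℤ) (a : ℕ) (A : ℕ → ℕ → ℤ) : Prop where
  nonneg : ∀ r < 2 * m, ∀ c < m, 0 ≤ A r c
  le : ∀ r < 2 * m, ∀ c < m, A r c ≤ T
  zero : ∀ r < 2 * m, ∀ c < m, c < a → c < r → A r c = 0

theorem Stage.swapStep {m a k : ℕ} {T q : ℤ} {A : ℕ → ℕ → ℤ} (h : Stage m T a A) (hak : a < k)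
    (hk : k < 2 * m) (hT : 0 < T) : Stage m T a (swapStep m T a k q A) := by
  refine ⟨fun r hr c hc => ?_, fun r hr c hc => ?_, fun r hr c hc hca hcr => ?_⟩
  · simp only [Prog.swapStep, hc, if_true]
    split_ifs
    · exact h.nonneg k hk c hc
    · exact Int.emod_nonneg _ hT.ne'
    · exact h.nonneg r hr c hc
  · simp only [Prog.swapStep, hc, if_true]
    split_ifs
    · exact h.le k hk c hc
    · exact (Int.emod_lt_of_pos _ hT).le
    · exact h.le r hr c hc
  · simp only [Prog.swapStep, hc, if_true]
    split_ifs
    · exact h.zero k hk c hc hca (by omega)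
    · rw [h.zero k hk c hc hca (by omega), h.zero a (by omega) c hc hca hca]; simp
    · exact h.zero r hr c hc hca hcr

/-- The first part of a pass: all entries are reduced modulo `T`. -/
def reduceAll : Stmt :=
  forLoop 3 (.const 0) (.var 1) (forLoop 4 (.const 0) (.var 1)
    (.store (.var 3) (.var 4) (.mod (.ld (.var 3) (.var 4)) (.var 2))))

theorem wp_reduceAll {X N m : ℕ} {T : ℤ} {σ : St} (h1 : σ.var 1 = m) (h2 : σ.var 2 = T)
    (hT : 0 < T) (hTX : T ≤ X) (hmX : m ≤ X) (hmN : m ≤ N) :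
    wp X N reduceAll (Post 3 σ fun r c => if r < m ∧ c < m then σ.mem r c % T else σ.mem r c) σ := by
  refine wp_for (fun i => Post 3 σ fun r c => if r < i ∧ c < m then σ.mem r c % T else σ.mem r c)
    0 m rfl (by simp [Expr.eval, St.set, h1]) hmN (by omega) (fun i τ v h => h.set le_rfl v)
    (by simpa using Post.refl 3 σ) ?_ (fun τ h => h)
  intro i τ hi hx h
  have v1 : τ.var 1 = m := by rw [h.var 1 (by omega), h1]
  have v2 : τ.var 2 = T := by rw [h.var 2 (by omega), h2]
  have v3 : τ.var 3 = i := by simpa using hx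
  refine wp_for (fun j => Post 4 τ fun r c => if r < i ∧ c < m ∨ r = i ∧ c < j then σ.mem r c % T
    else σ.mem r c) 0 m rfl (by simp [Expr.eval, St.set, v1]) hmN (by omega)
    (fun i τ v h => h.set le_rfl v) ?_ ?_ ?_
  · have := Post.refl 4 τ
    rw [h.mem] at this
    simpa using this
  · intro j υ hj hy h'
    have w2 : υ.var 2 = T := by rw [h'.var 2 (by omega), v2]
    have w3 : υ.var 3 = i := by rw [h'.var 3 (by omega), v3]
    have w4 : υ.var 4 = j := by simpa using hy
    have m1 : υ.mem i j = σ.mem i j := by rw [h'.mem]; simp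
    simp [wp, eval_mod, Expr.eval, St.put, w2, w3, w4, m1, emod_natAbs_le hT hTX]
    refine ⟨h'.var, ?_, h'.inp, h'.out⟩
    funext r c
    simp only [h'.mem]
    by_cases hr : r = i
    · subst hr
      by_cases hc : c = j
      · subst hc; simp
      · have e1 : c ≤ j ↔ c < j := by omega
        simp [hc, e1]
    · simp [hr]
  · intro υ h'
    refine ⟨by rw [h'.var 3 (by omega), hx], ?_⟩
    have := h.trans h' (by omega)
    convert this using 4
    omega

/-- Transformation of the matrix to triangular form by the Euclidean algorithm on its rows, modulo
`T`. -/
def eliminate : Stmt :=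
  forLoop 3 (.const 0) (.var 1) (forLoop 4 (.add (.var 3) (.const 1))
    (.sub (.sub (.mul (.const 2) (.var 1)) (.const 1)) (.var 3))
    (.loop true (.mul (.const 4) (.mul (.var 2) (.var 2))) stepRows))

theorem euclid_halving {x y P B : ℤ} (hy : 0 < y) (hyx : y < x) (h : x * y * P ≤ B)
    (hP : 0 ≤ P) : y * (x % y) * (P * 2) ≤ B := by
  have h1 := Int.emod_nonneg x hy.ne'
  have h2 := Int.emod_lt_of_pos x hy
  have h3 : y + x % y ≤ x := by
    have h4 := Int.emod_add_mul_ediv x y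
    have h5 : 1 ≤ x / y := Int.le_ediv_of_mul_le hy (by omega)
    nlinarith
  have h6 : y * (x % y) * 2 ≤ x * y := by nlinarith
  nlinarith

/-- Elimination preserves every property `P` that is preserved by the division steps and allows to
pass to the next column, and it leads to an upper triangular matrix. The product of the two entries
in the pivot column, at first at most `T * T`, is halved in each division step but the first one; so
it is zero after as many steps as `4 * (T * T)` has binary digits. -/
theorem wp_eliminate {X N m : ℕ} {T : ℤ} {σ : St} (P : ℕ → (ℕ → ℕ → ℤ) → Prop)
    (h1 : σ.var 1 = m) (h2 : σ.var 2 = T) (hT : 0 < T) (hTX : T ≤ X) (hmX : 2 * m ≤ X)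
    (hmN : 2 * m ≤ N) (hTN : cnt true (4 * (T * T)) ≤ N) (h0 : Stage m T 0 σ.mem)
    (hP0 : P 0 σ.mem)
    (hstep : ∀ a k A, a < m → a < k → k < 2 * m → Stage m T a A → A k a ≠ 0 → P a A →
      P a (swapStep m T a k (A a a / A k a) A))
    (hnext : ∀ a A, P a A → P (a + 1) A) :
    wp X N eliminate (fun τ => ∃ A, Stage m T m A ∧ P m A ∧ Post 3 σ A τ) σ := by
  have hC : 4 * (T * T) < 2 ^ cnt true (4 * (T * T)) := by
    have h := Nat.lt_size_self (4 * (T * T)).toNat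
    have h' : ((4 * (T * T)).toNat : ℤ) = 4 * (T * T) := Int.toNat_of_nonneg (by positivity)
    simp only [cnt, if_true]
    rw [← h']
    exact_mod_cast h
  set C := cnt true (4 * (T * T)) with hCdef
  refine wp_for (fun a τ => ∃ A, Stage m T a A ∧ P a A ∧ Post 3 σ A τ) 0 m rfl
    (by simp [Expr.eval, St.set, h1]) (by omega) (by omega)
    (fun i τ v ⟨A, hA, hP, h⟩ => ⟨A, hA, hP, h.set le_rfl v⟩) ⟨σ.mem, h0, hP0, Post.refl 3 σ⟩ ?_
    (fun τ h => h)
  rintro a τ ha hx ⟨A, hA, hP, h⟩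
  have v1 : τ.var 1 = m := by rw [h.var 1 (by omega), h1]
  have v2 : τ.var 2 = T := by rw [h.var 2 (by omega), h2]
  have v3 : τ.var 3 = a := by simpa using hx
  refine wp_for (fun i υ => ∃ A, Stage m T a A ∧ P a A ∧ (∀ r, a < r → r < a + 1 + i → A r a = 0) ∧
    Post 4 τ A υ) (a + 1) (2 * m - 1 - a) (by simp [Expr.eval, v3])
    (by simp [Expr.eval, St.set, v1, v3]; omega) (by omega) (by omega)
    (fun i τ v ⟨A, hA, hP, hz, h⟩ => ⟨A, hA, hP, hz, h.set le_rfl v⟩)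
    ⟨A, hA, hP, fun r _ _ => by omega, by have := Post.refl 4 τ; rwa [h.mem] at this⟩ ?_ ?_
  · rintro i υ hi hy ⟨A, hA, hP, hz, h'⟩
    have w1 : υ.var 1 = m := by rw [h'.var 1 (by omega), v1]
    have w2 : υ.var 2 = T := by rw [h'.var 2 (by omega), v2]
    have w3 : υ.var 3 = a := by rw [h'.var 3 (by omega), v3]
    set k := a + 1 + i with hk
    -- `j = 0` is an alternative since the first step may only exchange the two entries.
    refine wp_loop (fun j ω => ∃ A, Stage m T a A ∧ P a A ∧
      (∀ r, a < r → r < k → A r a = 0) ∧ (A k a < A a a ∨ A k a = 0 ∨ j = 0) ∧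
      A a a * A k a * 2 ^ j ≤ 2 * (T * T) ∧ Post 5 υ A ω) C
      (by simp [Expr.eval, w2, hCdef]) hTN ?_ ?_ ?_
    · refine ⟨A, hA, hP, hz, Or.inr (Or.inr rfl), ?_, by
        have := Post.refl 5 υ; rwa [h'.mem] at this⟩
      have b1 := hA.le a (by omega) a ha
      have b2 := hA.le k (by omega) a ha
      have b3 := hA.nonneg a (by omega) a ha
      have b4 := hA.nonneg k (by omega) a ha
      nlinarith
    · rintro j ω hj ⟨A, hA, hP, hz, hlt, hprod, h⟩
      have hm := h.mem
      subst hm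
      refine wp_mono _ ?_ (wp_stepRows (a := a) (k := k) (m := m) (T := T)
        (by rw [h.var 1 (by omega), w1]) (by rw [h.var 2 (by omega), w2])
        (by rw [h.var 3 (by omega), w3]) (by rw [h.var 4 (by omega), hy]) (by omega) hT hTX
        (by omega) (by omega) ?_ ?_)
      · intro ω' h'
        by_cases h0 : ω.mem k a = 0
        · rw [if_pos h0] at h'
          refine ⟨ω.mem, hA, hP, hz, Or.inr (Or.inl h0), ?_, h.trans h' le_rfl⟩
          rw [h0]; simp; positivity
        · rw [if_neg h0] at h'
          have b1 := hA.le a (by omega) a ha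
          have b2 := hA.le k (by omega) a ha
          have b3 := hA.nonneg a (by omega) a ha
          have b4 : 0 < ω.mem k a := lt_of_le_of_ne (hA.nonneg k (by omega) a ha) (Ne.symm h0)
          have b5 := Int.emod_nonneg (ω.mem a a) b4.ne'
          have b6 := Int.emod_lt_of_pos (ω.mem a a) b4
          have e1 : swapStep m T a k (ω.mem a a / ω.mem k a) ω.mem a a = ω.mem k a := by
            simp [swapStep, ha]
          have e2 : swapStep m T a k (ω.mem a a / ω.mem k a) ω.mem k a =
              ω.mem a a % ω.mem k a := by
            have : k ≠ a := by omega
            simp only [swapStep, ha, if_true, this, if_false]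
            rw [mul_comm, ← Int.emod_def]
            exact Int.emod_eq_of_lt b5 (by omega)
          refine ⟨_, hA.swapStep (by omega) (by omega) hT,
            hstep a k _ ha (by omega) (by omega) hA h0 hP, ?_, ?_, ?_, h.trans h' le_rfl⟩
          · intro r har hrk
            have n1 : r ≠ a := by omega
            have n2 : r ≠ k := by omega
            simp only [swapStep, ha, if_true, n1, n2, if_false]
            exact hz r har hrk
          · left; rw [e1, e2]; exact b6
          · rw [e1, e2, pow_succ]
            rcases hlt with hlt | hlt | hlt
            · exact euclid_halving b4 hlt hprod (by positivity)
            · exact absurd hlt h0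
            · subst hlt
              rw [pow_zero, one_mul]
              nlinarith
      · have b1 := hA.le a (by omega) a ha
        have b3 := hA.nonneg a (by omega) a ha
        omega
      · intro c hc
        have b1 := hA.le k (by omega) c hc
        have b3 := hA.nonneg k (by omega) c hc
        omega
    · rintro ω ⟨A, hA, hP, hz, hlt, hprod, h⟩
      refine ⟨by rw [h.var 4 (by omega), hy], A, hA, hP, ?_, h'.trans h (by omega)⟩
      have b3 := hA.nonneg a (by omega) a ha
      have b4 := hA.nonneg k (by omega) a ha
      have hprod0 : A a a * A k a = 0 := by
        by_contra hne
        have : 1 ≤ A a a * A k a := lt_of_le_of_ne (by positivity) (Ne.symm hne)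
        nlinarith
      have hCpos : C ≠ 0 := by
        intro hC0
        rw [hC0] at hC
        nlinarith
      have hk0 : A k a = 0 := by
        rcases mul_eq_zero.mp hprod0 with h0 | h0
        · rcases hlt with hlt | hlt | hlt
          · omega
          · exact hlt
          · exact absurd hlt hCpos
        · exact h0
      intro r har hr
      rcases (show r < k ∨ r = k by omega) with h1 | rfl
      · exact hz r har h1
      · exact hk0
  · rintro υ ⟨A, hA, hP, hz, h'⟩
    refine ⟨by rw [h'.var 3 (by omega), hx], A, ⟨hA.nonneg, hA.le, ?_⟩, hnext a A hP,
      h.trans h' (by omega)⟩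
    intro r hr c hc hca hcr
    rcases (show c < a ∨ c = a by omega) with h1 | rfl
    · exact hA.zero r hr c hc h1 hcr
    · exact hz r hcr (by omega)

/-- A pass: reduction modulo `T`, and elimination. -/
def pass : Stmt := .seq reduceAll eliminate

/-! ### The determinant by elimination modulo a large number -/

/-- The determinant, modulo `t`, of the upper left `m` by `m` submatrix. -/
def detMod (m t : ℕ) (A : ℕ → ℕ → ℤ) : ZMod t :=
  (Matrix.of fun i j : Fin m => (A i j : ZMod t)).det

theorem detMod_swapStep {m t a k : ℕ} (q : ℤ) (A : ℕ → ℕ → ℤ) (ha : a < m) (hk : k < m)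
    (hak : a ≠ k) : detMod m t (swapStep m t a k q A) = -detMod m t A := by
  let i : Fin m := ⟨a, ha⟩
  let j : Fin m := ⟨k, hk⟩
  have hij : i ≠ j := fun h => hak (congrArg Fin.val h)
  let M : Matrix (Fin m) (Fin m) (ZMod t) := Matrix.of fun i j : Fin m => (A i j : ZMod t)
  let M' := M.updateRow i (M i + (-(q : ZMod t)) • M j)
  have h1 : M'.det = M.det := Matrix.det_updateRow_add_smul_self M hij _
  have h2 : Matrix.of (fun i j : Fin m => (swapStep m t a k q A i j : ZMod t)) =
      M'.submatrix (Equiv.swap i j) id := by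
    ext r c
    have er : (r : ℕ) = a ↔ r = i := by rw [Fin.ext_iff]
    have ek : (r : ℕ) = k ↔ r = j := by rw [Fin.ext_iff]
    simp only [Matrix.of_apply, swapStep, c.2, if_true, er, ek, Matrix.submatrix_apply, id]
    by_cases hr : r = i
    · subst hr
      simp [M', M, hij.symm, j]
    · by_cases hr' : r = j
      · subst hr'
        simp only [hr, if_false, if_true, Equiv.swap_apply_right, M', Matrix.updateRow_self,
          ZMod.intCast_mod]
        simp [M, i, j, sub_eq_add_neg]
      · simp [hr, hr', Equiv.swap_apply_of_ne_of_ne hr hr', M', M]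
  rw [detMod, h2, Matrix.det_permute, Equiv.Perm.sign_swap hij, h1]
  simp [detMod, M]

theorem wp_pass_det {X N m t : ℕ} {σ : St} (h1 : σ.var 1 = m) (h2 : σ.var 2 = t) (ht : 0 < t)
    (hTX : t ≤ X) (hmX : 2 * m ≤ X) (hmN : 2 * m ≤ N) (hTN : cnt true (4 * ((t : ℤ) * t)) ≤ N)
    (hz : ∀ r, m ≤ r → r < 2 * m → ∀ c < m, σ.mem r c = 0) :
    wp X N pass (fun τ => ∃ A, Stage m t m A ∧ (∀ r c, 2 * m ≤ r → A r c = σ.mem r c) ∧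
      (∀ r, m ≤ r → r < 2 * m → ∀ c < m, A r c = 0) ∧
      (detMod m t A = detMod m t σ.mem ∨ detMod m t A = -detMod m t σ.mem) ∧ Post 3 σ A τ) σ := by
  have ht' : (0 : ℤ) < t := by exact_mod_cast ht
  refine wp_seq (wp_reduceAll (m := m) h1 h2 ht' (by exact_mod_cast hTX) (by omega) (by omega)) ?_
  intro τ h
  set B : ℕ → ℕ → ℤ := fun r c => if r < m ∧ c < m then σ.mem r c % t else σ.mem r c with hB
  have hBz : ∀ r, m ≤ r → r < 2 * m → ∀ c < m, B r c = 0 := fun r hr hr' c hc => by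
    have : ¬ r < m := by omega
    simp [hB, this, hz r hr hr' c hc]
  have hdet : detMod m t B = detMod m t σ.mem := by
    unfold detMod
    congr 1
    ext i j
    simp [hB]
  have hst : Stage m t 0 B := by
    refine ⟨fun r hr c hc => ?_, fun r hr c hc => ?_, fun r hr c hc h0 => by omega⟩
    · by_cases hrm : r < m
      · simp only [hB, hrm, hc, and_self, if_true]; exact Int.emod_nonneg _ ht'.ne'
      · rw [hBz r (by omega) hr c hc]
    · by_cases hrm : r < m
      · simp only [hB, hrm, hc, and_self, if_true]; exact (Int.emod_lt_of_pos _ ht').le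
      · rw [hBz r (by omega) hr c hc]; exact ht'.le
  refine wp_mono _ ?_ (wp_eliminate (m := m) (T := t) (fun _ A =>
    (∀ r c, 2 * m ≤ r → A r c = σ.mem r c) ∧
    (∀ r, m ≤ r → r < 2 * m → ∀ c < m, A r c = 0) ∧
    (detMod m t A = detMod m t σ.mem ∨ detMod m t A = -detMod m t σ.mem))
    (by rw [h.var 1 (by omega), h1]) (by rw [h.var 2 (by omega), h2]) ht'
    (by exact_mod_cast hTX) hmX hmN hTN (by rw [h.mem]; exact hst) ?_ ?_ (fun a A hA => hA))
  · rintro υ ⟨A, hA, ⟨hA1, hA2, hA3⟩, h'⟩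
    exact ⟨A, hA, hA1, hA2, hA3, h.trans h' le_rfl⟩
  · rw [h.mem]
    refine ⟨fun r c hr => ?_, hBz, Or.inl hdet⟩
    have : ¬ r < m := by omega
    simp [hB, this]
  · rintro a k A ha hak hk hst h0 ⟨hA1, hA2, hA3⟩
    have hkm : k < m := by
      by_contra hcon
      exact h0 (hA2 k (by omega) hk a ha)
    refine ⟨fun r c hr => ?_, fun r hr hr' c hc => ?_, ?_⟩
    · have n1 : r ≠ a := by omega
      have n2 : r ≠ k := by omega
      simp [swapStep, n1, n2, hA1 r c hr]
    · have n1 : r ≠ a := by omega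
      have n2 : r ≠ k := by omega
      simp [swapStep, n1, n2, hA2 r hr hr' c hc]
    · rw [detMod_swapStep _ A ha hkm (by omega)]
      rcases hA3 with h3 | h3
      · right; rw [h3]
      · left; rw [h3, neg_neg]

/-- After a pass, the absolute value of the determinant is computed into the variable `2`, if the
modulus exceeds twice that value. -/
def computeDet : Stmt :=
  .seq (.assign 3 (.const 1)) (.seq
    (forLoop 4 (.const 0) (.var 1)
      (.assign 3 (.mod (.mul (.var 3) (.ld (.var 4) (.var 4))) (.var 2))))
    (.assign 2 (.add (.var 3) (.mul (.div (.mul (.const 2) (.var 3)) (.var 2))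
      (.sub (.var 2) (.mul (.const 2) (.var 3)))))))

/-- Recovery of `|δ|` from the residue `r` of `δ` or `-δ` modulo `t`: the quotient `2 * r / t` is `0`
if `r` is less than `t / 2`, and `1` otherwise. -/
theorem abs_of_residue {r t δ : ℤ} (h0 : 0 ≤ r) (hrt : r < t) (hδ : 2 * |δ| < t)
    (h : t ∣ r - δ ∨ t ∣ r + δ) : r + 2 * r / t * (t - 2 * r) = |δ| := by
  have key : ∀ s : ℤ, 2 * |s| < t → t ∣ r - s → r + 2 * r / t * (t - 2 * r) = |s| := by
    rintro s hs ⟨u, hu⟩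
    rcases abs_cases s with ⟨e, hs0⟩ | ⟨e, hs0⟩ <;> rw [e] at hs ⊢
    · have hu0 : u = 0 := by
        have : t * u < t * 1 := by linarith
        have h1 : u < 1 := lt_of_mul_lt_mul_left this (by linarith)
        have : t * (-1) < t * u := by linarith
        have h2 : -1 < u := lt_of_mul_lt_mul_left this (by linarith)
        omega
      subst hu0
      rw [Int.ediv_eq_zero_of_lt (by linarith) (by linarith)]
      linarith
    · have hu0 : u = 1 := by
        have : t * u < t * 2 := by linarith
        have h1 : u < 2 := lt_of_mul_lt_mul_left this (by linarith)
        have : t * 0 < t * u := by linarith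
        have h2 : 0 < u := lt_of_mul_lt_mul_left this (by linarith)
        omega
      subst hu0
      have : 2 * r / t = 1 := by
        rw [Int.ediv_eq_iff_of_pos (by linarith)]
        constructor <;> linarith
      rw [this]
      linarith
  rcases h with h | h
  · exact key δ hδ h
  · rw [← abs_neg]; exact key (-δ) (by rwa [abs_neg]) (by simpa using h)

theorem wp_computeDet {X N m t : ℕ} {σ : St} {δ : ℤ} (h1 : σ.var 1 = m) (h2 : σ.var 2 = t)
    (ht : 1 < t) (htX : t ≤ X) (hmX : m ≤ X) (hmN : m ≤ N) (hst : Stage m t m σ.mem)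
    (hdet : detMod m t σ.mem = (δ : ZMod t) ∨ detMod m t σ.mem = -(δ : ZMod t))
    (hδ : 2 * |δ| < t) :
    wp X N computeDet (fun τ => τ.var 2 = |δ| ∧ Post 2 σ σ.mem τ) σ := by
  simp only [computeDet, wp]
  refine ⟨by simp [Expr.eval]; omega, ?_⟩
  have ht' : (0 : ℤ) < t := by omega
  have hdiag : detMod m t σ.mem = ∏ i ∈ Finset.range m, (σ.mem i i : ZMod t) := by
    rw [detMod, Matrix.det_of_isUpperTriangular, Finset.prod_range]
    · rfl
    · intro i j hij
      have hij' : (j : ℕ) < i := hij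
      simp [hst.zero i (by omega) j j.2 j.2 hij']
  refine wp_for (fun i τ => Post 3 σ σ.mem τ ∧ 0 ≤ τ.var 3 ∧ τ.var 3 < t ∧
    (τ.var 3 : ZMod t) = ∏ j ∈ Finset.range i, (σ.mem j j : ZMod t)) 0 m rfl
    (by simp [Expr.eval, St.set, h1]) hmN (by omega) ?_ ?_ ?_ ?_
  · rintro i τ v ⟨h, h'⟩
    exact ⟨h.set (by omega) v, by simpa [St.set] using h'⟩
  · refine ⟨(Post.refl 3 σ).set le_rfl _, ?_⟩
    simp [St.set, Expr.eval, ht]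
  · rintro i τ hi hx ⟨h, h0, hlt, hp⟩
    have v2 : τ.var 2 = t := by rw [h.var 2 (by omega), h2]
    have v4 : τ.var 4 = i := by simpa using hx
    simp only [wp, eval_mod, Expr.eval, v2, v4, h.mem, Int.natAbs_natCast]
    refine ⟨emod_natAbs_le ht' (by exact_mod_cast htX), by simp [St.set, v4],
      h.set le_rfl _, ?_⟩
    simp only [St.set, Function.update_self]
    refine ⟨Int.emod_nonneg _ ht'.ne', Int.emod_lt_of_pos _ ht', ?_⟩
    rw [Finset.prod_range_succ, ← hp]
    simp
  · rintro τ ⟨h, h0, hlt, hp⟩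
    have v2 : τ.var 2 = t := by rw [h.var 2 (by omega), h2]
    have key : τ.var 3 + 2 * τ.var 3 / t * (t - 2 * τ.var 3) = |δ| := by
      apply abs_of_residue h0 hlt hδ
      rw [← hdiag] at hp
      rw [← hp] at hdet
      rcases hdet with h | h
      · left
        rw [← ZMod.intCast_zmod_eq_zero_iff_dvd]
        push_cast
        rw [h, sub_self]
      · right
        rw [← ZMod.intCast_zmod_eq_zero_iff_dvd]
        push_cast
        rw [h, neg_add_cancel]
    simp only [Expr.eval, v2, key]
    have := abs_nonneg δ
    refine ⟨by omega, by simp [St.set], fun y hy => ?_, h.mem, h.inp, h.out⟩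
    have : y ≠ 2 := by omega
    simp [St.set, this, h.var y (by omega)]

/-! ### The Hermite normal form by elimination modulo the determinant -/

theorem mem_iff_of_congr {m : ℕ} {Λ : Submodule ℤ (Fin m → ℤ)} {T : ℤ} {x y : Fin m → ℤ}
    (t : Fin m → ℤ) (hxy : ∀ c, y c = x c + T * t c)
    (h : ∀ c, t c ≠ 0 → Pi.single c T ∈ Λ) : x ∈ Λ ↔ y ∈ Λ := by
  have h1 : y = x + ∑ c, t c • (Pi.single c T : Fin m → ℤ) := by
    funext c
    simp only [Pi.add_apply, Finset.sum_apply, Pi.smul_apply, Pi.single_apply, smul_eq_mul, hxy c]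
    simp [mul_comm]
  have h2 : ∑ c, t c • (Pi.single c T : Fin m → ℤ) ∈ Λ := by
    refine Submodule.sum_mem _ fun c _ => ?_
    by_cases hc : t c = 0
    · simp [hc]
    · exact Λ.smul_mem _ (h c hc)
  rw [h1, Submodule.add_mem_iff_left _ h2]

/-- The first `2 * m` rows of `A` generate the lattice `Λ`: the lattices that contain these rows are
those that contain `Λ`. -/
def Generates {m : ℕ} (Λ : Submodule ℤ (Fin m → ℤ)) (A : ℕ → ℕ → ℤ) : Prop :=
  ∀ Λ' : Submodule ℤ (Fin m → ℤ), (∀ r < 2 * m, row m A r ∈ Λ') ↔ Λ ≤ Λ'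

theorem row_single {m j : ℕ} {T : ℤ} {A : ℕ → ℕ → ℤ} (hj : j < m)
    (h : ∀ c < m, A (m + j) c = if c = j then T else 0) :
    row m A (m + j) = Pi.single (⟨j, hj⟩ : Fin m) T := by
  funext c
  simp [row, h c c.2, Pi.single_apply, Fin.ext_iff]

/-- In a division step in stage `a`, reduction modulo `T` changes only entries in the columns after
`a`: the entries before are zero, and the new entry in the column `a` is a remainder of a division by
a number that is at most `T`. -/
theorem mem_swapStep {m a k : ℕ} {T : ℤ} {A : ℕ → ℕ → ℤ} {Λ' : Submodule ℤ (Fin m → ℤ)}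
    (ha : a < m) (hak : a < k) (hk : k < 2 * m) (hst : Stage m T a A)
    (h0 : A k a ≠ 0) (hΛ : ∀ j (hj : j < m), a < j → Pi.single (⟨j, hj⟩ : Fin m) T ∈ Λ') :
    (row m A a - (A a a / A k a) • row m A k ∈ Λ') ↔
      row m (swapStep m T a k (A a a / A k a) A) k ∈ Λ' := by
  set q := A a a / A k a with hq
  apply mem_iff_of_congr (T := T) (fun c : Fin m => -((A a c - q * A k c) / T))
  · intro c
    have n1 : k ≠ a := by omega
    simp only [row, swapStep, c.2, if_true, n1, if_false, Pi.sub_apply, Pi.smul_apply, smul_eq_mul,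
      Int.emod_def]
    ring
  · intro c hc
    rcases lt_trichotomy (c : ℕ) a with h1 | h1 | h1
    · exfalso
      apply hc
      rw [hst.zero k hk c c.2 h1 (by omega), hst.zero a (by omega) c c.2 h1 h1]
      simp
    · exfalso
      apply hc
      rw [h1, hq, mul_comm, ← Int.emod_def]
      have b1 := hst.le k hk a ha
      have b2 := lt_of_le_of_ne (hst.nonneg k hk a ha) (Ne.symm h0)
      have := Int.emod_nonneg (A a a) h0
      have := Int.emod_lt_of_pos (A a a) b2
      rw [Int.ediv_eq_zero_of_lt (by assumption) (by omega), neg_zero]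
    · exact hΛ c c.2 h1

theorem Generates.swapStep {m a k : ℕ} {T : ℤ} {A : ℕ → ℕ → ℤ} {Λ : Submodule ℤ (Fin m → ℤ)}
    (h : Generates Λ A) (ha : a < m) (hak : a < k) (hk : k < 2 * m)
    (hst : Stage m T a A) (h0 : A k a ≠ 0)
    (hD : ∀ j, a < j → j < m → ∀ c < m, A (m + j) c = if c = j then T else 0) :
    Generates Λ (swapStep m T a k (A a a / A k a) A) := by
  intro Λ'
  rw [← h Λ']
  set q := A a a / A k a with hq
  -- The rows that are still multiples of unit vectors vanish in the column `a`.
  have hkj : ∀ j, a < j → j < m → k ≠ m + j := by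
    rintro j h1 h2 rfl
    exact h0 (by rw [hD j h1 h2 a ha, if_neg (by omega)])
  have e1 : row m (Prog.swapStep m T a k q A) a = row m A k := by
    funext c; simp [row, Prog.swapStep]
  have e2 : ∀ r, r ≠ a → r ≠ k → row m (Prog.swapStep m T a k q A) r = row m A r := by
    intro r n1 n2; funext c; simp [row, Prog.swapStep, n1, n2]
  constructor
  · intro hA
    have hΛ : ∀ j (hj : j < m), a < j → Pi.single (⟨j, hj⟩ : Fin m) T ∈ Λ' := by
      intro j hj haj
      rw [← row_single hj (hD j haj hj), ← e2 (m + j) (by omega) (hkj j haj hj).symm]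
      exact hA _ (by omega)
    have hm := (mem_swapStep ha hak hk hst h0 hΛ).mpr (hA k hk)
    have hk' := hA a (by omega)
    rw [e1] at hk'
    intro r hr
    by_cases n1 : r = a
    · subst n1
      have := Λ'.add_mem hm (Λ'.smul_mem q hk')
      convert this using 1
      exact (sub_add_cancel _ _).symm
    · by_cases n2 : r = k
      · subst n2; exact hk'
      · rw [← e2 r n1 n2]; exact hA r hr
  · intro hA
    have hΛ : ∀ j (hj : j < m), a < j → Pi.single (⟨j, hj⟩ : Fin m) T ∈ Λ' := by
      intro j hj haj
      rw [← row_single hj (hD j haj hj)]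
      exact hA _ (by omega)
    intro r hr
    by_cases n1 : r = a
    · subst n1; rw [e1]; exact hA k hk
    · by_cases n2 : r = k
      · subst n2
        exact (mem_swapStep ha hak hk hst h0 hΛ).mp
          (Λ'.sub_mem (hA a (by omega)) (Λ'.smul_mem q (hA r hk)))
      · rw [e2 r n1 n2]; exact hA r hr

theorem wp_pass_lattice {X N m : ℕ} {T : ℤ} {Λ : Submodule ℤ (Fin m → ℤ)} {σ : St}
    (h1 : σ.var 1 = m) (h2 : σ.var 2 = T) (hT : 0 < T)
    (hTX : T ≤ X) (hmX : 2 * m ≤ X) (hmN : 2 * m ≤ N) (hTN : cnt true (4 * (T * T)) ≤ N)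
    (hD : ∀ j < m, ∀ c < m, σ.mem (m + j) c = if c = j then T else 0)
    (hDΛ : ∀ j : Fin m, Pi.single j T ∈ Λ)
    (hspan : Λ = Submodule.span ℤ (Set.range fun a : Fin m => row m σ.mem a)) :
    wp X N pass (fun τ => ∃ A, TriBasis Λ A ∧ (∀ r < m, ∀ c < m, 0 ≤ A r c ∧ A r c ≤ T) ∧
      Post 3 σ A τ) σ := by
  refine wp_seq (wp_reduceAll (m := m) h1 h2 hT hTX (by omega) (by omega)) ?_
  intro τ h
  set B : ℕ → ℕ → ℤ := fun r c => if r < m ∧ c < m then σ.mem r c % T else σ.mem r c with hB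
  have hBD : ∀ j < m, ∀ c < m, B (m + j) c = if c = j then T else 0 := fun j hj c hc => by
    have : ¬ m + j < m := by omega
    simp [hB, hD j hj c hc]
  have hBr : ∀ r, m ≤ r → r < 2 * m → ∀ c < m, B r c = T ∨ B r c = 0 := fun r hr hr' c hc => by
    have := hBD (r - m) (by omega) c hc
    rw [show m + (r - m) = r by omega] at this
    rw [this]
    split_ifs <;> simp
  have hst : Stage m T 0 B := by
    refine ⟨fun r hr c hc => ?_, fun r hr c hc => ?_, fun r hr c hc h0 => by omega⟩
    · by_cases hrm : r < m
      · simp only [hB, hrm, hc, and_self, if_true]; exact Int.emod_nonneg _ hT.ne'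
      · rcases hBr r (by omega) hr c hc with h | h <;> rw [h]; exact hT.le
    · by_cases hrm : r < m
      · simp only [hB, hrm, hc, and_self, if_true]; exact (Int.emod_lt_of_pos _ hT).le
      · rcases hBr r (by omega) hr c hc with h | h <;> rw [h]; exact hT.le
  have hgen : Generates Λ B := by
    intro Λ'
    have hmod : (∀ j : Fin m, Pi.single j T ∈ Λ') →
        ∀ r < m, (row m σ.mem r ∈ Λ' ↔ row m B r ∈ Λ') := by
      intro hΛ' r hr
      apply mem_iff_of_congr (T := T) (fun c : Fin m => -(σ.mem r c / T))
      · intro c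
        simp only [row, hB, hr, c.2, and_self, if_true, Int.emod_def]; ring
      · exact fun c _ => hΛ' c
    constructor
    · intro hA
      have hΛ' : ∀ j : Fin m, Pi.single j T ∈ Λ' := fun j => by
        rw [← row_single j.2 (hBD j j.2)]; exact hA _ (by omega)
      rw [hspan, Submodule.span_le]
      rintro _ ⟨a, rfl⟩
      exact (hmod hΛ' a a.2).mpr (hA a (by omega))
    · intro hle r hr
      have hΛ' : ∀ j : Fin m, Pi.single j T ∈ Λ' := fun j => hle (hDΛ j)
      by_cases hrm : r < m
      · refine (hmod hΛ' r hrm).mp (hle ?_)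
        rw [hspan]
        exact Submodule.subset_span ⟨⟨r, hrm⟩, rfl⟩
      · have := row_single (A := B) (j := r - m) (by omega) (hBD (r - m) (by omega))
        rw [show m + (r - m) = r by omega] at this
        rw [this]
        exact hΛ' _
  refine wp_mono _ ?_ (wp_eliminate (m := m) (T := T) (fun a A =>
    (∀ j, a < j → j < m → ∀ c < m, A (m + j) c = if c = j then T else 0) ∧ Generates Λ A)
    (by rw [h.var 1 (by omega), h1]) (by rw [h.var 2 (by omega), h2]) hT
    hTX hmX hmN hTN (by rw [h.mem]; exact hst) ?_ ?_ ?_)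
  · rintro υ ⟨A, hA, ⟨-, hA2⟩, h'⟩
    have hspan' : Submodule.span ℤ (Set.range fun a : Fin m => row m A a) = Λ := by
      apply le_antisymm
      · rw [Submodule.span_le]
        rintro _ ⟨a, rfl⟩
        exact (hA2 Λ).mpr le_rfl a (by omega)
      · rw [← hA2]
        intro r hr
        by_cases hrm : r < m
        · exact Submodule.subset_span ⟨⟨r, hrm⟩, rfl⟩
        · have : row m A r = 0 := funext fun c => hA.zero r hr c c.2 c.2 (by omega)
          rw [this]; exact Submodule.zero_mem _
    refine ⟨A, triBasis_of_span hspan' (fun a ha c hc => hA.zero a (by omega) c (by omega)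
      (by omega) hc) (fun a ha => hA.nonneg a (by omega) a ha) hT hDΛ,
      fun r hr c hc => ⟨hA.nonneg r (by omega) c hc, hA.le r (by omega) c hc⟩, h.trans h' le_rfl⟩
  · rw [h.mem]
    exact ⟨fun j _ hj => hBD j hj, hgen⟩
  · rintro a k A ha hak hk hst h0 ⟨hA1, hA2⟩
    refine ⟨fun j haj hj c hc => ?_, hA2.swapStep ha hak hk hst h0 hA1⟩
    have n1 : m + j ≠ a := by omega
    have n2 : m + j ≠ k := by
      rintro rfl
      exact h0 (by rw [hA1 j haj hj a ha, if_neg (by omega)])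
    simp only [swapStep, hc, if_true, n1, n2, if_false]
    exact hA1 j haj hj c hc
  · rintro a A ⟨hA1, hA2⟩
    exact ⟨fun j haj => hA1 j (by omega), hA2⟩

/-- Subtraction of `q` times the row `j` from the row `a`, modulo `T`, from the column `j` on. -/
def reduceStep (m : ℕ) (T : ℤ) (a j : ℕ) (q : ℤ) (A : ℕ → ℕ → ℤ) : ℕ → ℕ → ℤ := fun r c =>
  if r = a ∧ j ≤ c ∧ c < m then (A a c - q * A j c) % T else A r c

theorem TriBasis.reduceStep {m a j : ℕ} {T q : ℤ} {A : ℕ → ℕ → ℤ}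
    {Λ : Submodule ℤ (Fin m → ℤ)} (h : TriBasis Λ A) (haj : a < j) (hj : j < m)
    (hΛ : ∀ j : Fin m, Pi.single j T ∈ Λ) : TriBasis Λ (reduceStep m T a j q A) := by
  have hdiag : ∀ r, Prog.reduceStep m T a j q A r r = A r r := by
    intro r
    have : ¬ (r = a ∧ j ≤ r ∧ r < m) := by omega
    simp [Prog.reduceStep, this]
  refine ⟨fun r hr => ?_, fun r hr c hc => ?_, fun r hr => ?_, fun r x hx hx0 => ?_⟩
  · by_cases hra : r = a
    · subst hra
      rw [← mem_iff_of_congr (T := T) (x := row m A r - q • row m A j)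
        (fun c : Fin m => if j ≤ c then -((A r c - q * A j c) / T) else 0) ?_ fun c _ => hΛ c]
      · exact Λ.sub_mem (h.mem r hr) (Λ.smul_mem q (h.mem j hj))
      · intro c
        simp only [row, Prog.reduceStep, c.2, and_true, true_and, Pi.sub_apply, Pi.smul_apply,
          smul_eq_mul]
        by_cases hc : j ≤ c
        · simp only [hc, if_true, Int.emod_def]; ring
        · simp [hc, h.zero j hj c (by omega)]
    · have : row m (Prog.reduceStep m T a j q A) r = row m A r := by
        funext c; simp [row, Prog.reduceStep, hra]
      rw [this]; exact h.mem r hr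
  · have : ¬ (r = a ∧ j ≤ c ∧ c < m) := by omega
    simp [Prog.reduceStep, this, h.zero r hr c hc]
  · rw [hdiag]; exact h.pos r hr
  · rw [hdiag]; exact h.dvd r x hx hx0

/-- Reduction of the entries above the diagonal of a triangular matrix. -/
def reduceAbove : Stmt :=
  forLoop 3 (.const 0) (.var 1) (forLoop 4 (.add (.var 3) (.const 1))
    (.sub (.sub (.var 1) (.const 1)) (.var 3))
    (.seq (.assign 5 (.div (.ld (.var 3) (.var 4)) (.ld (.var 4) (.var 4))))
      (forLoop 6 (.var 4) (.sub (.var 1) (.var 4))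
        (.store (.var 3) (.var 6) (.mod (.sub (.ld (.var 3) (.var 6))
          (.mul (.var 5) (.ld (.var 4) (.var 6)))) (.var 2))))))

theorem wp_reduceRow {X N m a j : ℕ} {T : ℤ} {σ : St} (h1 : σ.var 1 = m) (h2 : σ.var 2 = T)
    (h3 : σ.var 3 = a) (h4 : σ.var 4 = j) (haj : a < j) (hj : j < m) (hT : 0 < T) (hTX : T ≤ X)
    (hmX : m ≤ X) (hmN : m ≤ N) (ha : (σ.mem a j).natAbs ≤ X) :
    wp X N (.seq (.assign 5 (.div (.ld (.var 3) (.var 4)) (.ld (.var 4) (.var 4))))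
      (forLoop 6 (.var 4) (.sub (.var 1) (.var 4))
        (.store (.var 3) (.var 6) (.mod (.sub (.ld (.var 3) (.var 6))
          (.mul (.var 5) (.ld (.var 4) (.var 6)))) (.var 2)))))
      (Post 5 σ (reduceStep m T a j (σ.mem a j / σ.mem j j) σ.mem)) σ := by
  simp only [wp, Expr.eval, h3, h4, Int.natAbs_natCast]
  refine ⟨(Int.natAbs_ediv_le_natAbs _ _).trans ha, ?_⟩
  set q := σ.mem a j / σ.mem j j
  set σ' := σ.set 5 q with hσ'
  refine wp_for (fun i => Post 6 σ' (fun r c => if c < j + i then reduceStep m T a j q σ.mem r c else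
    σ.mem r c)) j (m - j) ?_ ?_ (by omega) (by omega) (fun i τ v h => h.set le_rfl v) ?_ ?_ ?_
  · simp [Expr.eval, hσ', St.set, h4]
  · simp [Expr.eval, hσ', St.set, h1, h4]; omega
  · refine ⟨fun _ _ => rfl, ?_, rfl, rfl⟩
    funext r c
    by_cases hc : c < j
    · have : ¬ j ≤ c := by omega
      simp [hσ', St.set, hc, reduceStep, this]
    · simp [hσ', St.set, hc]
  · intro i τ hi hx h
    have v2 : τ.var 2 = T := by rw [h.var 2 (by omega)]; simp [hσ', St.set, h2]
    have v3 : τ.var 3 = a := by rw [h.var 3 (by omega)]; simp [hσ', St.set, h3]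
    have v4 : τ.var 4 = j := by rw [h.var 4 (by omega)]; simp [hσ', St.set, h4]
    have v5 : τ.var 5 = q := by rw [h.var 5 (by omega)]; simp [hσ', St.set]
    have m1 : ∀ r, τ.mem r (j + i) = σ.mem r (j + i) := fun r => by rw [h.mem]; simp
    simp only [wp, eval_mod, Expr.eval, hx, v2, v3, v4, v5, m1, Int.natAbs_natCast]
    refine ⟨emod_natAbs_le hT hTX, hx, h.var, ?_, h.inp, h.out⟩
    funext r c
    simp only [St.put, h.mem, reduceStep]
    by_cases hc : c = j + i
    · subst hc
      by_cases hr : r = a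
      · subst hr; simp; omega
      · simp [hr]
    · have e1 : c < j + (i + 1) ↔ c < j + i := by omega
      simp [hc, e1]
  · intro τ h
    refine ⟨fun y hy => ?_, ?_, h.inp, h.out⟩
    · have : y ≠ 5 := by omega
      rw [h.var y (by omega)]; simp [hσ', St.set, this]
    · rw [h.mem]; funext r c
      have e : j + (m - j) = m := by omega
      rw [e]
      by_cases hc : c < m <;> simp [hc, reduceStep]

/-- The bounds of the Hermite normal form hold in the rows up to `a`, in the row `a` only before the
column `a + 1 + i`. -/
structure Reduced (m : ℕ) (T : ℤ) (a i : ℕ) (A : ℕ → ℕ → ℤ) : Prop where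
  nonneg : ∀ r < m, ∀ c < m, 0 ≤ A r c
  le : ∀ r < m, ∀ c < m, A r c ≤ T
  lt : ∀ r c, r < c → c < m → (r < a ∨ r = a ∧ c < a + 1 + i) → A r c < A c c

theorem Reduced.reduceStep {m a i : ℕ} {T : ℤ} {A : ℕ → ℕ → ℤ} (h : Reduced m T a i A)
    (hi : a + 1 + i < m) (hT : 0 < T) (hp : 0 < A (a + 1 + i) (a + 1 + i)) :
    Reduced m T a (i + 1) (reduceStep m T a (a + 1 + i)
      (A a (a + 1 + i) / A (a + 1 + i) (a + 1 + i)) A) := by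
  set j := a + 1 + i with hj
  set q := A a j / A j j with hq
  refine ⟨fun r hr c hc => ?_, fun r hr c hc => ?_, fun r c hrc hc h' => ?_⟩
  · simp only [Prog.reduceStep]
    split_ifs
    · exact Int.emod_nonneg _ hT.ne'
    · exact h.nonneg r hr c hc
  · simp only [Prog.reduceStep]
    split_ifs
    · exact (Int.emod_lt_of_pos _ hT).le
    · exact h.le r hr c hc
  · have n1 : ¬ (c = a ∧ j ≤ c ∧ c < m) := by omega
    simp only [Prog.reduceStep, n1, if_false]
    by_cases hra : r = a
    · by_cases hcj : c = j
      · rw [if_pos ⟨hra, hcj.ge, hc⟩, hcj, hq, mul_comm, ← Int.emod_def]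
        have b1 := h.le j (by omega) j (by omega)
        have b2 := Int.emod_nonneg (A a j) hp.ne'
        have b3 := Int.emod_lt_of_pos (A a j) hp
        rw [Int.emod_eq_of_lt b2 (by omega)]
        exact b3
      · rw [if_neg (by omega)]
        exact h.lt r c hrc hc (by omega)
    · rw [if_neg (by omega)]
      exact h.lt r c hrc hc (by omega)

theorem wp_reduceAbove {X N m : ℕ} {T : ℤ} {Λ : Submodule ℤ (Fin m → ℤ)} {σ : St}
    (h1 : σ.var 1 = m) (h2 : σ.var 2 = T) (hT : 0 < T) (hTX : T ≤ X) (hmX : m ≤ X) (hmN : m ≤ N)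
    (hb : TriBasis Λ σ.mem) (hle : ∀ r < m, ∀ c < m, 0 ≤ σ.mem r c ∧ σ.mem r c ≤ T)
    (hΛ : ∀ j : Fin m, Pi.single j T ∈ Λ) :
    wp X N reduceAbove (fun τ => ∃ H, IsHNF Λ H ∧ (∀ r < m, ∀ c < m, 0 ≤ H r c ∧ H r c ≤ T) ∧
      Post 3 σ H τ) σ := by
  refine wp_for (fun a τ => ∃ A, TriBasis Λ A ∧ Reduced m T a 0 A ∧ Post 3 σ A τ) 0 m rfl
    (by simp [Expr.eval, St.set, h1]) hmN (by omega)
    (fun i τ v ⟨A, hA, hr, h⟩ => ⟨A, hA, hr, h.set le_rfl v⟩)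
    ⟨σ.mem, hb, ⟨fun r hr c hc => (hle r hr c hc).1, fun r hr c hc => (hle r hr c hc).2,
      fun r c _ _ _ => by omega⟩, Post.refl 3 σ⟩ ?_ ?_
  · rintro a τ ha hx ⟨A, hA, hr, h⟩
    have v1 : τ.var 1 = m := by rw [h.var 1 (by omega), h1]
    have v2 : τ.var 2 = T := by rw [h.var 2 (by omega), h2]
    have v3 : τ.var 3 = a := by simpa using hx
    refine wp_for (fun i υ => ∃ A, TriBasis Λ A ∧ Reduced m T a i A ∧ Post 4 τ A υ) (a + 1)
      (m - 1 - a) (by simp [Expr.eval, v3]) (by simp [Expr.eval, St.set, v1, v3]; omega)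
      (by omega) (by omega) (fun i τ v ⟨A, hA, hr, h⟩ => ⟨A, hA, hr, h.set le_rfl v⟩)
      ⟨A, hA, hr, by have := Post.refl 4 τ; rwa [h.mem] at this⟩ ?_ ?_
    · rintro i υ hi hy ⟨A, hA, hr, h'⟩
      have hm := h'.mem
      subst hm
      refine wp_mono _ ?_ (wp_reduceRow (a := a) (j := a + 1 + i) (m := m) (T := T)
        (by rw [h'.var 1 (by omega), v1]) (by rw [h'.var 2 (by omega), v2])
        (by rw [h'.var 3 (by omega), v3]) hy (by omega) (by omega) hT hTX hmX hmN ?_)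
      · intro ω h''
        refine ⟨by rw [h''.var 4 (by omega), hy], _, hA.reduceStep (by omega) (by omega) hΛ,
          hr.reduceStep (by omega) hT (hA.pos _ (by omega)), h'.trans h'' (by omega)⟩
      · have := hr.nonneg a ha (a + 1 + i) (by omega)
        have := hr.le a ha (a + 1 + i) (by omega)
        omega
    · rintro υ ⟨A, hA, hr, h'⟩
      refine ⟨by rw [h'.var 3 (by omega), hx], A, hA, ⟨hr.nonneg, hr.le, ?_⟩,
        h.trans h' (by omega)⟩
      intro r c hrc hc h''
      exact hr.lt r c hrc hc (by omega)
  · rintro τ ⟨A, hA, hr, h⟩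
    exact ⟨A, ⟨hA, fun a c hac hc => hr.nonneg a (by omega) c hc,
      fun a c hac hc => hr.lt a c hac hc (by omega)⟩,
      fun r hr' c hc => ⟨hr.nonneg r hr' c hc, hr.le r hr' c hc⟩, h⟩

/-! ### The Laplacian -/

/-- Computation of a sum into a variable. -/
theorem wp_sumLoop {X N x y n : ℕ} {e c : Expr} {σ : St} (f : ℕ → ℤ) (B : ℕ) (hxy : x < y)
    (hn : c.eval ((σ.set x 0).set y 0) = n) (hnN : n ≤ N) (hnX : n ≤ X)
    (hf : ∀ i < n, (f i).natAbs ≤ B) (hB : n * B ≤ X)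
    (he : ∀ i τ, i < n → τ.var y = (i : ℤ) → Post x σ σ.mem τ → e.eval τ = f i) :
    wp X N (.seq (.assign x (.const 0)) (forLoop y (.const 0) c
      (.assign x (.add (.var x) e))))
      (fun τ => τ.var x = ∑ i ∈ Finset.range n, f i ∧ Post x σ σ.mem τ) σ := by
  refine ⟨by simp [Expr.eval], ?_⟩
  refine wp_for (fun i τ => τ.var x = ∑ i ∈ Finset.range i, f i ∧ Post x σ σ.mem τ) 0 n rfl hn hnN
    (by omega) ?_ ?_ ?_ (fun τ h => h)
  · rintro i τ v ⟨h, h'⟩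
    refine ⟨?_, h'.set hxy.le v⟩
    have : x ≠ y := hxy.ne
    simp [St.set, this, h]
  · refine ⟨by simp [St.set, Expr.eval], (Post.refl x σ).set le_rfl _⟩
  · rintro i τ hi hy ⟨h, h'⟩
    have e1 : e.eval τ = f i := he i τ hi (by simpa using hy) h'
    simp only [wp, Expr.eval, h, e1, ← Finset.sum_range_succ]
    refine ⟨?_, ?_, by simp [St.set], h'.set le_rfl _⟩
    · calc (∑ j ∈ Finset.range (i + 1), f j).natAbs
          ≤ ∑ j ∈ Finset.range (i + 1), (f j).natAbs := Int.natAbs_sum_le _ _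
        _ ≤ (Finset.range (i + 1)).card • B := Finset.sum_le_card_nsmul _ _ _ fun j hj =>
            hf j (by have := Finset.mem_range.mp hj; omega)
        _ ≤ n * B := by
            rw [Finset.card_range, smul_eq_mul]; exact Nat.mul_le_mul_right _ (by omega)
        _ ≤ X := hB
    · have : y ≠ x := hxy.ne'
      simp [St.set, this, hy]

/-- Computation of the matrix `extMat`. -/
def extend : Stmt :=
  .seq (forLoop 3 (.const 0) (.var 1) (.seq
    (.seq (.assign 4 (.const 0)) (forLoop 5 (.const 0) (.var 1)
      (.assign 4 (.add (.var 4) (.ld (.var 3) (.var 5))))))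
    (.store (.var 3) (.var 1) (.mod (.sub (.const 0) (.var 4)) (.var 2)))))
  (.seq (forLoop 3 (.const 0) (.var 1) (.store (.var 1) (.var 3) (.const 0)))
    (.store (.var 1) (.var 1) (.var 2)))

theorem wp_extend {X N m : ℕ} {T : ℤ} {σ : St} (h1 : σ.var 1 = m) (h2 : σ.var 2 = T) (hT : 0 < T)
    (hTX : m * T ≤ X) (hTX' : T ≤ X) (hmX : m ≤ X) (hmN : m ≤ N)
    (hle : ∀ r < m, ∀ c < m, 0 ≤ σ.mem r c ∧ σ.mem r c ≤ T) :
    wp X N extend (fun τ => ∃ E, (∀ r ≤ m, ∀ c ≤ m, E r c = extMat m T σ.mem r c) ∧ Post 3 σ E τ)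
      σ := by
  refine wp_seq (R := Post 3 σ (fun r c => if r < m ∧ c = m then extMat m T σ.mem r c else
    σ.mem r c)) ?_ ?_
  · refine wp_for (fun i => Post 3 σ (fun r c => if r < i ∧ c = m then extMat m T σ.mem r c else
      σ.mem r c)) 0 m rfl (by simp [Expr.eval, St.set, h1]) hmN (by omega)
      (fun i τ v h => h.set le_rfl v) (by simpa using Post.refl 3 σ) ?_ (fun τ h => h)
    intro i τ hi hx h
    have v1 : τ.var 1 = m := by rw [h.var 1 (by omega), h1]
    have v2 : τ.var 2 = T := by rw [h.var 2 (by omega), h2]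
    have v3 : τ.var 3 = i := by simpa using hx
    have hm : ∀ c < m, τ.mem i c = σ.mem i c := fun c hc => by
      rw [h.mem]; simp
    refine wp_seq (wp_sumLoop (n := m) (fun c => τ.mem i c) T.toNat (by omega)
      (by simp [Expr.eval, St.set, v1]) hmN hmX ?_ ?_ ?_) ?_
    · intro c hc
      have := hle i hi c hc
      rw [hm c hc]; omega
    · zify
      rw [Int.toNat_of_nonneg hT.le]
      exact hTX
    · intro c υ hc hy h'
      have w3 : υ.var 3 = i := by rw [h'.var 3 (by omega), v3]
      simp [Expr.eval, w3, hy, h'.mem]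
    · rintro υ ⟨hs, h'⟩
      have w1 : υ.var 1 = m := by rw [h'.var 1 (by omega), v1]
      have w2 : υ.var 2 = T := by rw [h'.var 2 (by omega), v2]
      have w3 : υ.var 3 = i := by rw [h'.var 3 (by omega), v3]
      rw [Finset.sum_congr rfl fun c hc => hm c (Finset.mem_range.mp hc)] at hs
      simp only [wp, eval_mod, Expr.eval, w1, w2, w3, hs, Int.natAbs_natCast, zero_sub]
      refine ⟨emod_natAbs_le hT hTX', by simp [St.put, w3],
        fun y hy => (h'.var y (by omega)).trans (h.var y hy), ?_, h'.inp.trans h.inp,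
        h'.out.trans h.out⟩
      funext r c
      simp only [St.put, h'.mem, h.mem]
      by_cases hr : r = i
      · subst hr
        by_cases hc : c = m
        · subst hc; simp [extMat, hi]
        · simp [hc]
      · have e1 : r < i + 1 ↔ r < i := by omega
        simp [hr, e1]
  · intro τ h
    have v1 : τ.var 1 = m := by rw [h.var 1 (by omega), h1]
    have v2 : τ.var 2 = T := by rw [h.var 2 (by omega), h2]
    refine wp_seq (wp_for (fun i => Post 3 τ (fun r c => if r = m ∧ c < i then 0 else τ.mem r c))
      0 m (Q := Post 3 τ (fun r c => if r = m ∧ c < m then 0 else τ.mem r c)) rfl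
      (by simp [Expr.eval, St.set, v1]) hmN (by omega)
      (fun i τ v h => h.set le_rfl v) (by simpa using Post.refl 3 τ) ?_ (fun τ h => h)) ?_
    · intro i υ hi hx h'
      have w1 : υ.var 1 = m := by rw [h'.var 1 (by omega), v1]
      have w3 : υ.var 3 = i := by simpa using hx
      simp only [wp, Expr.eval, w1, w3, Int.natAbs_natCast]
      refine ⟨by simp, by simp [St.put, w3], h'.var, ?_, h'.inp, h'.out⟩
      funext r c
      simp only [St.put, h'.mem]
      by_cases hr : r = m
      · by_cases hc : c = i
        · simp [hr, hc]
        · have e1 : c < i + 1 ↔ c < i := by omega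
          simp [hc, e1]
      · simp [hr]
    · intro υ h'
      have w1 : υ.var 1 = m := by rw [h'.var 1 (by omega), v1]
      have w2 : υ.var 2 = T := by rw [h'.var 2 (by omega), v2]
      simp only [wp, Expr.eval, w1, w2, Int.natAbs_natCast]
      refine ⟨by omega, _, ?_, fun y hy => (h'.var y (by omega)).trans (h.var y hy), rfl,
        h'.inp.trans h.inp, h'.out.trans h.out⟩
      intro r hr c hc
      simp only [St.put, h'.mem, h.mem]
      rcases hr.lt_or_eq with hr | rfl
      · have n1 : r ≠ m := hr.ne
        rcases hc.lt_or_eq with hc | rfl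
        · simp [extMat, hr, hc, n1, hc.ne]
        · simp [hr, n1]
      · rcases hc.lt_or_eq with hc | rfl
        · simp [extMat, hc, hc.ne]
        · simp [extMat]

/-- In the row of the vertex `w`, the entry of `w` itself is replaced by minus the sum of the
others. -/
def diagonal : Stmt :=
  forLoop 3 (.const 0) (.var 0) (.seq
    (.assign 4 (.mod (.add (.var 3) (.var 1)) (.var 0))) (.seq
    (.seq (.assign 5 (.const 0)) (forLoop 6 (.const 0) (.var 0)
      (.assign 5 (.add (.var 5) (.ld (.var 4) (.var 6))))))
    (.store (.var 4) (.var 3) (.sub (.ld (.var 4) (.var 3)) (.var 5)))))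

theorem rowOf_inj {m v w : ℕ} (hv : v ≤ m) (hw : w ≤ m) (h : rowOf m v = rowOf m w) : v = w := by
  rcases v with _ | v <;> rcases w with _ | w
  · rfl
  · rw [rowOf_zero, rowOf_succ (by omega)] at h; omega
  · rw [rowOf_zero, rowOf_succ (by omega)] at h; omega
  · rw [rowOf_succ (by omega), rowOf_succ (by omega)] at h; omega

theorem wp_diagonal {X N m : ℕ} {T : ℤ} {σ : St} (h0 : σ.var 0 = (m + 1 : ℕ)) (h1 : σ.var 1 = m)
    (hT : 0 ≤ T) (hTX : (m + 2 : ℕ) * T ≤ X) (hmX : m + 1 ≤ X) (hmN : m + 1 ≤ N)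
    (hle : ∀ r ≤ m, ∀ c ≤ m, 0 ≤ σ.mem r c ∧ σ.mem r c ≤ T) :
    wp X N diagonal (Post 3 σ fun r c => if c ≤ m ∧ r = rowOf m c then
      σ.mem r c - ∑ u ∈ Finset.range (m + 1), σ.mem r u else σ.mem r c) σ := by
  refine wp_for (fun i => Post 3 σ fun r c => if c < i ∧ r = rowOf m c then
      σ.mem r c - ∑ u ∈ Finset.range (m + 1), σ.mem r u else σ.mem r c) 0 (m + 1) rfl
      (by simp [Expr.eval, St.set, h0]) hmN (by omega)
      (fun i τ v h => h.set le_rfl v) (by simpa using Post.refl 3 σ) ?_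
      (fun τ h => by simpa only [Nat.lt_succ_iff] using h)
  intro i τ hi hx h
  have v0 : τ.var 0 = (m + 1 : ℕ) := by rw [h.var 0 (by omega), h0]
  have v1 : τ.var 1 = m := by rw [h.var 1 (by omega), h1]
  have v3 : τ.var 3 = i := by simpa using hx
  have hrow : ((i : ℤ) + m) % ((m + 1 : ℕ) : ℤ) = (rowOf m i : ℕ) := by
    simp [rowOf]
  have hr := rowOf_lt m i
  have hm : ∀ c ≤ m, τ.mem (rowOf m i) c = σ.mem (rowOf m i) c := fun c hc => by
    rw [h.mem]
    simp only
    split_ifs with h'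
    · have := rowOf_inj (by omega) hc h'.2
      omega
    · rfl
  have hev : (Expr.mod (.add (.var 3) (.var 1)) (.var 0)).eval τ = (rowOf m i : ℕ) := by
    simp only [eval_mod, Expr.eval, v0, v1, v3, hrow]
  refine ⟨by rw [hev]; simp; omega, ?_⟩
  rw [hev]
  set σ' := τ.set 4 (rowOf m i : ℕ) with hσ'
  have hTX' : ((m + 2 : ℕ) * T).toNat ≤ X := by omega
  refine wp_seq (wp_sumLoop (n := m + 1) (fun c => τ.mem (rowOf m i) c) T.toNat
    (by omega)
    (by simp [Expr.eval, St.set, hσ', v0]) hmN hmX ?_ ?_ ?_) ?_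
  · intro c hc
    have := hle (rowOf m i) (by omega) c (by omega)
    rw [hm c (by omega)]; omega
  · zify
    rw [Int.toNat_of_nonneg hT]
    push_cast at hTX ⊢
    linarith
  · intro c υ hc hy h'
    have w4 : υ.var 4 = (rowOf m i : ℕ) := by rw [h'.var 4 (by omega)]; simp [hσ', St.set]
    simp [Expr.eval, w4, hy, h'.mem, hσ', St.set]
  · rintro υ ⟨hs, h'⟩
    have w3 : υ.var 3 = i := by rw [h'.var 3 (by omega)]; simp [hσ', St.set, v3]
    have w4 : υ.var 4 = (rowOf m i : ℕ) := by rw [h'.var 4 (by omega)]; simp [hσ', St.set]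
    rw [Finset.sum_congr rfl fun c hc =>
      hm c (by have := Finset.mem_range.mp hc; omega)] at hs
    have hmem : υ.mem = τ.mem := h'.mem
    simp only [wp, Expr.eval, w3, w4, hs, Int.natAbs_natCast, hmem, hm i (by omega)]
    refine ⟨?_, by simp [St.put, w3], fun y hy => ?_, ?_, h'.inp.trans h.inp, h'.out.trans h.out⟩
    · have b1 := hle (rowOf m i) (by omega) i (by omega)
      have b2 : 0 ≤ ∑ u ∈ Finset.range (m + 1), σ.mem (rowOf m i) u := Finset.sum_nonneg
        fun u hu => (hle (rowOf m i) (by omega) u (by have := Finset.mem_range.mp hu; omega)).1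
      have b3 := Finset.sum_le_card_nsmul (Finset.range (m + 1)) (fun u => σ.mem (rowOf m i) u) T
        fun u hu => (hle (rowOf m i) (by omega) u (by have := Finset.mem_range.mp hu; omega)).2
      simp only [Finset.card_range, nsmul_eq_mul] at b3
      push_cast at b3 hTX
      have e : ((m : ℤ) + 2) * T = ((m : ℤ) + 1) * T + T := by ring
      change (σ.mem (rowOf m i) i -
        ∑ u ∈ Finset.range (m + 1), σ.mem (rowOf m i) u).natAbs ≤ X
      omega
    · rw [St.put, h'.var y (by omega)]
      have : y ≠ 4 := by omega
      simp [hσ', St.set, this, h.var y (by omega)]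
    · funext r c
      simp only [St.put, hmem, h.mem]
      by_cases hc : c = i
      · subst hc
        by_cases hr : r = rowOf m c
        · simp [← hr]
        · simp [hr]
      · have e1 : c < i + 1 ↔ c < i := by omega
        simp [hc, e1]

/-- Output of the negatives of the rows as columns. -/
def output : Stmt :=
  forLoop 3 (.const 0) (.var 0) (forLoop 4 (.const 0) (.var 0)
    (.write (.sub (.const 0) (.ld (.mod (.add (.var 4) (.var 1)) (.var 0)) (.var 3)))))

theorem encodeMatrix_eq {k l : ℕ} {A : Matrix (Fin k) (Fin l) ℤ} {f : ℕ → ℕ → ℤ}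
    (h : ∀ i j, A i j = f i j) :
    encodeMatrix A = (List.range k).flatMap fun i => (List.range l).map (f i) := by
  have ofFn : ∀ {α : Type} (n : ℕ) (g : ℕ → α),
      List.ofFn (fun i : Fin n => g i) = (List.range n).map g := by
    intro α n g
    rw [List.ofFn_eq_map, ← List.map_coe_finRange_eq_range, List.map_map]
    rfl
  simp only [encodeMatrix, h]
  rw [ofFn k fun i => List.ofFn fun j : Fin l => f i j, List.flatMap_def]
  congr 1
  exact List.map_congr_left fun i _ => ofFn l (f i)

theorem wp_output {X N m : ℕ} {σ : St} (h0 : σ.var 0 = (m + 1 : ℕ)) (h1 : σ.var 1 = m)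
    (hmX : m + 1 ≤ X) (hmN : m + 1 ≤ N) :
    wp X N output (fun τ => τ.out = σ.out ++ (List.range (m + 1)).flatMap fun v =>
      (List.range (m + 1)).map fun w => -σ.mem (rowOf m w) v) σ := by
  refine wp_for (fun i τ => (∀ y < 3, τ.var y = σ.var y) ∧ τ.mem = σ.mem ∧
    τ.out = σ.out ++ (List.range i).flatMap fun v =>
      (List.range (m + 1)).map fun w => -σ.mem (rowOf m w) v) 0 (m + 1) rfl
      (by simp [Expr.eval, St.set, h0]) hmN (by omega) ?_ (by simp) ?_ (fun τ h => h.2.2)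
  · rintro i τ v ⟨h, h'⟩
    refine ⟨fun y hy => ?_, h'⟩
    have : y ≠ 3 := by omega
    simp [St.set, this, h y hy]
  rintro i τ hi hx ⟨h, hm, ho⟩
  refine wp_for (fun j υ => (∀ y < 4, υ.var y = τ.var y) ∧ υ.mem = σ.mem ∧
    υ.out = τ.out ++ (List.range j).map fun w => -σ.mem (rowOf m w) i) 0 (m + 1) rfl
      (by simp [Expr.eval, St.set, h, h0]) hmN (by omega) ?_ (by simp [hm]) ?_ ?_
  · rintro i τ v ⟨h, h'⟩
    refine ⟨fun y hy => ?_, h'⟩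
    have : y ≠ 4 := by omega
    simp [St.set, this, h y hy]
  · rintro j υ hj hy ⟨h', hm', ho'⟩
    have hrow : ((j : ℤ) + m) % ((m + 1 : ℕ) : ℤ) = (rowOf m j : ℕ) := by
      simp [rowOf]
    have w0 : υ.var 0 = (m + 1 : ℕ) := by rw [h' 0 (by omega), h 0 (by omega), h0]
    have w1 : υ.var 1 = m := by rw [h' 1 (by omega), h 1 (by omega), h1]
    have w3 : υ.var 3 = i := by rw [h' 3 (by omega), hx]; simp
    have w4 : υ.var 4 = j := by simpa using hy
    simp only [wp, eval_mod, Expr.eval, w0, w1, w3, w4, hrow, Int.natAbs_natCast]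
    refine ⟨by simp, h', hm', ?_⟩
    rw [ho', List.range_succ, List.map_append, hm']
    simp
  · rintro υ ⟨h', hm', ho'⟩
    refine ⟨by rw [h' 3 (by omega), hx], fun y hy => (h' y (by omega)).trans (h y hy), hm', ?_⟩
    rw [ho', ho, List.range_succ (n := i), List.flatMap_append]
    simp

/-! ### The input -/

/-- Reading of the input into the rows `0, …, m - 1`, with a copy in the rows `2 * m, …, 3 * m - 1`.
The variable `2` becomes the sum of the dimension and the squares of all entries. -/
def readInput : Stmt :=
  .seq (.read 0) (.seq (.assign 1 (.sub (.var 0) (.const 1))) (.seq (.assign 2 (.var 0))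
    (forLoop 3 (.const 0) (.var 1) (forLoop 4 (.const 0) (.var 0)
      (.seq (.read 5) (.seq (.store (.var 3) (.var 4) (.var 5))
        (.seq (.store (.add (.mul (.const 2) (.var 1)) (.var 3)) (.var 4) (.var 5))
          (.assign 2 (.add (.var 2) (.mul (.var 5) (.var 5)))))))))))

/-- The sum of the dimension and the squares of all entries of the input. -/
def inputSum (m : ℕ) (f : ℕ → ℕ → ℤ) : ℤ :=
  (m + 1 : ℕ) + ∑ j ∈ Finset.range m, ∑ i ∈ Finset.range (m + 1), f j i * f j i

theorem natAbs_le_mul_self (x : ℤ) : (x.natAbs : ℤ) ≤ x * x := by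
  rw [← Int.natAbs_mul_self' x]
  have : x.natAbs ≤ x.natAbs * x.natAbs := Nat.le_mul_self _
  exact_mod_cast this

theorem partialSum_le {m i j : ℕ} {f : ℕ → ℕ → ℤ} (hi : i < m) (hj : j ≤ m + 1) :
    (m + 1 : ℕ) + ∑ k ∈ Finset.range i, ∑ l ∈ Finset.range (m + 1), f k l * f k l +
      ∑ l ∈ Finset.range j, f i l * f i l ≤ inputSum m f := by
  have h1 : ∑ l ∈ Finset.range j, f i l * f i l ≤ ∑ l ∈ Finset.range (m + 1), f i l * f i l :=
    Finset.sum_le_sum_of_subset_of_nonneg (by simpa using hj) fun _ _ _ => mul_self_nonneg _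
  have h2 : ∑ k ∈ Finset.range (i + 1), ∑ l ∈ Finset.range (m + 1), f k l * f k l ≤
      ∑ k ∈ Finset.range m, ∑ l ∈ Finset.range (m + 1), f k l * f k l :=
    Finset.sum_le_sum_of_subset_of_nonneg (by simp; omega)
      fun _ _ _ => Finset.sum_nonneg fun _ _ => mul_self_nonneg _
  rw [Finset.sum_range_succ] at h2
  unfold inputSum
  linarith

theorem entry_le_inputSum {m i j : ℕ} {f : ℕ → ℕ → ℤ} (hi : i < m) (hj : j ≤ m) :
    ((f i j).natAbs : ℤ) ≤ inputSum m f := by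
  have h := partialSum_le (f := f) hi (Nat.succ_le_succ hj)
  rw [Finset.sum_range_succ] at h
  have h1 : 0 ≤ ∑ k ∈ Finset.range i, ∑ l ∈ Finset.range (m + 1), f k l * f k l :=
    Finset.sum_nonneg fun _ _ => Finset.sum_nonneg fun _ _ => mul_self_nonneg _
  have h2 : 0 ≤ ∑ l ∈ Finset.range j, f i l * f i l := Finset.sum_nonneg fun _ _ => mul_self_nonneg _
  have := natAbs_le_mul_self (f i j)
  push_cast at h
  linarith

theorem wp_readInput {X N m : ℕ} {f : ℕ → ℕ → ℤ} {σ : St}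
    (hinp : σ.inp = ((m + 1 : ℕ) : ℤ) :: (List.range m).flatMap fun j => (List.range (m + 1)).map (f j))
    (hmem : σ.mem = fun _ _ => 0) (hX : inputSum m f ≤ X) (hmN : m + 1 ≤ N) :
    wp X N readInput (fun τ => τ.var 0 = (m + 1 : ℕ) ∧ τ.var 1 = m ∧ τ.var 2 = inputSum m f ∧
      (∀ r < m, ∀ c < m + 1, τ.mem r c = f r c ∧ τ.mem (2 * m + r) c = f r c) ∧
      (∀ r c, m ≤ r → r < 2 * m → τ.mem r c = 0) ∧ τ.out = σ.out) σ := by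
  have hmX : m + 1 ≤ X := by
    have : 0 ≤ ∑ k ∈ Finset.range m, ∑ l ∈ Finset.range (m + 1), f k l * f k l :=
      Finset.sum_nonneg fun _ _ => Finset.sum_nonneg fun _ _ => mul_self_nonneg _
    unfold inputSum at hX
    omega
  simp only [readInput, wp, hinp, List.headD_cons, List.tail_cons]
  refine ⟨by omega, ?_⟩
  simp only [Expr.eval, St.set, Function.update_self]
  refine ⟨by push_cast; simp; omega, ?_⟩
  simp only [Function.update_apply]
  refine ⟨by simp; omega, ?_⟩
  refine wp_for (fun i τ => τ.var 0 = (m + 1 : ℕ) ∧ τ.var 1 = m ∧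
      τ.var 2 = (m + 1 : ℕ) + ∑ k ∈ Finset.range i, ∑ l ∈ Finset.range (m + 1), f k l * f k l ∧
      (∀ r < i, ∀ c < m + 1, τ.mem r c = f r c ∧ τ.mem (2 * m + r) c = f r c) ∧
      (∀ r c, m ≤ r → r < 2 * m → τ.mem r c = 0) ∧ τ.out = σ.out ∧
      τ.inp = (List.range' i (m - i)).flatMap fun j => (List.range (m + 1)).map (f j))
    0 m rfl (by simp [Expr.eval, St.set]) (by omega) (by omega) ?_ ?_ ?_ ?_
  · intro i τ v h
    simpa [St.set] using h
  · simp [hmem, List.range_eq_range']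
  · rintro i τ hi hx ⟨h0, h1, h2, hm1, hm2, ho, hin⟩
    rw [show m - i = (m - (i + 1)) + 1 by omega, List.range'_succ, List.flatMap_cons] at hin
    set rest := (List.range' (i + 1) (m - (i + 1))).flatMap fun j =>
      (List.range (m + 1)).map (f j) with hrest
    refine wp_for (fun j υ => υ.var 0 = (m + 1 : ℕ) ∧ υ.var 1 = m ∧ υ.var 3 = (i : ℤ) ∧
        υ.var 2 = (m + 1 : ℕ) + ∑ k ∈ Finset.range i, ∑ l ∈ Finset.range (m + 1), f k l * f k l +
          ∑ l ∈ Finset.range j, f i l * f i l ∧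
        (∀ r c, (r < i ∧ c < m + 1 ∨ r = i ∧ c < j) → υ.mem r c = f r c ∧
          υ.mem (2 * m + r) c = f r c) ∧
        (∀ r c, m ≤ r → r < 2 * m → υ.mem r c = 0) ∧ υ.out = σ.out ∧
        υ.inp = (List.range' j (m + 1 - j)).map (f i) ++ rest)
      0 (m + 1) rfl (by simp [Expr.eval, St.set, h0]) (by omega) (by omega) ?_ ?_ ?_ ?_
    · intro i τ v h
      simpa [St.set] using h
    · refine ⟨h0, h1, by simpa using hx, by simpa using h2, ?_, hm2, ho, ?_⟩
      · rintro r c (⟨hr, hc⟩ | ⟨-, hc⟩)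
        · exact hm1 r hr c hc
        · omega
      · rw [hin, List.range_eq_range']; rfl
    · rintro j υ hj hy ⟨w0, w1, w3, w2, wm1, wm2, wo, win⟩
      rw [show m + 1 - j = (m + 1 - (j + 1)) + 1 by omega, List.range'_succ] at win
      have w4 : υ.var 4 = j := by simpa using hy
      have he : ((f i j).natAbs : ℤ) ≤ X := (entry_le_inputSum hi (by omega)).trans hX
      have hs : (m + 1 : ℕ) + ∑ k ∈ Finset.range i, ∑ l ∈ Finset.range (m + 1), f k l * f k l +
          ∑ l ∈ Finset.range j, f i l * f i l + f i j * f i j ≤ X := by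
        have := (partialSum_le (f := f) hi (j := j + 1) (by omega)).trans hX
        rw [Finset.sum_range_succ] at this
        linarith
      have hs0 : 0 ≤ (m + 1 : ℕ) + ∑ k ∈ Finset.range i, ∑ l ∈ Finset.range (m + 1), f k l * f k l +
          ∑ l ∈ Finset.range j, f i l * f i l + f i j * f i j := by
        have s1 : 0 ≤ ∑ k ∈ Finset.range i, ∑ l ∈ Finset.range (m + 1), f k l * f k l :=
          Finset.sum_nonneg fun _ _ => Finset.sum_nonneg fun _ _ => mul_self_nonneg _
        have s2 : 0 ≤ ∑ l ∈ Finset.range j, f i l * f i l :=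
          Finset.sum_nonneg fun _ _ => mul_self_nonneg _
        have s3 := mul_self_nonneg (f i j)
        positivity
      have hc : (2 * (m : ℤ) + i).natAbs = 2 * m + i := by omega
      simp only [wp, win, List.map_cons, List.cons_append, List.headD_cons, List.tail_cons,
        Expr.eval, St.set, St.put, Function.update_apply]
      simp only [Nat.reduceEqDiff, if_true, if_false, w0, w1, w2, w3, w4,
        Int.natAbs_natCast, hc, OfNat.zero_ne_ofNat, OfNat.one_ne_ofNat]
      refine ⟨by omega, by omega, by omega, by omega, by simp, trivial, trivial, trivial, ?_, ?_, ?_, wo, trivial⟩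
      · rw [Finset.sum_range_succ]; ring
      · intro r c hrc
        have n1 : ¬ (r = 2 * m + i) := by omega
        have n2 : ¬ (2 * m + r = i) := by omega
        simp only [n1, n2, false_and, if_false, Nat.add_left_cancel_iff]
        by_cases h : r = i ∧ c = j
        · rw [if_pos h, if_pos h, h.1, h.2]; exact ⟨rfl, rfl⟩
        · rw [if_neg h, if_neg h]; exact wm1 r c (by omega)
      · intro r c hr hr'
        have n1 : ¬ (r = 2 * m + i) := by omega
        have n2 : ¬ (r = i) := by omega
        simp only [n1, n2, false_and, if_false]
        exact wm2 r c hr hr'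
    · rintro υ ⟨w0, w1, w3, w2, wm1, wm2, wo, win⟩
      refine ⟨by simpa using w3, w0, w1, ?_, ?_, wm2, wo, by simpa using win⟩
      · rw [w2, Finset.sum_range_succ _ i]; ring
      · intro r hr c hc
        exact wm1 r c (by omega)
  · rintro τ ⟨h0, h1, h2, hm1, hm2, ho, -⟩
    exact ⟨h0, h1, h2, hm1, hm2, ho⟩

/-! ### The complete program -/

/-- Computation of a modulus that exceeds twice the absolute value of the determinant. -/
def modulus : Stmt :=
  .seq (.assign 3 (.const 1)) (.seq
    (forLoop 4 (.const 0) (.var 1) (.assign 3 (.mul (.var 3) (.mul (.var 2) (.var 2)))))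
    (.assign 2 (.add (.mul (.const 2) (.var 3)) (.const 1))))

theorem wp_modulus {X N m Y : ℕ} {σ : St} (h1 : σ.var 1 = m) (h2 : σ.var 2 = Y) (hY : 0 < Y)
    (hX : 2 * (Y * Y) ^ m + 1 ≤ X) (hmX : m ≤ X) (hmN : m ≤ N) :
    wp X N modulus (fun τ => τ.var 2 = (2 * (Y * Y) ^ m + 1 : ℕ) ∧ Post 2 σ σ.mem τ) σ := by
  refine ⟨by simp [Expr.eval]; omega, ?_⟩
  refine wp_seq (wp_for (fun i τ => τ.var 3 = ((Y * Y) ^ i : ℕ) ∧ Post 3 σ σ.mem τ) 0 m rfl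
    (by simp [Expr.eval, St.set, h1]) hmN (by omega) ?_ ?_ ?_ (fun τ h => h)) ?_
  · rintro i τ v ⟨h, h'⟩
    exact ⟨by simp [St.set, h], h'.set (by omega) v⟩
  · exact ⟨by simp [St.set, Expr.eval], (Post.refl 3 σ).set le_rfl _⟩
  · rintro i τ hi hx ⟨h, h'⟩
    have v2 : τ.var 2 = Y := by rw [h'.var 2 (by omega), h2]
    have e : ((Y * Y) ^ i : ℕ) * ((Y : ℤ) * Y) = ((Y * Y) ^ (i + 1) : ℕ) := by
      push_cast; ring
    simp only [wp, Expr.eval, h, v2, e, Int.natAbs_natCast]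
    refine ⟨?_, by simpa [St.set] using hx, by simp [St.set], h'.set le_rfl _⟩
    have : (Y * Y) ^ (i + 1) ≤ (Y * Y) ^ m := Nat.pow_le_pow_right (by positivity) hi
    omega
  · rintro τ ⟨h, h'⟩
    simp only [wp, Expr.eval, h]
    refine ⟨by omega, by simp [St.set], fun y hy => ?_, h'.mem, h'.inp, h'.out⟩
    have : y ≠ 2 := by omega
    simp [St.set, this, h'.var y (by omega)]

/-- Restoring the input from its copy, and storing the multiples by the variable `2` of the unit
vectors in the rows `m, …, 2 * m - 1`. -/
def restore : Stmt :=
  forLoop 3 (.const 0) (.var 1) (.seq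
    (forLoop 4 (.const 0) (.var 1) (.store (.var 3) (.var 4)
      (.ld (.add (.mul (.const 2) (.var 1)) (.var 3)) (.var 4))))
    (.store (.add (.var 1) (.var 3)) (.var 3) (.var 2)))

theorem wp_restore {X N m : ℕ} {D : ℤ} {f : ℕ → ℕ → ℤ} {σ : St} (h1 : σ.var 1 = m)
    (h2 : σ.var 2 = D) (hD : D.natAbs ≤ X) (hmX : m ≤ X) (hmN : m ≤ N)
    (hf : ∀ r < m, ∀ c < m, σ.mem (2 * m + r) c = f r c) (hfX : ∀ r < m, ∀ c < m, (f r c).natAbs ≤ X)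
    (hz : ∀ r < m, ∀ c < m, σ.mem (m + r) c = 0) :
    wp X N restore (fun τ => (∀ y < 3, τ.var y = σ.var y) ∧ τ.inp = σ.inp ∧ τ.out = σ.out ∧
      (∀ r < m, ∀ c < m, τ.mem r c = f r c) ∧
      (∀ r < m, ∀ c < m, τ.mem (m + r) c = if c = r then D else 0)) σ := by
  refine wp_for (fun i τ => (∀ y < 3, τ.var y = σ.var y) ∧ τ.inp = σ.inp ∧ τ.out = σ.out ∧
      (∀ r < i, ∀ c < m, τ.mem r c = f r c) ∧
      (∀ r < m, ∀ c < m, τ.mem (m + r) c = if r < i then if c = r then D else 0 else 0) ∧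
      (∀ r < m, ∀ c < m, τ.mem (2 * m + r) c = f r c)) 0 m rfl
    (by simp [Expr.eval, St.set, h1]) hmN (by omega) ?_ ?_ ?_ ?_
  · rintro i τ v ⟨h, h'⟩
    refine ⟨fun y hy => ?_, h'⟩
    have : y ≠ 3 := by omega
    simp [St.set, this, h y hy]
  · exact ⟨fun _ _ => rfl, rfl, rfl, fun r hr => by omega, fun r hr c hc => by simpa using hz r hr c hc,
      hf⟩
  · rintro i τ hi hx ⟨h, hin, ho, hA, hB, hC⟩
    have v1 : τ.var 1 = m := by rw [h 1 (by omega), h1]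
    have v2 : τ.var 2 = D := by rw [h 2 (by omega), h2]
    have v3 : τ.var 3 = i := by simpa using hx
    refine wp_seq (wp_for (fun j => Post 4 τ (fun r c => if r = i ∧ c < j then f i c else τ.mem r c))
      0 m rfl (by simp [Expr.eval, St.set, v1]) hmN (by omega)
      (fun i τ v h => h.set le_rfl v) (by simpa using Post.refl 4 τ) ?_ (fun τ h => h)) ?_
    · intro j υ hj hy h'
      have w1 : υ.var 1 = m := by rw [h'.var 1 (by omega), v1]
      have w3 : υ.var 3 = i := by rw [h'.var 3 (by omega), v3]
      have w4 : υ.var 4 = j := by simpa using hy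
      have hc : (2 * (m : ℤ) + i).natAbs = 2 * m + i := by omega
      have hm : υ.mem (2 * m + i) j = f i j := by
        have : ¬ (2 * m + i = i) := by omega
        rw [h'.mem]
        simp only [this, false_and, if_false]
        exact hC i hi j hj
      simp only [wp, Expr.eval, w1, w3, w4, Int.natAbs_natCast, hc, hm]
      refine ⟨hfX i hi j hj, by simp [St.put, w4], h'.var, ?_, h'.inp, h'.out⟩
      funext r c
      simp only [St.put, h'.mem]
      by_cases hc : c = j
      · subst hc
        by_cases hr : r = i <;> simp [hr]
      · have e1 : c < j + 1 ↔ c < j := by omega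
        simp [hc, e1]
    · intro υ h'
      have w1 : υ.var 1 = m := by rw [h'.var 1 (by omega), v1]
      have w2 : υ.var 2 = D := by rw [h'.var 2 (by omega), v2]
      have w3 : υ.var 3 = i := by rw [h'.var 3 (by omega), v3]
      have hmi : ((m : ℤ) + i).natAbs = m + i := by omega
      simp only [wp, Expr.eval, w1, w2, w3, Int.natAbs_natCast, hmi]
      refine ⟨hD, by simp [St.put, w3], fun y hy => (h'.var y (by omega)).trans (h y hy),
        h'.inp.trans hin, h'.out.trans ho, fun r hr c hc => ?_, fun r hr c hc => ?_,
        fun r hr c hc => ?_⟩ <;> simp only [St.put, h'.mem]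
      · have n1 : ¬ (r = m + i) := by omega
        simp only [n1, false_and, if_false]
        by_cases hri : r = i
        · subst hri; simp [hc]
        · simp only [hri, false_and, if_false]; exact hA r (by omega) c hc
      · have n2 : ¬ (m + r = i) := by omega
        simp only [n2, false_and, if_false, Nat.add_left_cancel_iff]
        by_cases hri : r = i
        · subst hri
          have := hB r hr c hc
          simp only [lt_irrefl, if_false] at this
          simp [this]
        · have e1 : r < i + 1 ↔ r < i := by omega
          simp only [hri, false_and, if_false, e1]
          exact hB r hr c hc
      · have n1 : ¬ (2 * m + r = m + i) := by omega
        have n2 : ¬ (2 * m + r = i) := by omega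
        simp only [n1, n2, false_and, if_false]
        exact hC r hr c hc
  · rintro τ ⟨h, hin, ho, hA, hB, -⟩
    exact ⟨h, hin, ho, hA, fun r hr c hc => by simpa [hr] using hB r hr c hc⟩

theorem cnt_mono {v w : ℤ} (h : v ≤ w) : cnt true v ≤ cnt true w := by
  simp only [cnt, if_true]
  exact Nat.size_le_size (Int.toNat_le_toNat h)

/-- A bound for the determinant that is easily computed: `m! * Y ^ m ≤ (Y * Y) ^ m`. -/
theorem abs_det_le {m Y : ℕ} {B : Matrix (Fin m) (Fin m) ℤ} (hm : m ≤ Y)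
    (hB : ∀ i j, ((B i j).natAbs : ℤ) ≤ Y) : |B.det| ≤ (Y * Y : ℕ) ^ m := by
  have h := Matrix.det_le (A := B) (abv := AbsoluteValue.abs) (x := (Y : ℤ))
    (fun i j => by simpa using hB i j)
  rw [Fintype.card_fin] at h
  refine le_trans (by simpa using h) ?_
  have : m.factorial ≤ Y ^ m := (Nat.factorial_le_pow m).trans (Nat.pow_le_pow_left hm m)
  push_cast
  rw [mul_pow]
  have h2 : (m.factorial : ℤ) ≤ (Y : ℤ) ^ m := by exact_mod_cast this
  exact mul_le_mul_of_nonneg_right h2 (by positivity)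

/-- The entries of a basis as a function of natural numbers. -/
def entries {m : ℕ} (b : Fin m → Fin (m + 1) → ℤ) (j i : ℕ) : ℤ :=
  if h : j < m ∧ i < m + 1 then b ⟨j, h.1⟩ ⟨i, h.2⟩ else 0

theorem encodeVectors_eq {m : ℕ} (b : Fin m → Fin (m + 1) → ℤ) :
    encodeVectors b = ((m + 1 : ℕ) : ℤ) ::
      (List.range m).flatMap fun j => (List.range (m + 1)).map (entries b j) := by
  have := encodeMatrix_eq (A := Matrix.of b) (f := entries b) (fun i j => by
    simp [entries, Nat.lt_succ_iff.mp j.2])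
  rw [← this]
  rfl

/-- The modulus for the computation of the determinant of the matrix with the entries `f`. -/
def modulusOf (f : ℕ → ℕ → ℤ) (m : ℕ) : ℕ :=
  2 * ((inputSum m f).toNat * (inputSum m f).toNat) ^ m + 1

theorem inputSum_toNat {m : ℕ} (f : ℕ → ℕ → ℤ) :
    ((inputSum m f).toNat : ℤ) = inputSum m f ∧ m + 1 ≤ (inputSum m f).toNat := by
  have hsum : 0 ≤ ∑ k ∈ Finset.range m, ∑ l ∈ Finset.range (m + 1), f k l * f k l :=
    Finset.sum_nonneg fun _ _ => Finset.sum_nonneg fun _ _ => mul_self_nonneg _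
  unfold inputSum
  omega

/-- The entries of a basis of the lattice `L`. -/
noncomputable abbrev basisEntries {m : ℕ} {L : Submodule ℤ (Fin (m + 1) → ℤ)} (b : Module.Basis (Fin m) ℤ L) :
    ℕ → ℕ → ℤ := entries fun j => (b j : Fin (m + 1) → ℤ)

theorem basisEntries_apply {m : ℕ} {L : Submodule ℤ (Fin (m + 1) → ℤ)}
    (b : Module.Basis (Fin m) ℤ L) (i j : Fin m) : basisEntries b i j = basisMatrix b i j := by
  have h1 : (i : ℕ) < m ∧ (j : ℕ) < m + 1 := ⟨i.2, by omega⟩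
  simp only [basisEntries, entries, h1, and_self, dif_pos]
  rfl

theorem two_mul_abs_det_lt {m : ℕ} {L : Submodule ℤ (Fin (m + 1) → ℤ)}
    (b : Module.Basis (Fin m) ℤ L) : 2 * |(basisMatrix b).det| < modulusOf (basisEntries b) m := by
  obtain ⟨hY, hmY⟩ := inputSum_toNat (m := m) (basisEntries b)
  have h := abs_det_le (B := basisMatrix b) (m := m) (Y := (inputSum m (basisEntries b)).toNat)
    (by omega) (fun i j => by
      rw [hY, ← basisEntries_apply]; exact entry_le_inputSum i.2 (by omega))
  rw [modulusOf]
  push_cast at h ⊢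
  linarith

/-- The program that computes the determinant of a basis of the lattice. -/
def detProgram : Stmt := .seq readInput (.seq modulus (.seq pass computeDet))

theorem wp_detProgram {X N m : ℕ} {L : Submodule ℤ (Fin (m + 1) → ℤ)}
    (b : Module.Basis (Fin m) ℤ L) (hYX : inputSum m (basisEntries b) ≤ X)
    (htX : modulusOf (basisEntries b) m ≤ X) (hmX : 2 * m + 1 ≤ X) (hmN : 2 * m + 1 ≤ N)
    (hTN : cnt true (4 * ((modulusOf (basisEntries b) m : ℤ) * modulusOf (basisEntries b) m)) ≤ N) :
    wp X N detProgram (fun τ => τ.var 0 = (m + 1 : ℕ) ∧ τ.var 1 = m ∧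
      τ.var 2 = |(basisMatrix b).det| ∧
      (∀ r < m, ∀ c < m, τ.mem (2 * m + r) c = basisEntries b r c) ∧
      (∀ r < m, ∀ c < m, τ.mem (m + r) c = 0) ∧ τ.out = [])
      ⟨fun _ => 0, fun _ _ => 0, encodeVectors fun j => (b j : Fin (m + 1) → ℤ), []⟩ := by
  have hδt := two_mul_abs_det_lt b
  obtain ⟨hY, hmY⟩ := inputSum_toNat (m := m) (basisEntries b)
  have ht1 : 1 < modulusOf (basisEntries b) m := by
    have := pow_pos (Nat.mul_pos (Nat.lt_of_lt_of_le (Nat.succ_pos m) hmY)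
      (Nat.lt_of_lt_of_le (Nat.succ_pos m) hmY)) m
    rw [modulusOf]
    omega
  refine wp_seq (wp_readInput (f := basisEntries b) (encodeVectors_eq _) rfl hYX (by omega)) ?_
  rintro σ1 ⟨a0, a1, a2, am1, am2, ao⟩
  refine wp_seq (wp_modulus a1 (a2.trans hY.symm) (by omega) htX (by omega) (by omega)) ?_
  rintro σ2 ⟨b2, hp2⟩
  have b0 := (hp2.var 0 (by omega)).trans a0
  have b1 := (hp2.var 1 (by omega)).trans a1
  replace b2 : σ2.var 2 = modulusOf (basisEntries b) m := b2
  generalize modulusOf (basisEntries b) m = t at *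
  refine wp_seq (wp_pass_det b1 b2 (by omega) htX (by omega) (by omega) hTN ?_) ?_
  · intro r h1 h2 c _
    rw [hp2.mem]; exact am2 r c h1 h2
  rintro σ3 ⟨A, hst, hcopy, hz, hd, hp3⟩
  have hA := hp3.mem
  subst hA
  have hdetMod : detMod m t σ2.mem = ((basisMatrix b).det : ZMod t) := by
    have := RingHom.map_det (Int.castRingHom (ZMod t)) (basisMatrix b)
    rw [detMod]
    refine Eq.trans ?_ this.symm
    congr 1
    ext i j
    simp only [Matrix.of_apply, RingHom.mapMatrix_apply, Matrix.map_apply, eq_intCast,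
      ← basisEntries_apply, hp2.mem, (am1 i i.2 j (by omega)).1]
  rw [hdetMod] at hd
  have c0 := (hp3.var 0 (by omega)).trans b0
  have c1 := (hp3.var 1 (by omega)).trans b1
  have c2 := (hp3.var 2 (by omega)).trans b2
  refine wp_mono _ ?_ (wp_computeDet c1 c2 ht1 htX (by omega) (by omega) hst hd hδt)
  rintro σ4 ⟨d2, hp4⟩
  refine ⟨(hp4.var 0 (by omega)).trans c0, (hp4.var 1 (by omega)).trans c1, d2, ?_, ?_, ?_⟩
  · intro r hr c hc
    rw [hp4.mem, hcopy _ _ (by omega), hp2.mem]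
    exact (am1 r hr c (by omega)).2
  · intro r hr c hc
    rw [hp4.mem]
    exact hz (m + r) (by omega) (by omega) c hc
  · rw [hp4.out, hp3.out, hp2.out, ao]

/-- The output of the program in terms of the memory after `diagonal`. -/
theorem encodeMatrix_lapMat {m : ℕ} {E E' : ℕ → ℕ → ℤ}
    (hE : ∀ r ≤ m, ∀ c ≤ m, E' r c = E r c) :
    ((List.range (m + 1)).flatMap fun v => (List.range (m + 1)).map fun w =>
      -(if v ≤ m ∧ rowOf m w = rowOf m v then
        E' (rowOf m w) v - ∑ u ∈ Finset.range (m + 1), E' (rowOf m w) u else E' (rowOf m w) v)) =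
      encodeMatrix (lapMat m E) := by
  symm
  apply encodeMatrix_eq (f := fun v w => _)
  intro v w
  have hr := rowOf_lt m w
  have hsum : ∑ u ∈ Finset.range (m + 1), E' (rowOf m w) u =
      ∑ u ∈ Finset.range (m + 1), E (rowOf m w) u :=
    Finset.sum_congr rfl fun u hu => hE _ (by omega) u (by have := Finset.mem_range.mp hu; omega)
  simp only [lapMat, Matrix.of_apply]
  by_cases hvw : v = w
  · subst hvw
    have h1 : (v : ℕ) ≤ m := by omega
    rw [if_pos rfl, if_pos ⟨h1, rfl⟩, hsum, hE _ (by omega) _ h1]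
    ring
  · have h1 : ¬ ((v : ℕ) ≤ m ∧ rowOf m w = rowOf m v) := fun h =>
      hvw (Fin.ext (rowOf_inj (by omega) (by omega) h.2).symm)
    rw [if_neg hvw, if_neg h1, hE _ (by omega) _ (by omega)]

/-- The program that computes the Laplacian from a basis of the lattice. -/
def main : Stmt :=
  .seq detProgram (.seq restore (.seq pass (.seq reduceAbove (.seq extend (.seq diagonal output)))))

theorem single_latticeDet_mem {m : ℕ} {L : Submodule ℤ (Fin (m + 1) → ℤ)}
    (hL : L ≤ sumZero (m + 1)) (b : Module.Basis (Fin m) ℤ L) (j : Fin m) :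
    Pi.single j (latticeDet L : ℤ) ∈ L.map (proj m) := by
  have h := single_mem_of_basis b j
  rw [latticeDet_eq hL b, ← Int.abs_eq_natAbs]
  rcases abs_choice (basisMatrix b).det with h' | h' <;> rw [h']
  · exact h
  · rw [Pi.single_neg]; exact Submodule.neg_mem _ h

theorem latticeDet_pos {m : ℕ} {L : Submodule ℤ (Fin (m + 1) → ℤ)} (hL : L ≤ sumZero (m + 1))
    (b : Module.Basis (Fin m) ℤ L) : 0 < latticeDet L := by
  rw [latticeDet_eq hL b]
  exact Int.natAbs_pos.mpr (det_basisMatrix_ne_zero hL b)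

/-- The program outputs the Laplacian that belongs to the Hermite normal form. -/
theorem wp_main {X N m : ℕ} {L : Submodule ℤ (Fin (m + 1) → ℤ)} (hL : L ≤ sumZero (m + 1))
    (b : Module.Basis (Fin m) ℤ L) (hYX : inputSum m (basisEntries b) ≤ X)
    (htX : (m + 2) * modulusOf (basisEntries b) m ≤ X) (hmX : 2 * m + 1 ≤ X) (hmN : 2 * m + 1 ≤ N)
    (hTN : cnt true (4 * ((modulusOf (basisEntries b) m : ℤ) * modulusOf (basisEntries b) m)) ≤ N) :
    wp X N main (fun τ => ∃ H, IsHNF (L.map (proj m)) H ∧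
      τ.out = encodeMatrix (lapMat m (extMat m (latticeDet L) H)))
      ⟨fun _ => 0, fun _ _ => 0, encodeVectors fun j => (b j : Fin (m + 1) → ℤ), []⟩ := by
  have hDΛ := single_latticeDet_mem hL b
  have hDpos : (0 : ℤ) < latticeDet L := by exact_mod_cast latticeDet_pos hL b
  have hdet : |(basisMatrix b).det| = latticeDet L := by
    rw [latticeDet_eq hL b, Int.abs_eq_natAbs]
  have hδt := two_mul_abs_det_lt b
  refine wp_seq (wp_detProgram b hYX ((Nat.le_mul_of_pos_left _ (by omega)).trans htX) hmX hmN hTN) ?_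
  rintro σ4 ⟨d0, d1, d2, dm1, dm2, dout⟩
  rw [hdet] at d2 hδt
  generalize modulusOf (basisEntries b) m = t at *
  generalize hD : (latticeDet L : ℤ) = D at *
  have hmulX : ∀ k : ℕ, k ≤ m + 2 → (k : ℤ) * D ≤ X := fun k hk => by
    have h1 : ((m + 2 : ℕ) : ℤ) * t ≤ X := by exact_mod_cast htX
    have h2 : (k : ℤ) * D ≤ ((m + 2 : ℕ) : ℤ) * t :=
      mul_le_mul (by exact_mod_cast hk) (by linarith) hDpos.le (by positivity)
    exact h2.trans h1
  have hDX : D ≤ X := by simpa using hmulX 1 (by omega)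
  refine wp_seq (wp_restore (f := basisEntries b) d1 d2 (by omega) (by omega) (by omega) dm1 ?_
    dm2) ?_
  · intro r hr c hc
    have := (entry_le_inputSum (f := basisEntries b) hr (j := c) (by omega)).trans hYX
    exact_mod_cast this
  rintro σ5 ⟨ev, ein, eo, em1, em2⟩
  have e0 := (ev 0 (by omega)).trans d0
  have e1 := (ev 1 (by omega)).trans d1
  have e2 := (ev 2 (by omega)).trans d2
  have hrow : ∀ a : Fin m, row m σ5.mem a = basisMatrix b a := fun a => by
    funext c
    rw [row, em1 a a.2 c c.2, basisEntries_apply]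
  refine wp_seq (wp_pass_lattice (Λ := L.map (proj m)) e1 e2 hDpos hDX (by omega) (by omega)
    ((cnt_mono ?_).trans hTN) em2 hDΛ ?_) ?_
  · have : D * D ≤ (t : ℤ) * t := mul_le_mul (by linarith) (by linarith) hDpos.le (by positivity)
    linarith
  · rw [map_proj_eq_span b]
    congr 2
    funext a
    exact (hrow a).symm
  rintro σ6 ⟨A, hA, hle, hp6⟩
  have hA' := hp6.mem
  subst hA'
  refine wp_seq (wp_reduceAbove ((hp6.var 1 (by omega)).trans e1) ((hp6.var 2 (by omega)).trans e2)
    hDpos hDX (by omega) (by omega) hA hle hDΛ) ?_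
  rintro σ7 ⟨H, hH, hHle, hp7⟩
  have hp67 := hp6.trans hp7 le_rfl
  have hH' := hp7.mem
  subst hH'
  refine wp_seq (wp_extend ((hp67.var 1 (by omega)).trans e1) ((hp67.var 2 (by omega)).trans e2)
    hDpos (hmulX m (by omega)) hDX (by omega) (by omega) hHle) ?_
  rintro σ8 ⟨E, hE, hp8⟩
  have hp68 := hp67.trans hp8 le_rfl
  have hE' := hp8.mem
  subst hE'
  refine wp_seq (wp_diagonal (m := m) (T := D) ((hp68.var 0 (by omega)).trans e0)
    ((hp68.var 1 (by omega)).trans e1) hDpos.le (hmulX (m + 2) le_rfl) (by omega) (by omega)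
    ?_) ?_
  · intro r hr c hc
    rw [hE r hr c hc]
    exact ⟨extMat_nonneg hH hDpos c, extMat_le hH hDpos hDΛ c⟩
  intro σ9 hp9
  have hp69 := hp68.trans hp9 le_rfl
  refine wp_mono _ ?_ (wp_output (m := m) ((hp69.var 0 (by omega)).trans e0)
    ((hp69.var 1 (by omega)).trans e1) (by omega) (by omega))
  intro τ hτ
  refine ⟨σ7.mem, hH, ?_⟩
  rw [hτ, hp69.out, eo, dout, List.nil_append, hp9.mem]
  exact encodeMatrix_lapMat hE

/-! ### Bounds in terms of the length of the input -/

theorem len_le_size {l : List ℤ} {z : ℤ} (h : z ∈ l) : len z ≤ size l :=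
  List.le_sum_of_mem (List.mem_map_of_mem h)

theorem natAbs_lt_of_mem {l : List ℤ} {z : ℤ} (h : z ∈ l) : z.natAbs < 2 ^ size l :=
  (Nat.lt_size_self _).trans_le (Nat.pow_le_pow_right (by omega)
    ((Nat.le_succ _).trans (len_le_size h)))

theorem length_le_size (l : List ℤ) : l.length ≤ size l := by
  induction l with
  | nil => simp
  | cons z l ih =>
    have : size (z :: l) = len z + size l := rfl
    rw [this, List.length_cons, len]
    omega

section

variable {m S : ℕ} (b : Fin m → Fin (m + 1) → ℤ) (hS : size (encodeVectors b) = S)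

include hS

theorem card_le_size : m * (m + 1) + 1 ≤ S := by
  have := length_le_size (encodeVectors b)
  rw [hS, encodeVectors_eq] at this
  simpa [List.length_flatMap] using this

theorem entries_natAbs_lt (j i : ℕ) : (entries b j i).natAbs < 2 ^ S := by
  by_cases h : j < m ∧ i < m + 1
  · rw [← hS]
    apply natAbs_lt_of_mem
    rw [encodeVectors_eq]
    refine List.mem_cons_of_mem _ (List.mem_flatMap.mpr ⟨j, by simp [h.1], ?_⟩)
    exact List.mem_map_of_mem (by simpa using h.2)
  · rw [entries, dif_neg h]; simp

theorem inputSum_le : inputSum m (entries b) ≤ (2 ^ (4 * S) : ℕ) := by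
  have hc := card_le_size b hS
  have h1 : ∀ j i, entries b j i * entries b j i ≤ ((2 ^ S * 2 ^ S : ℕ) : ℤ) := by
    intro j i
    have := (entries_natAbs_lt b hS j i).le
    rw [← Int.natAbs_mul_self' (entries b j i)]
    exact_mod_cast Nat.mul_le_mul this this
  have h2 : ∑ j ∈ Finset.range m, ∑ i ∈ Finset.range (m + 1), entries b j i * entries b j i ≤
      ((m * (m + 1) * (2 ^ S * 2 ^ S) : ℕ) : ℤ) := by
    calc _ ≤ ∑ j ∈ Finset.range m, ∑ i ∈ Finset.range (m + 1), ((2 ^ S * 2 ^ S : ℕ) : ℤ) :=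
          Finset.sum_le_sum fun j _ => Finset.sum_le_sum fun i _ => h1 j i
      _ = _ := by simp; ring
  have h3 : (m + 1) + m * (m + 1) * (2 ^ S * 2 ^ S) ≤ 2 ^ (4 * S) := by
    have hS2 : S < 2 ^ S := Nat.lt_two_pow_self
    have e : 2 ^ (4 * S) = 2 ^ S * 2 ^ S * (2 ^ S * 2 ^ S) := by
      rw [← pow_add, ← pow_add]; congr 1; ring
    rw [e]
    set A := 2 ^ S
    have h4 : m * (m + 1) + 1 ≤ A := by omega
    have h5 : m + 1 ≤ A := by nlinarith
    have h6 : 1 ≤ A * A := by nlinarith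
    have h7 : m * (m + 1) * (A * A) + A * A ≤ A * (A * A) := by nlinarith
    have h8 : A ≤ A * A := Nat.le_mul_self A
    have h9 : A * (A * A) ≤ A * A * (A * A) := Nat.mul_le_mul_right _ h8
    omega
  unfold inputSum
  have h3' : (((m + 1) + m * (m + 1) * (2 ^ S * 2 ^ S) : ℕ) : ℤ) ≤ (2 ^ (4 * S) : ℕ) := by
    exact_mod_cast h3
  push_cast at h2 h3' ⊢
  linarith

theorem modulusOf_le : modulusOf (entries b) m ≤ 2 ^ (8 * S ^ 2 + 2) := by
  have hc := card_le_size b hS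
  have hmS : m ≤ S := by nlinarith
  have hY : (inputSum m (entries b)).toNat ≤ 2 ^ (4 * S) := by
    exact Int.toNat_le.mpr (inputSum_le b hS)
  have h1 : ((inputSum m (entries b)).toNat * (inputSum m (entries b)).toNat) ^ m ≤
      2 ^ (8 * S ^ 2) := by
    calc _ ≤ (2 ^ (4 * S) * 2 ^ (4 * S)) ^ m := Nat.pow_le_pow_left (Nat.mul_le_mul hY hY) m
      _ = 2 ^ (8 * S * m) := by rw [← pow_add, ← pow_mul]; congr 1; ring
      _ ≤ 2 ^ (8 * S ^ 2) := Nat.pow_le_pow_right (by omega) (by nlinarith)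
  have h2 : 1 ≤ 2 ^ (8 * S ^ 2) := Nat.one_le_two_pow
  rw [modulusOf, pow_add]
  omega

theorem mul_modulusOf_le : (m + 2) * modulusOf (entries b) m ≤ 2 ^ (8 * S ^ 2 + 2 * S + 2) := by
  have hc := card_le_size b hS
  have h1 : m + 2 ≤ 2 ^ (2 * S) := by
    have hS2 : S < 2 ^ S := Nat.lt_two_pow_self
    have : 2 ^ S * 2 ^ S = 2 ^ (2 * S) := by rw [← pow_add]; congr 1; ring
    nlinarith
  calc _ ≤ 2 ^ (2 * S) * 2 ^ (8 * S ^ 2 + 2) := Nat.mul_le_mul h1 (modulusOf_le b hS)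
    _ = _ := by rw [← pow_add]; congr 1; ring

theorem cnt_modulusOf_le : cnt true (4 * ((modulusOf (entries b) m : ℤ) *
    modulusOf (entries b) m)) ≤ 16 * S ^ 2 + 2 * S + 7 := by
  have h := modulusOf_le b hS
  set t := modulusOf (entries b) m
  have h1 : (4 * ((t : ℤ) * t)).toNat = 4 * (t * t) := by
    rw [show (4 * ((t : ℤ) * t)) = ((4 * (t * t) : ℕ) : ℤ) by push_cast; ring, Int.toNat_natCast]
  simp only [cnt, if_true, h1]
  have h2 : 4 * (t * t) ≤ 2 ^ (16 * S ^ 2 + 6) := by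
    calc 4 * (t * t) ≤ 2 ^ 2 * (2 ^ (8 * S ^ 2 + 2) * 2 ^ (8 * S ^ 2 + 2)) :=
          Nat.mul_le_mul_left 4 (Nat.mul_le_mul h h)
      _ = _ := by rw [← pow_add, ← pow_add]; congr 1; ring
  have h3 := Nat.size_le_size h2
  rw [Nat.size_pow] at h3
  omega

end

theorem extMat_congr {m : ℕ} {D : ℤ} {H H' : ℕ → ℕ → ℤ}
    (h : ∀ a < m, ∀ c < m, H a c = H' a c) : extMat m D H = extMat m D H' := by
  funext a c
  unfold extMat
  split_ifs with h1 h2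
  · exact h a h1 c h2
  · rw [Finset.sum_congr rfl fun i hi => h a h1 i (Finset.mem_range.mp hi)]
  · rfl
  · rfl

/-- The program outputs the Laplacian in polynomial time. -/
theorem exists_polynomial : ∃ P : Polynomial ℕ, ∀ (m : ℕ) (L : Submodule ℤ (Fin (m + 1) → ℤ)),
    L ≤ sumZero (m + 1) → ∀ b : Module.Basis (Fin m) ℤ L,
    ∃ H, IsHNF (L.map (proj m)) H ∧
      OutputsInTime (main.comp 0 0) (encodeVectors fun j => (b j : Fin (m + 1) → ℤ))
        (encodeMatrix (lapMat m (extMat m (latticeDet L) H)))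
        (P.eval (size (encodeVectors fun j => (b j : Fin (m + 1) → ℤ)))) := by
  obtain ⟨K, hK⟩ := exists_outputsInTime main
  refine ⟨main.time.comp (16 * Polynomial.X ^ 2 + 2 * Polynomial.X + 7) *
    (5 * ((8 * Polynomial.X ^ 2 + 2 * Polynomial.X + 2) * Polynomial.C K + 2)),
    fun m L hL b => ?_⟩
  generalize hS : size (encodeVectors fun j => (b j : Fin (m + 1) → ℤ)) = S
  have hc := card_le_size _ hS
  have hmS : m + 1 ≤ S := by nlinarith
  have hx : ∀ k, k ≤ 8 * S ^ 2 + 2 * S + 2 → 2 ^ k ≤ 2 ^ (8 * S ^ 2 + 2 * S + 2) := fun k hk =>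
    Nat.pow_le_pow_right (by omega) hk
  obtain ⟨σ, ⟨H, hH, hout⟩, hrun⟩ := hK (16 * S ^ 2 + 2 * S + 7) (8 * S ^ 2 + 2 * S + 2)
    (encodeVectors fun j => (b j : Fin (m + 1) → ℤ)) _ (by omega)
    (fun z hz => (hS ▸ natAbs_lt_of_mem hz).le.trans (hx S (by omega)))
    (wp_main hL b ((inputSum_le _ hS).trans (by exact_mod_cast hx (4 * S) (by nlinarith)))
      (mul_modulusOf_le _ hS) (by
        have : 2 * S < 2 ^ (2 * S) := Nat.lt_two_pow_self
        have := hx (2 * S) (by omega)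
        omega) (by omega) (cnt_modulusOf_le _ hS))
  refine ⟨H, hH, ?_⟩
  rw [hout] at hrun
  simpa using hrun

end Prog

theorem theoremt :
    ∃ (p : RAM.Program) (P : Polynomial ℕ),
      ∀ (n : ℕ), 0 < n → ∀ (L : Submodule ℤ (Fin n → ℤ)), L ≤ sumZero n →
        Module.finrank ℤ L = n - 1 →
        ∃ G : DiMultigraph (Fin n),
          G.StronglyConnected ∧
          L = LinearMap.range G.laplacian.mulVecLin ∧
          (∀ v w : Fin n, |G.laplacian v w| ≤ (n : ℤ) * (latticeDet L : ℤ)) ∧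
          ∀ b : Module.Basis (Fin (n - 1)) ℤ L,
            RAM.OutputsInTime p (encodeVectors fun j => (b j : Fin n → ℤ))
              (encodeMatrix G.laplacian)
              (P.eval (RAM.size (encodeVectors fun j => (b j : Fin n → ℤ)))) := by
  obtain ⟨P, hP⟩ := Prog.exists_polynomial
  refine ⟨Prog.main.comp 0 0, P, fun n hn L hL hrank => ?_⟩
  obtain ⟨m, rfl⟩ : ∃ m, n = m + 1 := ⟨n - 1, by omega⟩
  let b₀ : Module.Basis (Fin m) ℤ L := Module.finBasisOfFinrankEq ℤ L hrank
  obtain ⟨H₀, hH₀, -⟩ := hP m L hL b₀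
  obtain ⟨G, hconn, hlap, hrange, hle⟩ := Prog.exists_digraph hL hH₀
    (by exact_mod_cast Prog.latticeDet_pos hL b₀) (Prog.single_latticeDet_mem hL b₀)
  refine ⟨G, hconn, hrange, hle, fun b => ?_⟩
  obtain ⟨H, hH, hout⟩ := hP m L hL b
  rw [hlap, ← Prog.extMat_congr fun a ha c hc => hH.unique hH₀ ha hc]
  exact hout
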